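/- Let $N\ge 2$, let $B$ be the open unit ball of $\mathbb{R}^N$ centered at $0$, $S=\partial B$, and $B_+=\{x\in B: x_N>0\}$. Let $\Omega\subset B_+$ be a domain whose boundary is $\partial\Omega=\overline{\Sigma}\cup T$, where $\Sigma=\partial\Omega\setminus\overline{T}$ is contained in $B_+$ and is a smooth hypersurface, on one side of which $\Omega$ lies locally, $T=\partial\Omega\setminus\overline{\Sigma}$ is a non-empty subset of $S$, and $\Lambda=\overline{\Sigma}\cap\overline{T}$ is a smooth $(N-2)$-dimensional submanifold of $S$. Let $\nu$ be the outward unit normal to $\partial\Omega$ on $\Sigma\cup T$, and let $u_\nu$ be the derivative in the direction $\nu$. Let $u\in C^\infty(\overline{\Omega}\setminus\Lambda)\cap C(\overline{\Omega})\cap W^{1,\infty}(\Omega)\cap W^{2,2}(\Omega)$ be a solution of $$\Delta u=N\ \text{ in }\Omega,\qquad u=0\ \text{ on }\Sigma,\qquad u_\nu=u\ \text{ on }T.$$ Let $e_N=(0,\dots,0,1)$, $X^q(x)=x_N\,x-\tfrac12(|x|^2+1)\,e_N$, and $$R=N\,\frac{\int_\Omega x_N\,dx}{\int_\Sigma x_N\,dS_x}.$$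 Suppose that for some constant $c\in\mathbb{R}$ the integral $$\frac12\int_\Sigma\left(u_\nu^2-c^2\right)\left[x_N\,u_\nu-\langle X^q,\nu\rangle\right]dS_x$$ exists and is non-positive, or, in particular, that $u_\nu$ is constant on $\Sigma$. Then $R>0$ and there is a point $z=(z',z_N)\in\mathbb{R}^{N-1}\times\mathbb{R}$ with $|z|=\sqrt{1+R^2}$ and $|z'|\le 1$ such that $$u(x)=\tfrac12\left(|x-z|^2-R^2\right)\quad\text{for } x\in\Omega .$$ Moreover, $\Sigma$ is the spherical cap $\{x\in B_+: |x-z|=R\}$, and it meets $T$ orthogonally along $\Lambda$. -/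

import Mathlib

open Set Filter Topology MeasureTheory
open scoped ContDiff RealInnerProductSpace

namespace HalfBallTorsion

/-- `ℝ^N` with `N = n + 1`; the last coordinate `x (Fin.last n)` is `x_N`. -/
abbrev E (n : ℕ) : Type := EuclideanSpace ℝ (Fin (n + 1))

variable {n : ℕ}

/-- The unit vector `e_N`. -/
noncomputable def eN (n : ℕ) : E n := EuclideanSpace.single (Fin.last n) (1 : ℝ)

/-- The open upper half-ball `B_+ = {x : |x| < 1, x_N > 0}`. -/
def halfBall (n : ℕ) : Set (E n) := {x | ‖x‖ < 1 ∧ 0 < x (Fin.last n)}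

/-- The horizontal part `(z', 0)` of `z = (z', z_N)`. -/
noncomputable def horizontal (z : E n) : E n := z - z (Fin.last n) • eN n

/-- The conformal Killing field `X^q = x_N x - (|x|² + 1) / 2 e_N`. -/
noncomputable def killing (x : E n) : E n :=
  x (Fin.last n) • x - ((‖x‖ ^ 2 + 1) / 2) • eN n

/-- `φ` is a smooth defining function of `Ω` near the boundary point `p`: it is smooth near `p`,
`φ p = 0`, `∇φ p ≠ 0`, and near `p` the set `Ω` is `{φ < 0}`. Hence near `p` the boundary of `Ω` is
the smooth embedded hypersurface `{φ = 0}`, and `Ω` lies on one side of it. -/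
def IsDefiningFunctionAt (Ω : Set (E n)) (p : E n) (φ : E n → ℝ) : Prop :=
  φ p = 0 ∧ gradient φ p ≠ 0 ∧
    ∃ U : Set (E n), IsOpen U ∧ p ∈ U ∧ ContDiffOn ℝ ∞ φ U ∧ ∀ x ∈ U, (x ∈ Ω ↔ φ x < 0)

/-- `v` is the outward unit normal to `∂Ω` at the point `p`, near which `∂Ω` is smooth. -/
def IsOutwardUnitNormal (Ω : Set (E n)) (p v : E n) : Prop :=
  ∃ φ : E n → ℝ, IsDefiningFunctionAt Ω p φ ∧ v = ‖gradient φ p‖⁻¹ • gradient φ p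

open Classical in
/-- The outward unit normal `ν` to `∂Ω`, with the value `0` at points near which `∂Ω` is not
smooth. It does not depend on the defining function, see `IsOutwardUnitNormal.unique`. -/
noncomputable def outwardNormal (Ω : Set (E n)) (p : E n) : E n :=
  if h : ∃ v, IsOutwardUnitNormal Ω p v then h.choose else 0

/-- The normal derivative `u_ν` at a boundary point: the derivative of `u` (one-sided, taken within
the closure of `Ω`) in the direction of the outward unit normal. -/
noncomputable def normalDeriv (Ω : Set (E n)) (u : E n → ℝ) (x : E n) : ℝ :=
  fderivWithin ℝ u (closure Ω) x (outwardNormal Ω x)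

/-- `Λ` is a smooth embedded submanifold of the unit sphere `S` of codimension one in `S`, that is
of dimension `N - 2`: near each of its points it is the zero set in `S` of a smooth function whose
differential does not vanish on the tangent space of `S`. -/
def IsSphereHypersurface (Λ : Set (E n)) : Prop :=
  ∀ p ∈ Λ, ∃ (g : E n → ℝ) (U : Set (E n)), IsOpen U ∧ p ∈ U ∧ ContDiffOn ℝ ∞ g U ∧
    (∀ x ∈ U, (x ∈ Λ ↔ ‖x‖ = 1 ∧ g x = 0)) ∧ ∃ w : E n, ⟪p, w⟫ = 0 ∧ fderiv ℝ g p w ≠ 0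

/-- The geometric setting: a domain `Ω ⊆ B_+` whose boundary consists of the smooth hypersurface
`Sg = ∂Ω \ closure T` (the `Σ` of the text), contained in `B_+`, and of the nonempty part
`T = ∂Ω \ closure Sg` of the unit sphere, whose closures meet at a common `(N-2)`-dimensional
submanifold of the sphere. -/
structure IsCapDomain (Ω Sg T : Set (E n)) : Prop where
  isOpen : IsOpen Ω
  isConnected : IsConnected Ω
  subset_halfBall : Ω ⊆ halfBall n
  surface_eq : Sg = frontier Ω \ closure T
  surface_subset : Sg ⊆ halfBall n
  surface_smooth : ∀ p ∈ Sg, ∃ φ, IsDefiningFunctionAt Ω p φ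
  cap_eq : T = frontier Ω \ closure Sg
  cap_subset : T ⊆ Metric.sphere 0 1
  cap_nonempty : T.Nonempty
  frontier_eq : frontier Ω = closure Sg ∪ T
  edge : IsSphereHypersurface (closure Sg ∩ closure T)

/-- Membership in `W^{k,p}(Ω)` of a function that is smooth in the open set `Ω`: its weak
derivatives are the classical ones, and those of order at most `k` have to be in `L^p(Ω)`. -/
def SmoothMemSobolev (k : ℕ) (p : ENNReal) (Ω : Set (E n)) (u : E n → ℝ) : Prop :=
  ContDiffOn ℝ ∞ u Ω ∧
    ∀ j ≤ k, MemLp (fun x => iteratedFDeriv ℝ j u x) p (volume.restrict Ω)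

/-- `u`, in `C^∞(closure Ω \ Λ) ∩ C(closure Ω)` with `Λ = closure Sg ∩ closure T`, and in
`W^{1,∞}(Ω) ∩ W^{2,2}(Ω)`, is a solution of
`Δu = N` in `Ω`, `u = 0` on `Sg`, `u_ν = u` on `T`. -/
structure IsSolution (Ω Sg T : Set (E n)) (u : E n → ℝ) : Prop where
  smooth : ContDiffOn ℝ ∞ u (closure Ω \ (closure Sg ∩ closure T))
  continuousOn : ContinuousOn u (closure Ω)
  lipschitz : SmoothMemSobolev 1 ⊤ Ω u
  sobolev : SmoothMemSobolev 2 2 Ω u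
  laplacian : ∀ x ∈ Ω, Laplacian.laplacian u x = (n : ℝ) + 1
  dirichlet : ∀ x ∈ Sg, u x = 0
  steklov : ∀ x ∈ T, normalDeriv Ω u x = u x

/-- The integrand `(u_ν² - c²) [x_N u_ν - ⟨X^q, ν⟩]` on `Sg` of the right-hand side of the
fundamental identity. -/
noncomputable def rhsIntegrand (Ω : Set (E n)) (u : E n → ℝ) (c : ℝ) (x : E n) : ℝ :=
  (normalDeriv Ω u x ^ 2 - c ^ 2) *
    (x (Fin.last n) * normalDeriv Ω u x - ⟪killing x, outwardNormal Ω x⟫)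

/-- The right-hand side `½ ∫_Sg (u_ν² - c²) [x_N u_ν - ⟨X^q, ν⟩] dS` of the fundamental identity;
`μHE[n]` is the `(N-1)`-dimensional Hausdorff measure, normalized to be the surface area. -/
noncomputable def fundamentalRHS (Ω Sg : Set (E n)) (u : E n → ℝ) (c : ℝ) : ℝ :=
  1 / 2 * ∫ x in Sg, rhsIntegrand Ω u c x ∂μHE[n]

/-- The number `R = N ∫_Ω x_N dx / ∫_Sg x_N dS`. -/
noncomputable def radius (Ω Sg : Set (E n)) : ℝ :=
  ((n : ℝ) + 1) * (∫ x in Ω, x (Fin.last n)) / ∫ x in Sg, x (Fin.last n) ∂μHE[n]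

/-- `Sg` and `T` meet orthogonally along `closure Sg ∩ closure T`: the inner product of the unit
normals at points of `Sg` and of `T` tends to `0` as both points tend to a common point. -/
def MeetOrthogonally (Ω Sg T : Set (E n)) : Prop :=
  ∀ p ∈ closure Sg ∩ closure T,
    Tendsto (fun q : E n × E n => ⟪outwardNormal Ω q.1, outwardNormal Ω q.2⟫)
      (𝓝[Sg] p ×ˢ 𝓝[T] p) (𝓝 0)

theorem IsDefiningFunctionAt.hasGradientAt {Ω : Set (E n)} {p : E n} {φ : E n → ℝ}
    (h : IsDefiningFunctionAt Ω p φ) : HasGradientAt φ (gradient φ p) p := by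
  obtain ⟨-, -, U, hU, hp, hs, -⟩ := h
  exact ((hs.contDiffAt (hU.mem_nhds hp)).differentiableAt (by simp)).hasGradientAt

/-- Along a ray from `p` in a direction `v` with `⟨∇φ(p), v⟩ = d`, the difference quotients of `φ`
tend to `d`, and the ray stays in the neighbourhood where `Ω = {φ < 0}`. -/
theorem IsDefiningFunctionAt.tendsto_ray {Ω : Set (E n)} {p : E n} {φ : E n → ℝ}
    (h : IsDefiningFunctionAt Ω p φ) (v : E n) :
    Tendsto (fun t : ℝ => φ (p + t • v) / t) (𝓝[>] 0) (𝓝 ⟪gradient φ p, v⟫) ∧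
      ∀ᶠ t : ℝ in 𝓝[>] 0, (p + t • v ∈ Ω ↔ φ (p + t • v) < 0) := by
  have hg := h.hasGradientAt.hasFDerivAt
  obtain ⟨h0, -, U, hU, hp, -, hiff⟩ := h
  have hline : HasDerivAt (fun t : ℝ => p + t • v) v 0 := by
    simpa using ((hasDerivAt_id (0 : ℝ)).smul_const v).const_add p
  constructor
  · have hd : HasDerivAt (fun t : ℝ => φ (p + t • v)) ⟪gradient φ p, v⟫ 0 :=
      hg.hasLineDerivAt v
    have hs := hasDerivAt_iff_tendsto_slope_zero.1 hd
    have hs' : Tendsto _ (𝓝[>] (0 : ℝ)) _ :=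
      hs.mono_left (nhdsWithin_mono (0 : ℝ) (fun t (ht : 0 < t) => ne_of_gt ht))
    refine hs'.congr fun t => ?_
    simp [h0, div_eq_inv_mul]
  · have hc : Tendsto (fun t : ℝ => p + t • v) (𝓝[>] 0) (𝓝 p) := by
      have := hline.continuousAt.tendsto
      simp only [zero_smul, add_zero] at this
      exact this.mono_left nhdsWithin_le_nhds
    filter_upwards [hc.eventually (hU.mem_nhds hp)] with t ht using hiff _ ht

theorem IsDefiningFunctionAt.inner_nonpos {Ω : Set (E n)} {p v : E n} {φ ψ : E n → ℝ}
    (h : IsDefiningFunctionAt Ω p φ) (h' : IsDefiningFunctionAt Ω p ψ)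
    (hv : ⟪gradient φ p, v⟫ < 0) : ⟪gradient ψ p, v⟫ ≤ 0 := by
  obtain ⟨h1, h2⟩ := h.tendsto_ray v
  obtain ⟨h1', h2'⟩ := h'.tendsto_ray v
  refine le_of_tendsto h1' ?_
  filter_upwards [h1.eventually (gt_mem_nhds hv), h2, h2', self_mem_nhdsWithin] with t a b c ht
  have ht : 0 < t := ht
  have hneg : φ (p + t • v) < 0 := by
    by_contra! hc
    exact absurd (div_nonneg hc ht.le) (not_le.2 a)
  exact (div_neg_of_neg_of_pos (c.1 (b.2 hneg)) ht).le

theorem IsOutwardUnitNormal.unique {Ω : Set (E n)} {p v w : E n}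
    (hv : IsOutwardUnitNormal Ω p v) (hw : IsOutwardUnitNormal Ω p w) : v = w := by
  obtain ⟨φ, hφ, rfl⟩ := hv
  obtain ⟨ψ, hψ, rfl⟩ := hw
  have ha : 0 < ‖gradient φ p‖ := norm_pos_iff.2 hφ.2.1
  have hb : 0 < ‖gradient ψ p‖ := norm_pos_iff.2 hψ.2.1
  have key := fun v => hφ.inner_nonpos hψ (v := v)
  set a := gradient φ p
  set b := gradient ψ p
  have ha1 : ‖‖a‖⁻¹ • a‖ = 1 := by rw [norm_smul, norm_inv, norm_norm, inv_mul_cancel₀ ha.ne']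
  have hb1 : ‖‖b‖⁻¹ • b‖ = 1 := by rw [norm_smul, norm_inv, norm_norm, inv_mul_cancel₀ hb.ne']
  by_contra hne
  have hlt : ⟪‖a‖⁻¹ • a, ‖b‖⁻¹ • b⟫ < 1 := by
    exact (inner_lt_one_iff_real_of_norm_eq_one ha1 hb1).2 hne
  have e1 : ⟪‖a‖⁻¹ • a, ‖b‖⁻¹ • b - ‖a‖⁻¹ • a⟫ < 0 := by
    rw [inner_sub_right, real_inner_self_eq_norm_sq, ha1]; linarith
  have e2 : 0 < ⟪‖b‖⁻¹ • b, ‖b‖⁻¹ • b - ‖a‖⁻¹ • a⟫ := by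
    rw [inner_sub_right, real_inner_self_eq_norm_sq, hb1, real_inner_comm]; linarith
  rw [real_inner_smul_left] at e1 e2
  have f1 := (mul_neg_iff.1 e1).resolve_right
    (fun h => absurd h.1 (not_lt.2 (inv_pos.2 ha).le)) |>.2
  have f2 := (pos_iff_pos_of_mul_pos e2).1 (inv_pos.2 hb)
  exact absurd (key _ f1) (not_le.2 f2)

theorem outwardNormal_eq {Ω : Set (E n)} {p v : E n} (hv : IsOutwardUnitNormal Ω p v) :
    outwardNormal Ω p = v := by
  have h : ∃ v, IsOutwardUnitNormal Ω p v := ⟨v, hv⟩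
  rw [outwardNormal, dif_pos h]
  exact h.choose_spec.unique hv

end HalfBallTorsion

open HalfBallTorsion

namespace HalfBallTorsion

/-! Let A = x_N ∇u - u e_N, W = A - X^q (`freeField`) and M = D²u - I. The fields A and X^q both
have divergence N x_N and are tangential on T, so W is divergence free and tangential on T. The
derivative of W is x_N M plus a skew endomorphism. Since M is symmetric and Δu is constant, the
field F = (½|∇u|² - u - c²/2) W - u M W satisfies div F = -u x_N tr(M²) (`divg_fundamental`). On T
its normal component vanishes, because differentiating ⟨∇u, x⟩ = u along T shows that D²u maps
tangent vectors to tangent vectors. On Σ, where u = 0 and |∇u|² = u_ν², its normal component is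
exactly half of the given integrand.

The solution satisfies u ≤ 0: since A = x_N² ∇(u/x_N), a maximum principle for u/x_N follows by
testing with a cutoff of this quotient (`nonpos`). Hence div F ≥ 0, while the total flux of F is
non-positive by assumption, so div F = 0 and M = 0 wherever u ≠ 0. Since Δu = N, the zero set of u
has empty interior, and M = 0 throughout Ω (`hess_eq_id`). Thus u = ½(|x - z|² - ρ²). The condition
on T gives |z|² = 1 + ρ² (`exists_center`), and a connectedness argument shows that Ω is the lens of
the unit ball and the ball of radius ρ about z (`eq_inter_ball`); the remaining geometry is read off
from it. The divergence theorem for A identifies ρ with R (`radius_eq`).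

The analytic work is the divergence theorem up to the singular edge Λ, with the flux taken with
respect to Hausdorff measure. Near a smooth boundary point a field splits into a part tangential to
the level sets of a defining function, which contributes nothing, and a multiple of a fixed
direction, which is integrated along lines. This gives the flux as an integral over a tangent
hyperplane. Lipschitz bounds in both directions compare it with the flux over the hypersurface up to
a small relative error, and a partition of unity into small pieces removes the error
(`integral_divg_smul_eq_integral_flux`). The edge has codimension two, so its δ-neighbourhood has
volume O(δ²); cutoffs with gradient of size 1/δ are then negligible against square integrable fields
(`exists_isCutoffSequence`). This is what D²u ∈ L² and bounded u, ∇u provide for F. -/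

variable {n : ℕ}

/-! ### Trace, divergence, and compactly supported fields -/

/-- The trace of an endomorphism of `ℝ^N`. -/
noncomputable def tr (A : E n →L[ℝ] E n) : ℝ :=
  ∑ i, ⟪EuclideanSpace.basisFun (Fin (n + 1)) ℝ i, A (EuclideanSpace.basisFun (Fin (n + 1)) ℝ i)⟫

/-- The divergence of a vector field. -/
noncomputable def divg (F : E n → E n) (x : E n) : ℝ := tr (fderiv ℝ F x)

theorem tr_add (A B : E n →L[ℝ] E n) : tr (A + B) = tr A + tr B := by
  simp [tr, inner_add_right, Finset.sum_add_distrib]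

theorem tr_sub (A B : E n →L[ℝ] E n) : tr (A - B) = tr A - tr B := by
  simp [tr, inner_sub_right, Finset.sum_sub_distrib]

theorem tr_smul (c : ℝ) (A : E n →L[ℝ] E n) : tr (c • A) = c * tr A := by
  simp [tr, inner_smul_right, Finset.mul_sum]

theorem tr_id : tr (ContinuousLinearMap.id ℝ (E n)) = n + 1 := by
  simp [tr]

theorem tr_smulRight (l : E n →L[ℝ] ℝ) (v : E n) : tr (l.smulRight v) = l v := by
  simp only [tr, ContinuousLinearMap.smulRight_apply, inner_smul_right]
  conv_rhs => rw [← (EuclideanSpace.basisFun (Fin (n + 1)) ℝ).sum_repr' v]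
  rw [map_sum]
  refine Finset.sum_congr rfl fun i _ => ?_
  rw [map_smul, smul_eq_mul, mul_comm]

theorem continuous_tr : Continuous (tr : (E n →L[ℝ] E n) → ℝ) := by
  unfold tr
  fun_prop

theorem abs_tr_le (A : E n →L[ℝ] E n) : |tr A| ≤ (n + 1) * ‖A‖ := by
  unfold tr
  refine (Finset.abs_sum_le_sum_abs _ _).trans ?_
  have : ∀ i ∈ Finset.univ, |⟪EuclideanSpace.basisFun (Fin (n + 1)) ℝ i,
      A (EuclideanSpace.basisFun (Fin (n + 1)) ℝ i)⟫| ≤ ‖A‖ := fun i _ => by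
    refine (abs_real_inner_le_norm _ _).trans ?_
    have h1 := (EuclideanSpace.basisFun (Fin (n + 1)) ℝ).norm_eq_one i
    have h2 := A.le_opNorm (EuclideanSpace.basisFun (Fin (n + 1)) ℝ i)
    rw [h1] at h2 ⊢
    linarith
  refine (Finset.sum_le_sum this).trans ?_
  simp

theorem divg_smul {f : E n → ℝ} {F : E n → E n} {x : E n} (hf : DifferentiableAt ℝ f x)
    (hF : DifferentiableAt ℝ F x) :
    divg (fun y => f y • F y) x = f x * divg F x + fderiv ℝ f x (F x) := by
  unfold divg
  rw [fderiv_fun_smul hf hF, tr_add, tr_smul, tr_smulRight]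

theorem divg_sub {F G : E n → E n} {x : E n} (hF : DifferentiableAt ℝ F x)
    (hG : DifferentiableAt ℝ G x) : divg (fun y => F y - G y) x = divg F x - divg G x := by
  unfold divg
  rw [fderiv_fun_sub hF hG, tr_sub]

theorem divg_eq_sum {F : E n → E n} {x : E n} (hF : DifferentiableAt ℝ F x) :
    divg F x = ∑ i, fderiv ℝ (fun y => ⟪EuclideanSpace.basisFun (Fin (n + 1)) ℝ i, F y⟫) x
      (EuclideanSpace.basisFun (Fin (n + 1)) ℝ i) := by
  unfold divg tr
  refine Finset.sum_congr rfl fun i _ => ?_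
  rw [fderiv_inner_apply ℝ (by fun_prop) hF]
  simp

/-- This is integration by parts against the constant function 1. -/
theorem integral_fderiv_apply_eq_zero {q : E n → ℝ} (hq : ContDiff ℝ 1 q)
    (hc : HasCompactSupport q) (v : E n) : ∫ x, fderiv ℝ q x v = 0 := by
  have h := integral_mul_fderiv_eq_neg_fderiv_mul_of_integrable (μ := (volume : Measure (E n)))
    (f := fun _ : E n => (1 : ℝ)) (g := q) (v := v) (by simp) ?_ ?_
    (fun _ _ => by fun_prop) (fun x _ => (hq.differentiable one_ne_zero).differentiableAt)
  · simpa using h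
  · simp only [one_mul]
    exact ((hq.continuous_fderiv
      one_ne_zero).clm_apply continuous_const).integrable_of_hasCompactSupport
      (hc.fderiv_apply ℝ v)
  · simpa using hq.continuous.integrable_of_hasCompactSupport hc

theorem integral_divg_eq_zero {G : E n → E n} (hG : ContDiff ℝ 1 G) (hc : HasCompactSupport G) :
    ∫ x, divg G x = 0 := by
  have hd : Differentiable ℝ G := hG.differentiable one_ne_zero
  simp_rw [fun x => divg_eq_sum (hd x)]
  have hq : ∀ i, ContDiff ℝ 1 (fun y => ⟪EuclideanSpace.basisFun (Fin (n + 1)) ℝ i, G y⟫) :=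
    fun i => contDiff_const.inner ℝ hG
  have hs : ∀ i, HasCompactSupport (fun y => ⟪EuclideanSpace.basisFun (Fin (n + 1)) ℝ i, G y⟫) :=
    fun i => hc.comp_left (g := fun v => ⟪EuclideanSpace.basisFun (Fin (n + 1)) ℝ i, v⟫)
      (inner_zero_right _)
  rw [integral_finsetSum]
  · exact Finset.sum_eq_zero fun i _ => integral_fderiv_apply_eq_zero (hq i) (hs i) _
  · intro i _
    exact (((hq i).continuous_fderiv one_ne_zero).clm_apply
      continuous_const).integrable_of_hasCompactSupport ((hs i).fderiv_apply ℝ _)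

/-! ### Integration along parallel lines; derivatives up to the boundary -/

/-- Fubini's theorem along the lines parallel to a unit vector. -/
theorem measurePreserving_line {e : E n} (he : ‖e‖ = 1) (p : E n) :
    MeasurePreserving (fun y : (ℝ ∙ e)ᗮ × ℝ => p + (y.2 • e + y.1)) volume volume := by
  have h1 := (ℝ ∙ e).measurePreserving_measurableEquivProd p
  rw [InnerProductSpace.euclideanHausdorffMeasure_eq_volume] at h1
  have h1 := h1.symm
  have h2 : MeasurePreserving (LinearIsometryEquiv.toSpanUnitSingleton (𝕜 := ℝ) e he)
    volume volume := LinearIsometryEquiv.measurePreserving _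
  have h3 : MeasurePreserving (Prod.map (LinearIsometryEquiv.toSpanUnitSingleton (𝕜 := ℝ) e he)
    (id : (ℝ ∙ e)ᗮ → (ℝ ∙ e)ᗮ)) volume volume := h2.prod (MeasurePreserving.id _)
  have h4 : MeasurePreserving (Prod.swap : (ℝ ∙ e)ᗮ × ℝ → ℝ × (ℝ ∙ e)ᗮ) volume volume :=
    Measure.measurePreserving_swap
  have h5 := h1.comp (h3.comp h4)
  have h6 : (fun y : (ℝ ∙ e)ᗮ × ℝ => p + (y.2 • e + y.1)) =
      ((ℝ ∙ e).measurableEquivProd p).symm ∘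
        Prod.map (LinearIsometryEquiv.toSpanUnitSingleton (𝕜 := ℝ) e he) id ∘ Prod.swap := by
    funext y
    simp [add_comm]
  rw [h6]
  exact h5

theorem measurableEmbedding_line {e : E n} (he : ‖e‖ = 1) (p : E n) :
    MeasurableEmbedding (fun y : (ℝ ∙ e)ᗮ × ℝ => p + (y.2 • e + y.1)) := by
  have hi : Function.Injective (fun y : (ℝ ∙ e)ᗮ × ℝ => p + (y.2 • e + y.1)) := by
    intro y z h
    have h : y.2 • e + (y.1 : E n) = z.2 • e + z.1 := add_left_cancel h
    have hy : ⟪e, (y.1 : E n)⟫ = 0 := Submodule.mem_orthogonal_singleton_iff_inner_right.1 y.1.2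
    have hz : ⟪e, (z.1 : E n)⟫ = 0 := Submodule.mem_orthogonal_singleton_iff_inner_right.1 z.1.2
    have h2 : y.2 = z.2 := by
      have := congrArg (fun v => ⟪e, v⟫) h
      simpa [inner_add_right, inner_smul_right, hy, hz, he] using this
    have h1 : (y.1 : E n) = z.1 := by
      rw [h2] at h
      exact add_left_cancel h
    exact Prod.ext (Subtype.ext h1) h2
  have hc : Continuous (fun y : (ℝ ∙ e)ᗮ × ℝ => p + (y.2 • e + y.1)) := by fun_prop
  exact hc.measurableEmbedding hi

theorem integral_eq_integral_line {e : E n} (he : ‖e‖ = 1) (p : E n) {f : E n → ℝ}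
    (hf : Integrable f) :
    ∫ x, f x = ∫ h : (ℝ ∙ e)ᗮ, ∫ t : ℝ, f (p + (t • e + h)) := by
  have hm := measurePreserving_line he p
  have hemb := measurableEmbedding_line he p
  rw [← hm.integral_comp hemb, Measure.volume_eq_prod, integral_prod]
  exact (hm.integrable_comp_emb hemb).2 hf

section BoundaryRegularity

variable {F : Type*} [NormedAddCommGroup F] [NormedSpace ℝ F]

/-- A function that is `C^1` up to the boundary of `Ω` within an open set `U`, with compact support
in `U`, has a continuous and bounded derivative in `Ω`. -/
theorem fderiv_bounded_of_tsupport_subset {Ω U : Set (E n)} (hΩ : IsOpen Ω) (hU : IsOpen U)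
    {q : E n → F} (hq : ContDiffOn ℝ 1 q (closure Ω ∩ U)) (hc : HasCompactSupport q)
    (hs : tsupport q ⊆ U) :
    ContDiffOn ℝ 1 q Ω ∧ ContinuousOn (fderiv ℝ q) Ω ∧ ∃ C, ∀ x ∈ Ω, ‖fderiv ℝ q x‖ ≤ C := by
  have hat : ∀ x ∈ Ω, ContDiffAt ℝ 1 q x := by
    intro x hx
    by_cases hxs : x ∈ tsupport q
    · refine (hq x ⟨subset_closure hx, hs hxs⟩).contDiffAt ?_
      exact Filter.mem_of_superset ((hΩ.inter hU).mem_nhds ⟨hx, hs hxs⟩)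
        (inter_subset_inter_left _ subset_closure)
    · have h0 : q =ᶠ[𝓝 x] fun _ => 0 := notMem_tsupport_iff_eventuallyEq.1 hxs
      exact contDiffAt_const.congr_of_eventuallyEq h0
  have hcd : ContDiffOn ℝ 1 q Ω := fun x hx => (hat x hx).contDiffWithinAt
  have hcont : ContinuousOn (fderiv ℝ q) Ω := hcd.continuousOn_fderiv_of_isOpen hΩ le_rfl
  refine ⟨hcd, hcont, ?_⟩
  -- At a boundary point the one-sided derivative `f'` is continuous within the closure and agrees
  -- with the full derivative at interior points, so it gives a local bound. Compactness of the
  -- support then makes the bound uniform.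
  have hloc : ∀ x, ∃ V ∈ 𝓝 x, ∃ C, ∀ y ∈ V ∩ Ω, ‖fderiv ℝ q y‖ ≤ C := by
    intro x
    by_cases hxs : x ∈ tsupport q
    · by_cases hxc : x ∈ closure Ω
      · have hxK : x ∈ closure Ω ∩ U := ⟨hxc, hs hxs⟩
        obtain ⟨u, hu, -, -, f', hf', hf'c⟩ :=
          (contDiffWithinAt_succ_iff_hasFDerivWithinAt' (n := 0) (by simp)).1 (hq x hxK)
        rw [insert_eq_of_mem hxK] at hu
        have hfc : ContinuousWithinAt f' (closure Ω ∩ U) x := by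
          exact hf'c.continuousWithinAt
        have hb := hfc.norm.tendsto.eventually (gt_mem_nhds (lt_add_one ‖f' x‖))
        have hboth := hb.and (show ∀ᶠ y in 𝓝[closure Ω ∩ U] x, y ∈ u from hu)
        rw [eventually_nhdsWithin_iff] at hboth
        obtain ⟨V, hVs, hVo, hxV⟩ := mem_nhds_iff.1 hboth
        refine ⟨V ∩ U, (hVo.inter hU).mem_nhds ⟨hxV, hs hxs⟩, ‖f' x‖ + 1, ?_⟩
        rintro y ⟨⟨hyV, hyU⟩, hyΩ⟩
        obtain ⟨h1, h2⟩ := hVs hyV ⟨subset_closure hyΩ, hyU⟩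
        have : HasFDerivAt q (f' y) y := (hf' y h2).hasFDerivAt
          (Filter.mem_of_superset ((hΩ.inter hU).mem_nhds ⟨hyΩ, hyU⟩)
            (inter_subset_inter_left _ subset_closure))
        rw [this.fderiv]
        exact h1.le
      · refine ⟨(closure Ω)ᶜ, isClosed_closure.isOpen_compl.mem_nhds hxc, 0, ?_⟩
        rintro y ⟨hy, hyΩ⟩
        exact absurd (subset_closure hyΩ) hy
    · have h0 : q =ᶠ[𝓝 x] fun _ => 0 := notMem_tsupport_iff_eventuallyEq.1 hxs
      have h1 := h0.eventuallyEq_nhds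
      refine ⟨_, h1, 0, ?_⟩
      rintro y ⟨hy, -⟩
      have hy : q =ᶠ[𝓝 y] fun _ => 0 := hy
      rw [hy.fderiv_eq]
      simp
  choose V hV C hC using hloc
  obtain ⟨t, -, ht⟩ := hc.isCompact.elim_nhds_subcover V (fun x _ => hV x)
  obtain ⟨M, hM⟩ : ∃ M, ∀ x ∈ t, C x ≤ M := by
    obtain ⟨M, hM⟩ := (t.image fun x => C x).bddAbove
    exact ⟨M, fun x hx => hM (Finset.mem_coe.2 (Finset.mem_image_of_mem _ hx))⟩
  refine ⟨max M 0, fun y hy => ?_⟩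
  by_cases hys : y ∈ tsupport q
  · obtain ⟨x, hxt, hyx⟩ := mem_iUnion₂.1 (ht hys)
    exact (hC x y ⟨hyx, hy⟩).trans ((hM x hxt).trans (le_max_left _ _))
  · have h0 : q =ᶠ[𝓝 y] fun _ => 0 := notMem_tsupport_iff_eventuallyEq.1 hys
    rw [h0.fderiv_eq]
    simp

end BoundaryRegularity

theorem integrableOn_of_continuousOn_of_bounded {Ω : Set (E n)} (hΩ : IsOpen Ω)
    (hb : Bornology.IsBounded Ω) {g : E n → ℝ} (hg : ContinuousOn g Ω) {C : ℝ}
    (hC : ∀ x ∈ Ω, |g x| ≤ C) : IntegrableOn g Ω := by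
  have : IsFiniteMeasure (volume.restrict Ω) := ⟨by simpa using hb.measure_lt_top⟩
  refine Integrable.of_bound (hg.aestronglyMeasurable hΩ.measurableSet) C ?_
  exact (ae_restrict_iff' hΩ.measurableSet).2 (Eventually.of_forall hC)

/-! ### Graph charts at smooth boundary points -/

/-- A ball of radius `3 r` around a boundary point `p` in which the defining function `φ` is close
to the linear function with gradient `a • e`. -/
structure GraphChart (Ω : Set (E n)) (φ : E n → ℝ) (p e : E n) (κ a r : ℝ) : Prop where
  norm_e : ‖e‖ = 1
  a_pos : 0 < a
  κ_pos : 0 < κ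
  κ_le : κ ≤ 1 / 4
  r_pos : 0 < r
  zero : φ p = 0
  smooth : ContDiffOn ℝ ∞ φ (Metric.ball p (3 * r))
  mem_iff : ∀ x ∈ Metric.ball p (3 * r), (x ∈ Ω ↔ φ x < 0)
  approx : ∀ x ∈ Metric.ball p (3 * r), ∀ y ∈ Metric.ball p (3 * r),
    |φ y - φ x - a * ⟪e, y - x⟫| ≤ κ * a * ‖y - x‖

/-- Strict differentiability of `φ` at `p` provides the affine approximation between any two nearby
points, with tilt `κ` as small as desired. -/
theorem IsDefiningFunctionAt.exists_graphChart {Ω : Set (E n)} {p : E n} {φ : E n → ℝ}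
    (h : IsDefiningFunctionAt Ω p φ) {κ : ℝ} (hκ : 0 < κ) (hκ' : κ ≤ 1 / 4) {δ : ℝ} (hδ : 0 < δ) :
    ∃ r ≤ δ, GraphChart Ω φ p (‖gradient φ p‖⁻¹ • gradient φ p) κ ‖gradient φ p‖ r := by
  have hg := h.hasGradientAt
  obtain ⟨h0, hne, U, hU, hpU, hs, hiff⟩ := h
  have ha : 0 < ‖gradient φ p‖ := norm_pos_iff.2 hne
  have hst : HasStrictFDerivAt φ (fderiv ℝ φ p) p :=
    (hs.contDiffAt (hU.mem_nhds hpU)).hasStrictFDerivAt (by simp)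
  have hka : 0 < κ * ‖gradient φ p‖ := mul_pos hκ ha
  obtain ⟨c, hcka⟩ : ∃ c : NNReal, (c : ℝ) = κ * ‖gradient φ p‖ :=
    ⟨(κ * ‖gradient φ p‖).toNNReal, Real.coe_toNNReal _ hka.le⟩
  obtain ⟨s, hsp, hsa⟩ := hst.approximates_deriv_on_nhds (c := c)
    (Or.inr (by rw [← NNReal.coe_pos, hcka]; exact hka))
  obtain ⟨R, hR, hRs⟩ := Metric.mem_nhds_iff.1 (Filter.inter_mem hsp (hU.mem_nhds hpU))
  have hsub : Metric.ball p (3 * min δ (R / 3)) ⊆ s ∩ U :=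
    (Metric.ball_subset_ball (by linarith [min_le_right δ (R / 3)])).trans hRs
  refine ⟨min δ (R / 3), min_le_left _ _, ?_, ha, hκ, hκ', lt_min hδ (by positivity), h0,
    hs.mono (hsub.trans inter_subset_right), fun x hx => hiff x (hsub hx).2, ?_⟩
  · rw [norm_smul, norm_inv, norm_norm, inv_mul_cancel₀ ha.ne']
  · intro x hx y hy
    have h1 := hsa y (hsub hy).1 x (hsub hx).1
    rw [real_inner_smul_left, mul_inv_cancel_left₀ ha.ne']
    rw [hg.hasFDerivAt.fderiv] at h1
    rw [hcka] at h1
    simpa using h1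

theorem hasCompactSupport_of_tsupport_subset_ball {q : E n → ℝ} {p : E n} {r : ℝ}
    (hs : tsupport q ⊆ Metric.ball p r) : HasCompactSupport q :=
  (isCompact_closedBall p r).of_isClosed_subset (isClosed_tsupport q)
    (hs.trans Metric.ball_subset_closedBall)

namespace GraphChart

variable {Ω : Set (E n)} {φ : E n → ℝ} {p e : E n} {κ a r : ℝ}

/-- The approximation property says that `φ - a ⟪e, ·⟫` is Lipschitz with constant `κ * a`, which
bounds its derivative. -/
theorem abs_fderiv_sub_le (h : GraphChart Ω φ p e κ a r) {x : E n}
    (hx : x ∈ Metric.ball p (3 * r)) (v : E n) :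
    |fderiv ℝ φ x v - a * ⟪e, v⟫| ≤ κ * a * ‖v‖ := by
  have hnb := Metric.isOpen_ball.mem_nhds hx
  have hd : DifferentiableAt ℝ φ x := (h.smooth.contDiffAt hnb).differentiableAt (by simp)
  have hka : 0 ≤ κ * a := (mul_pos h.κ_pos h.a_pos).le
  have hl : LipschitzOnWith ⟨κ * a, hka⟩ (fun y => φ y - a * ⟪e, y⟫) (Metric.ball p (3 * r)) := by
    refine LipschitzOnWith.of_dist_le_mul fun y hy z hz => ?_
    have := h.approx z hz y hy
    rw [inner_sub_right] at this
    rw [Real.dist_eq, dist_eq_norm]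
    change _ ≤ κ * a * _
    convert this using 2
    ring
  have h1 := norm_fderiv_le_of_lipschitzOn ℝ hnb hl
  have h2 : fderiv ℝ (fun y => φ y - a * ⟪e, y⟫) x v = fderiv ℝ φ x v - a * ⟪e, v⟫ := by
    have hl : HasFDerivAt (fun y => ⟪e, y⟫) (innerSL ℝ e) x := (innerSL ℝ e).hasFDerivAt
    rw [(hd.hasFDerivAt.fun_sub (hl.const_mul a)).fderiv]
    simp
  rw [← h2, ← Real.norm_eq_abs]
  exact (ContinuousLinearMap.le_opNorm _ _).trans (mul_le_mul_of_nonneg_right h1 (norm_nonneg _))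

theorem fderiv_e_pos (h : GraphChart Ω φ p e κ a r) {x : E n}
    (hx : x ∈ Metric.ball p (3 * r)) : 0 < fderiv ℝ φ x e := by
  have h1 := h.abs_fderiv_sub_le hx e
  rw [real_inner_self_eq_norm_sq, h.norm_e, abs_le] at h1
  nlinarith [h.a_pos, h.κ_le]

theorem lt_of_add_smul (h : GraphChart Ω φ p e κ a r) {x : E n} {s : ℝ}
    (hx : x ∈ Metric.ball p (3 * r)) (hs : 0 < s) (hy : x + s • e ∈ Metric.ball p (3 * r)) :
    φ x < φ (x + s • e) := by
  have h1 := h.approx x hx _ hy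
  rw [add_sub_cancel_left, inner_smul_right, real_inner_self_eq_norm_sq, norm_smul, h.norm_e,
    Real.norm_of_nonneg hs.le, abs_le] at h1
  have : 0 < a * s := mul_pos h.a_pos hs
  nlinarith [h.κ_le]

theorem mem_closure_iff (h : GraphChart Ω φ p e κ a r) {x : E n}
    (hx : x ∈ Metric.ball p (3 * r)) : x ∈ closure Ω ↔ φ x ≤ 0 := by
  have hnb := Metric.isOpen_ball.mem_nhds hx
  constructor
  · intro hc
    by_contra! hpos
    have hcont : ContinuousAt φ x := (h.smooth.contDiffAt hnb).continuousAt
    obtain ⟨y, hy, hyΩ⟩ :=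
      mem_closure_iff_nhds.1 hc _ (Filter.inter_mem hnb (hcont.eventually (lt_mem_nhds hpos)))
    exact absurd ((h.mem_iff y hy.1).1 hyΩ) (not_lt.2 (le_of_lt hy.2))
  -- `φ` strictly increases along `e`, so points slightly below `x` lie in `Ω`.
  · intro hle
    have hc : Tendsto (fun s : ℝ => x - s • e) (𝓝[>] 0) (𝓝 x) := by
      have : Continuous fun s : ℝ => x - s • e := by fun_prop
      simpa using (this.tendsto 0).mono_left nhdsWithin_le_nhds
    refine mem_closure_of_tendsto hc ?_
    filter_upwards [hc.eventually hnb, self_mem_nhdsWithin] with s hs hs0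
    refine (h.mem_iff _ hs).2 ?_
    have := h.lt_of_add_smul hs hs0 (by simpa using hx)
    simp only [sub_add_cancel] at this
    linarith

theorem mem_frontier_iff (h : GraphChart Ω φ p e κ a r) (hΩ : IsOpen Ω) {x : E n}
    (hx : x ∈ Metric.ball p (3 * r)) : x ∈ frontier Ω ↔ φ x = 0 := by
  rw [hΩ.frontier_eq, Set.mem_sdiff, h.mem_closure_iff hx, h.mem_iff x hx, not_lt]
  exact ⟨fun h => le_antisymm h.1 h.2, fun h => ⟨h.le, h.ge⟩⟩

theorem norm_sq_line (h : GraphChart Ω φ p e κ a r) (y : (ℝ ∙ e)ᗮ) (t : ℝ) :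
    ‖t • e + (y : E n)‖ ^ 2 = t ^ 2 + ‖y‖ ^ 2 := by
  have hy : ⟪e, (y : E n)⟫ = 0 := Submodule.mem_orthogonal_singleton_iff_inner_right.1 y.2
  rw [norm_add_sq_real, norm_smul, h.norm_e, real_inner_smul_left, hy, Real.norm_eq_abs, mul_one,
    sq_abs, Submodule.coe_norm]
  ring

theorem line_mem_ball (h : GraphChart Ω φ p e κ a r) {y : (ℝ ∙ e)ᗮ} (hy : ‖y‖ < r) {t : ℝ}
    (ht : t ∈ Icc (-r) r) : p + (t • e + (y : E n)) ∈ Metric.ball p (3 * r) := by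
  rw [mem_ball_iff_norm, add_sub_cancel_left]
  refine (norm_add_le _ _).trans_lt ?_
  rw [norm_smul, h.norm_e, Real.norm_eq_abs, ← Submodule.coe_norm]
  have := abs_le.2 ht
  linarith [h.r_pos]

/-- In a chart the hypersurface `{φ = 0}` is the graph of `f`, and `Ω` is what lies below it. -/
def IsHeight (_h : GraphChart Ω φ p e κ a r) (f : (ℝ ∙ e)ᗮ → ℝ) : Prop :=
  ∀ y : (ℝ ∙ e)ᗮ, ‖y‖ < r → f y ∈ Ioo (-r) r ∧ φ (p + (f y • e + y)) = 0 ∧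
    ∀ t ∈ Icc (-r) r, (p + (t • e + y) ∈ Ω ↔ t < f y)

/-- On each line parallel to `e` the function `φ` is strictly increasing and changes sign between
heights `-r` and `r`, so it has exactly one zero there. -/
theorem exists_height (h : GraphChart Ω φ p e κ a r) : ∃ f, h.IsHeight f := by
  have key : ∀ y : (ℝ ∙ e)ᗮ, ∃ s : ℝ, ‖y‖ < r → s ∈ Ioo (-r) r ∧ φ (p + (s • e + y)) = 0 ∧
    ∀ t ∈ Icc (-r) r, (p + (t • e + y) ∈ Ω ↔ t < s) := by
    intro y
    by_cases hy : ‖y‖ < r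
    swap
    · exact ⟨0, fun h => absurd h hy⟩
    have hr := h.r_pos
    have hey : ⟪e, (y : E n)⟫ = 0 := Submodule.mem_orthogonal_singleton_iff_inner_right.1 y.2
    have hcont : ContinuousOn (fun t : ℝ => φ (p + (t • e + (y : E n)))) (Icc (-r) r) :=
      h.smooth.continuousOn.comp (by fun_prop) fun t ht => h.line_mem_ball hy ht
    -- The points of the segment are within `2 * r` of `p`, so the error is at most `κ * a * 2 * r ≤
    -- a * r / 2`. This is smaller than `a * r`, which fixes the signs of `φ` at both ends.
    have happ : ∀ t ∈ Icc (-r) r, |φ (p + (t • e + (y : E n))) - a * t| ≤ a * (r / 2) := by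
      intro t ht
      have h1 := h.approx p (Metric.mem_ball_self (by linarith)) _ (h.line_mem_ball hy ht)
      rw [add_sub_cancel_left, h.zero, sub_zero, inner_add_right, hey, inner_smul_right,
        real_inner_self_eq_norm_sq, h.norm_e] at h1
      have h2 : ‖t • e + (y : E n)‖ ≤ 2 * r := by
        refine (norm_add_le _ _).trans ?_
        rw [norm_smul, h.norm_e, Real.norm_eq_abs, ← Submodule.coe_norm]
        linarith [abs_le.2 ht]
      have h3 : κ * a * ‖t • e + (y : E n)‖ ≤ a * (r / 2) := by
        have := mul_le_mul (mul_le_mul_of_nonneg_right h.κ_le h.a_pos.le) h2 (norm_nonneg _)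
          (by have := h.a_pos; positivity)
        linarith
      refine le_trans ?_ (h1.trans h3)
      simp
    have hlo : φ (p + ((-r) • e + (y : E n))) < 0 := by
      have := (abs_le.1 (happ (-r) ⟨le_rfl, by linarith⟩)).2
      nlinarith [mul_pos h.a_pos hr]
    have hhi : 0 < φ (p + (r • e + (y : E n))) := by
      have := (abs_le.1 (happ r ⟨by linarith, le_rfl⟩)).1
      nlinarith [mul_pos h.a_pos hr]
    obtain ⟨s, hs, hs0⟩ := intermediate_value_Ioo (by linarith : -r ≤ r) hcont ⟨hlo, hhi⟩
    refine ⟨s, fun _ => ⟨hs, hs0, fun t ht => ?_⟩⟩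
    have hmono : ∀ t₁ ∈ Icc (-r) r, ∀ t₂ ∈ Icc (-r) r, t₁ < t₂ →
        φ (p + (t₁ • e + (y : E n))) < φ (p + (t₂ • e + (y : E n))) := by
      intro t₁ h1 t₂ h2 hlt
      have heq : p + (t₂ • e + (y : E n)) = p + (t₁ • e + (y : E n)) + (t₂ - t₁) • e := by
        rw [sub_smul]; abel
      rw [heq]
      exact h.lt_of_add_smul (h.line_mem_ball hy h1) (sub_pos.2 hlt)
        (heq ▸ h.line_mem_ball hy h2)
    have hs0 : φ (p + (s • e + (y : E n))) = 0 := hs0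
    rw [h.mem_iff _ (h.line_mem_ball hy ht), ← hs0]
    constructor
    · intro hlt
      by_contra! hge
      rcases hge.eq_or_lt with h' | h'
      · rw [h'] at hlt; exact lt_irrefl _ hlt
      · exact lt_asymm hlt (hmono s (Ioo_subset_Icc_self hs) t ht h')
    · exact hmono t ht s (Ioo_subset_Icc_self hs)
  choose f hf using key
  exact ⟨f, hf⟩



/-- The fundamental theorem of calculus along the direction `e` of a chart. -/
theorem integral_fderiv_e (h : GraphChart Ω φ p e κ a r) (hΩ : IsOpen Ω)
    (hb : Bornology.IsBounded Ω) {f : (ℝ ∙ e)ᗮ → ℝ} (hf : h.IsHeight f) {q : E n → ℝ}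
    (hq : ContDiffOn ℝ 1 q (closure Ω ∩ Metric.ball p (3 * r)))
    (hs : tsupport q ⊆ Metric.ball p r) :
    ∫ x in Ω, fderiv ℝ q x e = ∫ y in Metric.ball (0 : (ℝ ∙ e)ᗮ) r, q (p + (f y • e + y)) := by
  have hr := h.r_pos
  have hc : HasCompactSupport q := hasCompactSupport_of_tsupport_subset_ball hs
  obtain ⟨hcd, hcont, C, hC⟩ := fderiv_bounded_of_tsupport_subset hΩ Metric.isOpen_ball hq hc
    (hs.trans (Metric.ball_subset_ball (by linarith)))
  have hbd : ∀ x ∈ Ω, |fderiv ℝ q x e| ≤ C := fun x hx => by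
    have := (fderiv ℝ q x).le_opNorm e
    rw [h.norm_e, mul_one, Real.norm_eq_abs] at this
    exact this.trans (hC x hx)
  have hint : IntegrableOn (fun x => fderiv ℝ q x e) Ω :=
    integrableOn_of_continuousOn_of_bounded hΩ hb (hcont.clm_apply continuousOn_const) hbd
  rw [← integral_indicator hΩ.measurableSet,
    integral_eq_integral_line h.norm_e p (hint.integrable_indicator hΩ.measurableSet),
    ← integral_indicator measurableSet_ball]
  congr 1
  ext y
  have hzero : ∀ x, x ∉ Metric.ball p r → fderiv ℝ q x = 0 := fun x hx => by
    have h0 : q =ᶠ[𝓝 x] fun _ => 0 := notMem_tsupport_iff_eventuallyEq.1 (fun h => hx (hs h))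
    rw [h0.fderiv_eq]; simp
  by_cases hy : ‖y‖ < r
  · rw [indicator_of_mem (mem_ball_zero_iff.2 hy)]
    obtain ⟨hfy, -, hmem⟩ := hf y hy
    have hle : -r ≤ f y := hfy.1.le
    have heq : (fun t : ℝ => Ω.indicator (fun x => fderiv ℝ q x e) (p + (t • e + (y : E n)))) =
        (Ioo (-r) (f y)).indicator (fun t => fderiv ℝ q (p + (t • e + (y : E n))) e) := by
      ext t
      by_cases ht : t ∈ Icc (-r) r
      · by_cases htf : t < f y
        · rw [indicator_of_mem ((hmem t ht).2 htf)]
          rcases ht.1.eq_or_lt with h' | h'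
          · rw [indicator_of_notMem (by simp [h']), hzero, zero_apply]
            rw [mem_ball_iff_norm, add_sub_cancel_left, not_lt]
            have := h.norm_sq_line y t
            refine le_of_sq_le_sq ?_ (norm_nonneg _)
            rw [this, ← h']
            nlinarith [sq_nonneg ‖y‖]
          · rw [indicator_of_mem (show t ∈ Ioo (-r) (f y) from ⟨h', htf⟩)]
        · rw [indicator_of_notMem (fun h => htf ((hmem t ht).1 h)),
            indicator_of_notMem (fun h => htf h.2)]
      · have hz : fderiv ℝ q (p + (t • e + (y : E n))) = 0 := by
          apply hzero
          rw [mem_ball_iff_norm, add_sub_cancel_left, not_lt]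
          have := h.norm_sq_line y t
          refine le_of_sq_le_sq ?_ (norm_nonneg _)
          rw [this]
          have : r < |t| := not_le.1 (fun h => ht (abs_le.1 h))
          nlinarith [sq_nonneg ‖y‖, sq_abs t]
        have h2 : t ∉ Ioo (-r) (f y) := fun h => ht ⟨h.1.le, (h.2.trans hfy.2).le⟩
        rw [indicator_of_notMem h2]
        by_cases hm : p + (t • e + (y : E n)) ∈ Ω
        · rw [indicator_of_mem hm, hz, zero_apply]
        · rw [indicator_of_notMem hm]
    rw [heq, integral_indicator measurableSet_Ioo, ← integral_Ioc_eq_integral_Ioo,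
      ← intervalIntegral.integral_of_le hle]
    have hmaps : MapsTo (fun t : ℝ => p + (t • e + (y : E n))) (Icc (-r) (f y))
        (closure Ω ∩ Metric.ball p (3 * r)) := by
      intro t ht
      have htr : t ∈ Icc (-r) r := ⟨ht.1, ht.2.trans hfy.2.le⟩
      refine ⟨?_, h.line_mem_ball hy htr⟩
      rcases ht.2.eq_or_lt with h' | h'
      · refine (h.mem_closure_iff (h.line_mem_ball hy htr)).2 ?_
        rw [h']
        exact (hf y hy).2.1.le
      · exact subset_closure ((hmem t htr).2 h')
    have hline : ∀ t : ℝ, HasDerivAt (fun t : ℝ => p + (t • e + (y : E n))) e t := fun t => by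
      simpa using (((hasDerivAt_id t).smul_const e).add_const (y : E n)).const_add p
    have hΩm : MapsTo (fun t : ℝ => p + (t • e + (y : E n))) (Ioo (-r) (f y)) Ω := fun t ht =>
      (hmem t ⟨ht.1.le, (ht.2.trans hfy.2).le⟩).2 ht.2
    have hFTC := intervalIntegral.integral_eq_sub_of_hasDerivAt_of_le
      (f := fun t => q (p + (t • e + (y : E n))))
      (f' := fun t => fderiv ℝ q (p + (t • e + (y : E n))) e) hle
      (hq.continuousOn.comp (by fun_prop) hmaps) ?_ ?_
    · rw [hFTC]
      -- The lower endpoint is at distance at least `r` from `p`, outside the support of `q`, so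
      -- only the endpoint on the graph contributes.
      have : q (p + (-r) • e + (y : E n)) = 0 := by
        apply image_eq_zero_of_notMem_tsupport
        intro hm
        have hm := hs hm
        rw [add_assoc, mem_ball_iff_norm, add_sub_cancel_left] at hm
        have h1 := h.norm_sq_line y (-r)
        nlinarith [sq_nonneg ‖y‖, norm_nonneg ((-r) • e + (y : E n))]
      rw [add_assoc] at this
      rw [this, sub_zero]
    · intro t ht
      have hd : DifferentiableAt ℝ q (p + (t • e + (y : E n))) :=
        (hcd.contDiffAt (hΩ.mem_nhds (hΩm ht))).differentiableAt one_ne_zero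
      exact hd.hasFDerivAt.comp_hasDerivAt t (hline t)
    · rw [intervalIntegrable_iff_integrableOn_Ioo_of_le hle]
      have : IsFiniteMeasure ((volume : Measure ℝ).restrict (Ioo (-r) (f y))) :=
        ⟨by simp⟩
      refine Integrable.of_bound ?_ C ?_
      · refine ContinuousOn.aestronglyMeasurable ?_ measurableSet_Ioo
        exact (hcont.clm_apply continuousOn_const).comp (by fun_prop) hΩm
      · exact (ae_restrict_iff' measurableSet_Ioo).2
          (Eventually.of_forall fun t ht => hbd _ (hΩm ht))
  · rw [indicator_of_notMem (fun h => hy (mem_ball_zero_iff.1 h))]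
    have : (fun t : ℝ => Ω.indicator (fun x => fderiv ℝ q x e) (p + (t • e + (y : E n)))) =
        fun _ => 0 := by
      ext t
      refine indicator_apply_eq_zero.2 fun _ => ?_
      rw [hzero, zero_apply]
      rw [mem_ball_iff_norm, add_sub_cancel_left, not_lt]
      have := h.norm_sq_line y t
      refine le_of_sq_le_sq ?_ (norm_nonneg _)
      rw [this]
      nlinarith [sq_nonneg t, h.r_pos]
    rw [this, integral_zero]

end GraphChart

/-! ### The divergence theorem in a chart, over the tangent hyperplane -/

namespace GraphChart

variable {Ω : Set (E n)} {φ : E n → ℝ} {p e : E n} {κ a r : ℝ}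

/-- A vector field that is tangential to the level sets of the defining function has no flux. -/
theorem integral_divg_eq_zero_of_tangential (h : GraphChart Ω φ p e κ a r) (hΩ : IsOpen Ω)
    (hb : Bornology.IsBounded Ω) {G : E n → E n}
    (hG : ContDiffOn ℝ 1 G (closure Ω ∩ Metric.ball p (3 * r)))
    (hc : HasCompactSupport G) (hs : tsupport G ⊆ Metric.ball p r)
    (ht : ∀ x ∈ Ω ∩ Metric.ball p (3 * r), fderiv ℝ φ x (G x) = 0) :
    ∫ x in Ω, divg G x = 0 := by
  have hr := h.r_pos
  have hs3 : tsupport G ⊆ Metric.ball p (3 * r) :=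
    hs.trans (Metric.ball_subset_ball (by linarith))
  obtain ⟨hcd, hcont, C, hC⟩ := fderiv_bounded_of_tsupport_subset hΩ Metric.isOpen_ball hG hc hs3
  have hcdiv : ContinuousOn (divg G) Ω := continuous_tr.comp_continuousOn hcont
  have hbd : ∀ x ∈ Ω, |divg G x| ≤ (n + 1) * C := fun x hx =>
    (abs_tr_le _).trans (mul_le_mul_of_nonneg_left (hC x hx) (by positivity))
  have hint : IntegrableOn (divg G) Ω :=
    integrableOn_of_continuousOn_of_bounded hΩ hb hcdiv hbd
  -- The cutoff `ψ k` vanishes where `k * φ ≥ -1`, hence near the boundary, and equals 1 where `k *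
  -- φ ≤ -2`. As a function of `φ` alone, its derivative vanishes on `G`, so multiplication by it
  -- creates no extra term in the divergence.
  set ψ : ℕ → E n → ℝ := fun k x => Real.smoothTransition (-(k * φ x) - 1) with hψ
  have hφat : ∀ x ∈ Metric.ball p (3 * r), ContDiffAt ℝ ∞ φ x := fun x hx =>
    h.smooth.contDiffAt (Metric.isOpen_ball.mem_nhds hx)
  have hψat : ∀ k, ∀ x ∈ Metric.ball p (3 * r), ContDiffAt ℝ 1 (ψ k) x := fun k x hx =>
    Real.smoothTransition.contDiffAt.comp x
      (((contDiffAt_const.mul ((hφat x hx).of_le (by simp))).neg).sub contDiffAt_const)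
  have hzero : ∀ k, ∀ x, x ∉ Ω → (fun y => ψ k y • G y) =ᶠ[𝓝 x] fun _ => 0 := by
    intro k x hx
    by_cases hxs : x ∈ tsupport G
    · have hxb := hs3 hxs
      have h0 : 0 ≤ φ x := not_lt.1 fun hlt => hx ((h.mem_iff x hxb).2 hlt)
      have hcx : ContinuousAt (fun y => -(k * φ y) - 1) x :=
        ((continuousAt_const.mul (hφat x hxb).continuousAt).neg).sub continuousAt_const
      have hlt : -(k * φ x) - 1 < 0 := by
        have : (0 : ℝ) ≤ k * φ x := by positivity
        linarith
      filter_upwards [hcx.eventually (gt_mem_nhds hlt)] with y hy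
      simp only [hψ]
      rw [Real.smoothTransition.zero_of_nonpos hy.le, zero_smul]
    · filter_upwards [notMem_tsupport_iff_eventuallyEq.1 hxs] with y hy
      simp [hy]
  have hH : ∀ k, ContDiff ℝ 1 (fun y => ψ k y • G y) := by
    refine fun k => contDiff_iff_contDiffAt.2 fun x => ?_
    by_cases hx : x ∈ Ω
    · by_cases hxs : x ∈ tsupport G
      · exact (hψat k x (hs3 hxs)).smul (hcd.contDiffAt (hΩ.mem_nhds hx))
      · refine contDiffAt_const (c := (0 : E n)) |>.congr_of_eventuallyEq ?_
        filter_upwards [notMem_tsupport_iff_eventuallyEq.1 hxs] with y hy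
        simp [hy]
    · exact contDiffAt_const.congr_of_eventuallyEq (hzero k x hx)
  have hdiv : ∀ k, divg (fun y => ψ k y • G y) = Ω.indicator (fun x => ψ k x * divg G x) := by
    intro k
    ext x
    by_cases hx : x ∈ Ω
    · rw [indicator_of_mem hx]
      by_cases hxs : x ∈ tsupport G
      · have hxb := hs3 hxs
        have hdφ : DifferentiableAt ℝ φ x := (hφat x hxb).differentiableAt (by simp)
        have hdψ := (hψat k x hxb).differentiableAt one_ne_zero
        have hdθ : DifferentiableAt ℝ Real.smoothTransition (-(k * φ x) - 1) :=
          (Real.smoothTransition.contDiffAt (n := 1)).differentiableAt one_ne_zero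
        rw [divg_smul hdψ ((hcd.contDiffAt (hΩ.mem_nhds hx)).differentiableAt one_ne_zero)]
        have h1 : HasFDerivAt (fun y => -(k * φ y) - 1) (-((k : ℝ) • fderiv ℝ φ x)) x :=
          ((hdφ.hasFDerivAt.const_mul (k : ℝ)).neg).sub_const 1
        have h2 := hdθ.hasFDerivAt.comp x h1
        have h3 : fderiv ℝ (ψ k) x = _ := h2.fderiv
        rw [h3]
        simp [ht x ⟨hx, hxb⟩]
      · have h0 := notMem_tsupport_iff_eventuallyEq.1 hxs
        have h1 : (fun y => ψ k y • G y) =ᶠ[𝓝 x] fun _ => 0 := by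
          filter_upwards [h0] with y hy
          simp [hy]
        have h0 : G =ᶠ[𝓝 x] fun _ => 0 := h0
        unfold divg
        rw [h1.fderiv_eq, h0.fderiv_eq]
        simp [tr]
    · rw [indicator_of_notMem hx]
      unfold divg
      rw [(hzero k x hx).fderiv_eq]
      simp [tr]
  have hint0 : ∀ k, ∫ x in Ω, ψ k x * divg G x = 0 := by
    intro k
    rw [← integral_indicator hΩ.measurableSet, ← hdiv k]
    exact integral_divg_eq_zero (hH k) (hc.smul_left (f := ψ k))
  have hlim : Tendsto (fun k => ∫ x in Ω, ψ k x * divg G x) atTop (𝓝 (∫ x in Ω, divg G x)) := by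
    refine tendsto_integral_of_dominated_convergence (fun x => |divg G x|) ?_ hint.abs ?_ ?_
    · intro k
      have : ContinuousOn (fun x => ψ k x * divg G x) Ω := by
        intro x hx
        by_cases hxs : x ∈ tsupport G
        · exact ((hψat k x (hs3 hxs)).continuousAt.continuousWithinAt).mul (hcdiv x hx)
        · have h0 : G =ᶠ[𝓝 x] fun _ => 0 := notMem_tsupport_iff_eventuallyEq.1 hxs
          have h1 : (fun x => ψ k x * divg G x) =ᶠ[𝓝 x] fun _ => 0 := by
            filter_upwards [h0.eventuallyEq_nhds] with y hy
            have : divg G y = 0 := by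
              unfold divg
              rw [Filter.EventuallyEq.fderiv_eq hy]
              simp [tr]
            rw [this, mul_zero]
          exact (continuousAt_const.congr h1.symm).continuousWithinAt
      exact this.aestronglyMeasurable hΩ.measurableSet
    · refine fun k => Eventually.of_forall fun x => ?_
      rw [Real.norm_eq_abs, abs_mul]
      refine mul_le_of_le_one_left (abs_nonneg _) ?_
      rw [abs_of_nonneg (Real.smoothTransition.nonneg _)]
      exact Real.smoothTransition.le_one _
    · refine (ae_restrict_iff' hΩ.measurableSet).2 (Eventually.of_forall fun x hx => ?_)
      by_cases hxs : x ∈ tsupport G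
      · have hneg := (h.mem_iff x (hs3 hxs)).1 hx
        have h1 : ∀ᶠ k : ℕ in atTop, ψ k x * divg G x = divg G x := by
          filter_upwards [(tendsto_natCast_atTop_atTop (R := ℝ)).eventually_ge_atTop
            (2 / (-φ x))] with k hk
          rw [div_le_iff₀ (by linarith)] at hk
          simp only [hψ]
          rw [Real.smoothTransition.one_of_one_le (by linarith), one_mul]
        exact tendsto_const_nhds.congr' (h1.mono fun k hk => hk.symm)
      · have h0 : G =ᶠ[𝓝 x] fun _ => 0 := notMem_tsupport_iff_eventuallyEq.1 hxs
        have : divg G x = 0 := by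
          unfold divg
          rw [h0.fderiv_eq]
          simp [tr]
        simp [this]
  simp only [hint0] at hlim
  exact tendsto_nhds_unique hlim tendsto_const_nhds

/-- The divergence theorem in a chart, with the flux expressed by an integral over the tangent
hyperplane. -/
theorem integral_divg_smul (h : GraphChart Ω φ p e κ a r) (hΩ : IsOpen Ω)
    (hb : Bornology.IsBounded Ω) {f : (ℝ ∙ e)ᗮ → ℝ} (hf : h.IsHeight f) {F : E n → E n}
    (hF : ContDiffOn ℝ 1 F (closure Ω ∩ Metric.ball p (3 * r))) {χ : E n → ℝ}
    (hχ : ContDiff ℝ 1 χ) (hs : tsupport χ ⊆ Metric.ball p r) :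
    ∫ x in Ω, divg (fun y => χ y • F y) x = ∫ y in Metric.ball (0 : (ℝ ∙ e)ᗮ) r,
      χ (p + (f y • e + y)) * (fderiv ℝ φ (p + (f y • e + y)) (F (p + (f y • e + y))) /
        fderiv ℝ φ (p + (f y • e + y)) e) := by
  have hr := h.r_pos
  have hs3 : tsupport χ ⊆ Metric.ball p (3 * r) :=
    hs.trans (Metric.ball_subset_ball (by linarith))
  have hcχ : HasCompactSupport χ := hasCompactSupport_of_tsupport_subset_ball hs
  -- This is the coefficient for which `χ • F - q • e` is annihilated by the derivative of `φ`.
  set q : E n → ℝ := fun x => χ x * (fderiv ℝ φ x (F x) / fderiv ℝ φ x e) with hqdef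
  have hdφ : ContDiffOn ℝ 1 (fderiv ℝ φ) (closure Ω ∩ Metric.ball p (3 * r)) :=
    (h.smooth.fderiv_of_isOpen Metric.isOpen_ball (m := 1) (by norm_cast)).mono inter_subset_right
  have hq : ContDiffOn ℝ 1 q (closure Ω ∩ Metric.ball p (3 * r)) :=
    hχ.contDiffOn.mul ((hdφ.clm_apply hF).div (hdφ.clm_apply contDiffOn_const)
      fun x hx => (h.fderiv_e_pos hx.2).ne')
  have hsq : tsupport q ⊆ tsupport χ := tsupport_mul_subset_left
  have hχF : ContDiffOn ℝ 1 (fun y => χ y • F y) (closure Ω ∩ Metric.ball p (3 * r)) :=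
    hχ.contDiffOn.smul hF
  have hsχF : tsupport (fun y => χ y • F y) ⊆ tsupport χ := tsupport_smul_subset_left χ F
  have hsqe : tsupport (fun y => q y • e) ⊆ tsupport χ :=
    (tsupport_smul_subset_left q fun _ => e).trans hsq
  have hcomp : ∀ {g : E n → E n}, tsupport g ⊆ tsupport χ → HasCompactSupport g := fun hg =>
    hcχ.isCompact.of_isClosed_subset (isClosed_tsupport _) hg
  have hqe : ContDiffOn ℝ 1 (fun y => q y • e) (closure Ω ∩ Metric.ball p (3 * r)) :=
    hq.smul contDiffOn_const
  obtain ⟨hA, hAc, CA, hCA⟩ := fderiv_bounded_of_tsupport_subset hΩ Metric.isOpen_ball hχF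
    (hcomp hsχF) (hsχF.trans hs3)
  obtain ⟨hB, hBc, CB, hCB⟩ := fderiv_bounded_of_tsupport_subset hΩ Metric.isOpen_ball hqe
    (hcomp hsqe) (hsqe.trans hs3)
  obtain ⟨hQ, -⟩ := fderiv_bounded_of_tsupport_subset hΩ Metric.isOpen_ball hq
    (hcχ.isCompact.of_isClosed_subset (isClosed_tsupport _) hsq) (hsq.trans hs3)
  have hsG : tsupport (fun y => χ y • F y - q y • e) ⊆ tsupport χ := by
    refine closure_minimal (fun x hx => ?_) (isClosed_tsupport χ)
    by_contra hxs
    have h1 := image_eq_zero_of_notMem_tsupport hxs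
    simp [hqdef, h1] at hx
  have hG := h.integral_divg_eq_zero_of_tangential hΩ hb (hχF.sub hqe) (hcomp hsG)
    (hsG.trans hs) ?_
  · have hi1 : IntegrableOn (divg fun y => χ y • F y) Ω :=
      integrableOn_of_continuousOn_of_bounded hΩ hb (continuous_tr.comp_continuousOn hAc)
        (C := (n + 1) * CA) fun x hx =>
          (abs_tr_le _).trans (mul_le_mul_of_nonneg_left (hCA x hx) (by positivity))
    have hi2 : IntegrableOn (divg fun y => q y • e) Ω :=
      integrableOn_of_continuousOn_of_bounded hΩ hb (continuous_tr.comp_continuousOn hBc)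
        (C := (n + 1) * CB) fun x hx =>
          (abs_tr_le _).trans (mul_le_mul_of_nonneg_left (hCB x hx) (by positivity))
    have h1 : ∫ x in Ω, divg (fun y => χ y • F y - q y • e) x =
        ∫ x in Ω, (divg (fun y => χ y • F y) x - divg (fun y => q y • e) x) := by
      refine setIntegral_congr_fun hΩ.measurableSet fun x hx => ?_
      exact divg_sub ((hA.contDiffAt (hΩ.mem_nhds hx)).differentiableAt one_ne_zero)
        ((hB.contDiffAt (hΩ.mem_nhds hx)).differentiableAt one_ne_zero)
    have h2 : ∫ x in Ω, divg (fun y => q y • e) x = ∫ x in Ω, fderiv ℝ q x e := by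
      refine setIntegral_congr_fun hΩ.measurableSet fun x hx => ?_
      have hd := (hQ.contDiffAt (hΩ.mem_nhds hx)).differentiableAt one_ne_zero
      rw [divg_smul hd (by fun_prop)]
      simp [divg, tr]
    rw [h1, integral_sub hi1 hi2, h2, h.integral_fderiv_e hΩ hb hf hq (hsq.trans hs)] at hG
    linarith
  · intro x hx
    have := (h.fderiv_e_pos hx.2).ne'
    rw [map_sub, map_smul, map_smul]
    simp only [hqdef, smul_eq_mul]
    field_simp
    ring

end GraphChart

/-! ### Comparison with the surface measure -/

theorem euclideanHausdorffMeasure_image_le {X Y : Type*} [EMetricSpace X] [EMetricSpace Y]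
    [MeasurableSpace X] [BorelSpace X] [MeasurableSpace Y] [BorelSpace Y] {K : NNReal} {g : X → Y}
    {s : Set X} (hg : LipschitzOnWith K g s) (d : ℕ) :
    μHE[d] (g '' s) ≤ (K : ENNReal) ^ d * μHE[d] s := by
  simp only [Measure.euclideanHausdorffMeasure_def, Measure.smul_apply]
  have h := hg.hausdorffMeasure_image_le (d := d) (by positivity)
  rw [ENNReal.rpow_natCast] at h
  rw [ENNReal.smul_def, ENNReal.smul_def, smul_eq_mul, smul_eq_mul, mul_left_comm]
  exact mul_le_mul_right h _

/-- The functions `|w| + w` and `|w| - w` are nonnegative, so their integrals are monotone in the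
measure; subtracting the inequality for `|w|` controls the sign-changing `w`. -/
theorem abs_integral_sub_integral_le {X : Type*} [MeasurableSpace X] {σ μ : Measure X} {C : NNReal}
    (h1 : σ ≤ μ) (h2 : μ ≤ C • σ) {w : X → ℝ} (hw : Integrable w σ) :
    |(∫ x, w x ∂σ) - ∫ x, w x ∂μ| ≤ (C - 1) * ∫ x, |w x| ∂σ := by
  have hwC : Integrable w (C • σ) := hw.smul_measure_nnreal
  have hwμ : Integrable w μ := hwC.mono_measure h2
  have e1 : ∫ x, (|w x| + w x) ∂σ ≤ ∫ x, (|w x| + w x) ∂μ :=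
    integral_mono_measure h1 (Eventually.of_forall fun x => by
      simp only [Pi.zero_apply]; linarith [neg_abs_le (w x)]) (hwμ.abs.add hwμ)
  have e2 : ∫ x, (|w x| - w x) ∂σ ≤ ∫ x, (|w x| - w x) ∂μ :=
    integral_mono_measure h1 (Eventually.of_forall fun x => by
      simp only [Pi.zero_apply]; linarith [le_abs_self (w x)]) (hwμ.abs.sub hwμ)
  have e3 : ∫ x, |w x| ∂μ ≤ ∫ x, |w x| ∂(C • σ) :=
    integral_mono_measure h2 (Eventually.of_forall fun x => abs_nonneg _) hwC.abs
  rw [integral_add hw.abs hw, integral_add hwμ.abs hwμ] at e1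
  rw [integral_sub hw.abs hw, integral_sub hwμ.abs hwμ] at e2
  rw [integral_smul_nnreal_measure, NNReal.smul_def, smul_eq_mul] at e3
  rw [abs_le]
  constructor <;> linarith

/-- The flux density of `χ • F` through `∂Ω`. -/
noncomputable def flux (Ω : Set (E n)) (F : E n → E n) (χ : E n → ℝ) (x : E n) : ℝ :=
  χ x * ⟪F x, outwardNormal Ω x⟫

namespace GraphChart

variable {Ω : Set (E n)} {φ : E n → ℝ} {p e : E n} {κ a r : ℝ}

theorem outwardNormal_eq (h : GraphChart Ω φ p e κ a r) {x : E n}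
    (hx : x ∈ Metric.ball p (3 * r)) (h0 : φ x = 0) :
    outwardNormal Ω x = ‖gradient φ x‖⁻¹ • gradient φ x := by
  refine HalfBallTorsion.outwardNormal_eq ⟨φ, ⟨h0, ?_, _, Metric.isOpen_ball, hx, h.smooth,
    h.mem_iff⟩, rfl⟩
  intro hg
  have h1 := h.fderiv_e_pos hx
  have h2 : fderiv ℝ φ x = 0 := by
    simpa [gradient] using hg
  rw [h2] at h1
  simp at h1

theorem inner_outwardNormal (h : GraphChart Ω φ p e κ a r) {x : E n}
    (hx : x ∈ Metric.ball p (3 * r)) (h0 : φ x = 0) (v : E n) :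
    ⟪v, outwardNormal Ω x⟫ = fderiv ℝ φ x v / ‖fderiv ℝ φ x‖ := by
  rw [h.outwardNormal_eq hx h0, real_inner_smul_right, real_inner_comm]
  have h1 : ⟪gradient φ x, v⟫ = fderiv ℝ φ x v := by simp [gradient]
  have h2 : ‖gradient φ x‖ = ‖fderiv ℝ φ x‖ := by simp [gradient]
  rw [h1, h2, div_eq_inv_mul]

/-- Both the norm of the derivative and its value on `e` lie between `(1 - κ) * a` and `(1 + κ) *
a`, and `(1 + κ) / (1 - κ) ≤ 1 + 4 * κ` for `κ ≤ 1 / 4`. The ratio is the factor between the flux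
density over the hyperplane and that over the hypersurface. -/
theorem norm_fderiv_div_le (h : GraphChart Ω φ p e κ a r) {x : E n}
    (hx : x ∈ Metric.ball p (3 * r)) :
    |‖fderiv ℝ φ x‖ / fderiv ℝ φ x e - 1| ≤ 4 * κ := by
  have hpos := h.fderiv_e_pos hx
  have ha := h.a_pos
  have hκ := h.κ_pos
  have hκ' := h.κ_le
  have h1 : fderiv ℝ φ x e ≤ ‖fderiv ℝ φ x‖ := by
    have := (le_abs_self _).trans ((fderiv ℝ φ x).le_opNorm e)
    rwa [h.norm_e, mul_one] at this
  have h2 : ‖fderiv ℝ φ x‖ ≤ (1 + κ) * a := by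
    refine ContinuousLinearMap.opNorm_le_bound _ (by positivity) fun v => ?_
    have e1 := h.abs_fderiv_sub_le hx v
    have e2 : |⟪e, v⟫| ≤ ‖v‖ := by
      have := abs_real_inner_le_norm e v
      rwa [h.norm_e, one_mul] at this
    have e3 : |a * ⟪e, v⟫| ≤ a * ‖v‖ := by
      rw [abs_mul, abs_of_pos ha]
      exact mul_le_mul_of_nonneg_left e2 ha.le
    rw [Real.norm_eq_abs]
    have e4 := abs_add_le (fderiv ℝ φ x v - a * ⟪e, v⟫) (a * ⟪e, v⟫)
    rw [sub_add_cancel] at e4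
    linarith
  have h3 : (1 - κ) * a ≤ fderiv ℝ φ x e := by
    have := (abs_le.1 (h.abs_fderiv_sub_le hx e)).1
    rw [real_inner_self_eq_norm_sq, h.norm_e] at this
    linarith
  rw [abs_of_nonneg (by rw [sub_nonneg, le_div_iff₀ hpos]; linarith), sub_le_iff_le_add,
    div_le_iff₀ hpos]
  nlinarith [mul_pos hκ ha, mul_nonneg (sub_nonneg.2 hκ') (mul_pos hκ ha).le]

/-- Since `φ` vanishes at both points of the graph, the approximation bounds their difference in
height by `κ` times their distance; the rest of the distance is horizontal. -/
theorem norm_le_of_heights (h : GraphChart Ω φ p e κ a r) {f : (ℝ ∙ e)ᗮ → ℝ} (hf : h.IsHeight f)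
    {y z : (ℝ ∙ e)ᗮ} (hy : ‖y‖ < r) (hz : ‖z‖ < r) :
    ‖(p + (f y • e + (y : E n))) - (p + (f z • e + (z : E n)))‖ ≤ (1 - κ)⁻¹ * ‖y - z‖ := by
  obtain ⟨hfy, hy0, -⟩ := hf y hy
  obtain ⟨hfz, hz0, -⟩ := hf z hz
  have hey : ⟪e, (y : E n)⟫ = 0 := Submodule.mem_orthogonal_singleton_iff_inner_right.1 y.2
  have hez : ⟪e, (z : E n)⟫ = 0 := Submodule.mem_orthogonal_singleton_iff_inner_right.1 z.2
  have h1 := h.approx _ (h.line_mem_ball hz (Ioo_subset_Icc_self hfz)) _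
    (h.line_mem_ball hy (Ioo_subset_Icc_self hfy))
  have heq : (p + (f y • e + (y : E n))) - (p + (f z • e + (z : E n))) =
      (f y - f z) • e + ((y - z : (ℝ ∙ e)ᗮ) : E n) := by
    rw [sub_smul, Submodule.coe_sub]; abel
  rw [hy0, hz0, sub_self, zero_sub, abs_neg, heq] at h1
  rw [heq]
  set N := ‖(f y - f z) • e + ((y - z : (ℝ ∙ e)ᗮ) : E n)‖
  have h2 : ⟪e, (f y - f z) • e + ((y - z : (ℝ ∙ e)ᗮ) : E n)⟫ = f y - f z := by
    rw [inner_add_right, inner_smul_right, real_inner_self_eq_norm_sq, h.norm_e, Submodule.coe_sub,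
      inner_sub_right, hey, hez]
    ring
  rw [h2, abs_mul, abs_of_pos h.a_pos] at h1
  have h3 : |f y - f z| ≤ κ * N := by
    have := h.a_pos
    nlinarith
  have h4 : N ≤ |f y - f z| + ‖y - z‖ := by
    refine (norm_add_le _ _).trans ?_
    rw [norm_smul, h.norm_e, mul_one, Real.norm_eq_abs, Submodule.norm_coe]
  have h5 : 0 < 1 - κ := by linarith [h.κ_le]
  rw [le_inv_mul_iff₀ h5]
  linarith

theorem proj_line (y : (ℝ ∙ e)ᗮ) (t : ℝ) :
    (ℝ ∙ e)ᗮ.orthogonalProjectionOnto (t • e + (y : E n)) = y := by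
  rw [map_add]
  have : (ℝ ∙ e)ᗮ.orthogonalProjectionOnto (t • e) = 0 := by
    rw [map_smul, Submodule.orthogonalProjectionOnto_orthogonalComplement_singleton_eq_zero,
      smul_zero]
  rw [this, zero_add, Submodule.orthogonalProjectionOnto_mem_subspace_eq_self]

/-- By Pythagoras, both the height and the horizontal part of a point in the ball of radius `r` are
smaller than `r`, so the point lies on a line covered by the chart, and `φ` has only one zero on
that line. -/
theorem mem_image_of_mem_frontier (h : GraphChart Ω φ p e κ a r) (hΩ : IsOpen Ω)
    {f : (ℝ ∙ e)ᗮ → ℝ} (hf : h.IsHeight f) {x : E n} (hx : x ∈ frontier Ω)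
    (hxr : x ∈ Metric.ball p r) :
    x ∈ (fun y : (ℝ ∙ e)ᗮ => p + (f y • e + (y : E n))) '' Metric.ball 0 r := by
  have hr := h.r_pos
  set t := ⟪e, x - p⟫ with htdef
  have hmem : x - p - t • e ∈ (ℝ ∙ e)ᗮ := by
    rw [Submodule.mem_orthogonal_singleton_iff_inner_right, inner_sub_right, inner_smul_right,
      real_inner_self_eq_norm_sq, h.norm_e]
    ring
  set y : (ℝ ∙ e)ᗮ := ⟨x - p - t • e, hmem⟩ with hydef
  have hxy : x = p + (t • e + (y : E n)) := by
    simp [hydef]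
  have hn := h.norm_sq_line y t
  have hnr : ‖t • e + (y : E n)‖ < r := by
    rw [hxy, mem_ball_iff_norm, add_sub_cancel_left] at hxr
    exact hxr
  have hyr : ‖y‖ < r := by
    refine lt_of_le_of_lt ?_ hnr
    refine le_of_sq_le_sq ?_ (norm_nonneg _)
    nlinarith [sq_nonneg t]
  have htr : |t| < r := by
    refine lt_of_le_of_lt ?_ hnr
    refine le_of_sq_le_sq ?_ (norm_nonneg _)
    rw [sq_abs]
    nlinarith [sq_nonneg ‖y‖]
  have htI : t ∈ Icc (-r) r := abs_le.1 htr.le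
  obtain ⟨hfy, hy0, hyΩ⟩ := hf y hyr
  refine ⟨y, mem_ball_zero_iff.2 hyr, ?_⟩
  simp only
  have h0 : φ x = 0 := (h.mem_frontier_iff hΩ (Metric.ball_subset_ball (by linarith) hxr)).1 hx
  have hle : f y ≤ t := by
    rw [← not_lt, ← hyΩ t htI, ← hxy, h.mem_iff x (Metric.ball_subset_ball (by linarith) hxr), h0]
    exact lt_irrefl _
  rcases hle.eq_or_lt with heq | hlt
  · rw [heq]; exact hxy.symm
  · exfalso
    have hadd : x = p + (f y • e + (y : E n)) + (t - f y) • e := by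
      rw [hxy, sub_smul]; abel
    have := h.lt_of_add_smul (h.line_mem_ball hyr (Ioo_subset_Icc_self hfy)) (sub_pos.2 hlt)
      (hadd ▸ Metric.ball_subset_ball (by linarith) hxr)
    rw [hy0, ← hadd, h0] at this
    exact lt_irrefl _ this

/-- In a chart, the divergence theorem holds up to an error that is controlled by the tilt of the
hypersurface. -/
theorem abs_integral_divg_sub_le (h : GraphChart Ω φ p e κ a r) (hΩ : IsOpen Ω)
    (hb : Bornology.IsBounded Ω) {F : E n → E n}
    (hF : ContDiffOn ℝ 1 F (closure Ω ∩ Metric.ball p (3 * r))) {χ : E n → ℝ}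
    (hχ : ContDiff ℝ 1 χ) (hs : tsupport χ ⊆ Metric.ball p r) :
    IntegrableOn (flux Ω F χ) (frontier Ω) μHE[n] ∧
    |(∫ x in Ω, divg (fun y => χ y • F y) x) - ∫ x in frontier Ω, flux Ω F χ x ∂μHE[n]| ≤
      (4 * κ + (((1 - κ)⁻¹) ^ n - 1)) * ∫ x in frontier Ω, |flux Ω F χ x| ∂μHE[n] := by
  have hr := h.r_pos
  have hκ := h.κ_pos
  have hκ' := h.κ_le
  obtain ⟨f, hf⟩ := h.exists_height
  set γ : (ℝ ∙ e)ᗮ → E n := fun y => p + (f y • e + (y : E n)) with hγ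
  set D : Set (ℝ ∙ e)ᗮ := Metric.ball 0 r with hD
  have hDn : ∀ {y}, y ∈ D → ‖y‖ < r := fun hy => mem_ball_zero_iff.1 hy
  obtain ⟨L, hL⟩ : ∃ L : NNReal, (L : ℝ) = (1 - κ)⁻¹ :=
    ⟨((1 - κ)⁻¹).toNNReal, Real.coe_toNNReal _ (inv_nonneg.2 (by linarith))⟩
  have hLip : LipschitzOnWith L γ D := LipschitzOnWith.of_dist_le_mul fun y hy z hz => by
    rw [dist_eq_norm, dist_eq_norm, hL]
    exact h.norm_le_of_heights hf (hDn hy) (hDn hz)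
  have hγball : ∀ y ∈ D, γ y ∈ Metric.ball p (3 * r) := fun y hy =>
    h.line_mem_ball (hDn hy) (Ioo_subset_Icc_self (hf y (hDn hy)).1)
  have hγfr : ∀ y ∈ D, γ y ∈ frontier Ω := fun y hy =>
    (h.mem_frontier_iff hΩ (hγball y hy)).2 (hf y (hDn hy)).2.1
  have hfin : Module.finrank ℝ (ℝ ∙ e)ᗮ = n := by
    have he : e ≠ 0 := fun h0 => by have := h.norm_e; rw [h0] at this; simp at this
    have : Fact (Module.finrank ℝ (E n) = n + 1) := ⟨by simp⟩
    exact Submodule.finrank_orthogonal_span_singleton he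
  have hvol : (volume : Measure (ℝ ∙ e)ᗮ) = μHE[n] := by
    rw [← InnerProductSpace.euclideanHausdorffMeasure_eq_volume, hfin]
  have haem : AEMeasurable γ (volume.restrict D) :=
    hLip.continuousOn.aemeasurable measurableSet_ball
  -- `σ` is the Lebesgue measure of the tangent hyperplane lifted to the graph, and `μ` is the
  -- surface measure of the graph. They are compared by `σ ≤ μ ≤ L ^ n • σ`, since the projection is
  -- 1-Lipschitz and the graph map is `L`-Lipschitz.
  set σ : Measure (E n) := Measure.map γ (volume.restrict D) with hσ
  set μ : Measure (E n) := μHE[n].restrict (γ '' D) with hμ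
  have hσA : ∀ A, MeasurableSet A → σ A = μHE[n] (γ ⁻¹' A ∩ D) := fun A hA => by
    rw [hσ, Measure.map_apply_of_aemeasurable haem hA,
      Measure.restrict_apply' measurableSet_ball, hvol]
  have hμA : ∀ A, MeasurableSet A → μ A = μHE[n] (γ '' (γ ⁻¹' A ∩ D)) := fun A hA => by
    rw [hμ, Measure.restrict_apply hA, inter_comm (γ ⁻¹' A), image_inter_preimage, inter_comm]
  have hproj : ∀ y, (ℝ ∙ e)ᗮ.orthogonalProjectionOnto (γ y - p) = y := fun y => by
    simp only [hγ, add_sub_cancel_left]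
    exact proj_line y (f y)
  have h1 : σ ≤ μ := by
    refine Measure.le_iff.2 fun A hA => ?_
    rw [hσA A hA, hμA A hA]
    have hPL : LipschitzWith 1 fun x : E n => (ℝ ∙ e)ᗮ.orthogonalProjectionOnto (x - p) :=
      LipschitzWith.of_dist_le_mul fun x z => by
        rw [dist_eq_norm, dist_eq_norm, ← map_sub, sub_sub_sub_cancel_right, NNReal.coe_one,
          one_mul]
        exact Submodule.norm_orthogonalProjectionOnto_apply_le _ _
    have := euclideanHausdorffMeasure_image_le
      (hPL.lipschitzOnWith (s := γ '' (γ ⁻¹' A ∩ D))) n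
    rw [image_image] at this
    simpa [hproj] using this
  have h2 : μ ≤ (L ^ n) • σ := by
    refine Measure.le_iff.2 fun A hA => ?_
    rw [Measure.smul_apply, hσA A hA, hμA A hA, ENNReal.smul_def, smul_eq_mul, ENNReal.coe_pow]
    exact euclideanHausdorffMeasure_image_le (hLip.mono inter_subset_right) n
  have hσfin : IsFiniteMeasure σ := by
    have : IsFiniteMeasure ((volume : Measure (ℝ ∙ e)ᗮ).restrict D) :=
      ⟨by simpa using measure_ball_lt_top⟩
    exact Measure.isFiniteMeasure_map _ _
  have hμfin : IsFiniteMeasure μ := isFiniteMeasure_of_le _ h2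
  -- measurability and boundedness of the flux density
  set Z : Set (E n) := frontier Ω ∩ Metric.ball p (3 * r) with hZ
  have hZm : MeasurableSet Z := isClosed_frontier.measurableSet.inter measurableSet_ball
  have hZcl : Z ⊆ closure Ω ∩ Metric.ball p (3 * r) :=
    inter_subset_inter_left _ frontier_subset_closure
  have hγZ : γ '' D ⊆ Z := by
    rintro _ ⟨y, hy, rfl⟩
    exact ⟨hγfr y hy, hγball y hy⟩
  have hdφ : ContinuousOn (fderiv ℝ φ) (Metric.ball p (3 * r)) :=
    h.smooth.continuousOn_fderiv_of_isOpen Metric.isOpen_ball (by simp)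
  have hdφZ : ContinuousOn (fderiv ℝ φ) Z := hdφ.mono inter_subset_right
  have hdF : ContinuousOn (fun x => fderiv ℝ φ x (F x)) Z :=
    hdφZ.clm_apply (hF.continuousOn.mono hZcl)
  have hflux : ∀ x ∈ Z, flux Ω F χ x = χ x * (fderiv ℝ φ x (F x) / ‖fderiv ℝ φ x‖) := by
    intro x hx
    rw [flux, h.inner_outwardNormal hx.2 ((h.mem_frontier_iff hΩ hx.2).1 hx.1)]
  have hne : ∀ x ∈ Z, ‖fderiv ℝ φ x‖ ≠ 0 := by
    intro x hx h0
    have := h.fderiv_e_pos hx.2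
    rw [norm_eq_zero.1 h0] at this
    simp at this
  have hwc : ContinuousOn (flux Ω F χ) Z := by
    refine ContinuousOn.congr ?_ hflux
    exact hχ.continuous.continuousOn.mul (hdF.div hdφZ.norm hne)
  have hqc : ContinuousOn (fun x => χ x * (fderiv ℝ φ x (F x) / fderiv ℝ φ x e)) Z :=
    hχ.continuous.continuousOn.mul (hdF.div (hdφZ.clm_apply continuousOn_const)
      fun x hx => (h.fderiv_e_pos hx.2).ne')
  have hχ0 : ∀ x, x ∉ tsupport χ → χ x = 0 := fun x hx => image_eq_zero_of_notMem_tsupport hx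
  have hcomp : IsCompact (frontier Ω ∩ tsupport χ) :=
    (hasCompactSupport_of_tsupport_subset_ball hs).isCompact.inter_left isClosed_frontier
  have hcZ : frontier Ω ∩ tsupport χ ⊆ Z := inter_subset_inter_right _
    (hs.trans (Metric.ball_subset_ball (by linarith)))
  obtain ⟨M, hM⟩ := hcomp.exists_bound_of_continuousOn (hwc.mono hcZ)
  have hMZ : ∀ x ∈ Z, ‖flux Ω F χ x‖ ≤ max M 0 := by
    intro x hx
    by_cases hxs : x ∈ tsupport χ
    · exact (hM x ⟨hx.1, hxs⟩).trans (le_max_left _ _)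
    · rw [flux, hχ0 x hxs, zero_mul, norm_zero]
      exact le_max_right _ _
  have hqw : ∀ x ∈ Z, χ x * (fderiv ℝ φ x (F x) / fderiv ℝ φ x e) - flux Ω F χ x =
      (‖fderiv ℝ φ x‖ / fderiv ℝ φ x e - 1) * flux Ω F χ x := by
    intro x hx
    rw [hflux x hx]
    have e1 := hne x hx
    have e2 := (h.fderiv_e_pos hx.2).ne'
    field_simp
  have hσZ : ∀ᵐ x ∂σ, x ∈ Z :=
    (Measure.absolutelyContinuous_of_le h1) (by
      rw [hμ]
      exact ae_mono (Measure.restrict_mono hγZ le_rfl) (ae_restrict_mem hZm))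
  have hμZ : μ ≤ μHE[n].restrict Z := Measure.restrict_mono hγZ le_rfl
  have hwμ : Integrable (flux Ω F χ) μ := by
    refine Integrable.of_bound ((hwc.aestronglyMeasurable hZm).mono_measure hμZ) (max M 0) ?_
    exact ae_mono hμZ ((ae_restrict_iff' hZm).2 (Eventually.of_forall hMZ))
  have hwσ : Integrable (flux Ω F χ) σ := hwμ.mono_measure h1
  have hqm : AEStronglyMeasurable (fun x => χ x * (fderiv ℝ φ x (F x) / fderiv ℝ φ x e)) σ :=
    (hqc.aestronglyMeasurable hZm).mono_measure (h1.trans hμZ)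
  have hdiff : ∀ᵐ x ∂σ, ‖χ x * (fderiv ℝ φ x (F x) / fderiv ℝ φ x e) - flux Ω F χ x‖ ≤
      4 * κ * |flux Ω F χ x| := by
    filter_upwards [hσZ] with x hx
    rw [hqw x hx, norm_mul, Real.norm_eq_abs, Real.norm_eq_abs]
    exact mul_le_mul_of_nonneg_right (h.norm_fderiv_div_le hx.2) (abs_nonneg _)
  have hdi : Integrable (fun x => χ x * (fderiv ℝ φ x (F x) / fderiv ℝ φ x e) - flux Ω F χ x) σ :=
    Integrable.mono' (hwσ.abs.const_mul _) (hqm.sub hwσ.aestronglyMeasurable) hdiff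
  have hqσ : Integrable (fun x => χ x * (fderiv ℝ φ x (F x) / fderiv ℝ φ x e)) σ := by
    refine (hdi.add hwσ).congr (Eventually.of_forall fun x => ?_)
    simp
  have hzero : ∀ x ∈ frontier Ω \ γ '' D, flux Ω F χ x = 0 := by
    rintro x ⟨hx, hxD⟩
    rw [flux, hχ0 x, zero_mul]
    intro hxs
    exact hxD (h.mem_image_of_mem_frontier hΩ hf hx (hs hxs))
  have hsub : γ '' D ⊆ frontier Ω := hγZ.trans inter_subset_left
  have hI : ∫ x in frontier Ω, flux Ω F χ x ∂μHE[n] = ∫ x, flux Ω F χ x ∂μ :=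
    setIntegral_eq_of_subset_of_forall_sdiff_eq_zero isClosed_frontier.measurableSet hsub hzero
  have hIabs : ∫ x in frontier Ω, |flux Ω F χ x| ∂μHE[n] = ∫ x, |flux Ω F χ x| ∂μ :=
    setIntegral_eq_of_subset_of_forall_sdiff_eq_zero isClosed_frontier.measurableSet hsub
      fun x hx => by rw [hzero x hx, abs_zero]
  refine ⟨IntegrableOn.of_forall_sdiff_eq_zero hwμ isClosed_frontier.measurableSet hzero, ?_⟩
  have hI1 : ∫ x in Ω, divg (fun y => χ y • F y) x =
      ∫ x, χ x * (fderiv ℝ φ x (F x) / fderiv ℝ φ x e) ∂σ := by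
    rw [h.integral_divg_smul hΩ hb hf hF hχ hs, hσ, integral_map haem (hσ ▸ hqm)]
  rw [hI1, hI, hIabs]
  -- Two errors add up: `hc1` from replacing `σ` by `μ`, and `hc2` from replacing the density with
  -- denominator `fderiv ℝ φ x e` by the one with the norm of the derivative.
  have hc1 := abs_integral_sub_integral_le h1 h2 hwσ
  have hc2 : |∫ x, (χ x * (fderiv ℝ φ x (F x) / fderiv ℝ φ x e) - flux Ω F χ x) ∂σ| ≤
      4 * κ * ∫ x, |flux Ω F χ x| ∂σ := by
    rw [← integral_const_mul]
    exact norm_integral_le_of_norm_le (hwσ.abs.const_mul _) hdiff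
  rw [integral_sub hqσ hwσ] at hc2
  have hc3 : ∫ x, |flux Ω F χ x| ∂σ ≤ ∫ x, |flux Ω F χ x| ∂μ :=
    integral_mono_measure h1 (Eventually.of_forall fun x => abs_nonneg _) hwμ.abs
  rw [NNReal.coe_pow, hL] at hc1
  have hL1 : 0 ≤ ((1 - κ)⁻¹) ^ n - 1 := by
    rw [sub_nonneg]
    exact one_le_pow₀ ((one_le_inv₀ (by linarith)).2 (by linarith))
  have htri := abs_sub_le (∫ x, χ x * (fderiv ℝ φ x (F x) / fderiv ℝ φ x e) ∂σ)
    (∫ x, flux Ω F χ x ∂σ) (∫ x, flux Ω F χ x ∂μ)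
  have hfinal : (4 * κ + (((1 - κ)⁻¹) ^ n - 1)) * ∫ x, |flux Ω F χ x| ∂σ ≤
      (4 * κ + (((1 - κ)⁻¹) ^ n - 1)) * ∫ x, |flux Ω F χ x| ∂μ :=
    mul_le_mul_of_nonneg_left hc3 (by positivity)
  linarith

end GraphChart

/-! ### Globalization by a partition of unity -/

theorem tr_sum {ι : Type*} (s : Finset ι) (A : ι → E n →L[ℝ] E n) :
    tr (∑ i ∈ s, A i) = ∑ i ∈ s, tr (A i) := by
  simp only [tr, sum_apply, inner_sum]
  exact Finset.sum_comm

theorem exists_tilt_lt (m : ℕ) {ε : ℝ} (hε : 0 < ε) :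
    ∃ κ : ℝ, 0 < κ ∧ κ ≤ 1 / 4 ∧ 4 * κ + (((1 - κ)⁻¹) ^ m - 1) ≤ ε := by
  have hc : ContinuousAt (fun κ : ℝ => 4 * κ + (((1 - κ)⁻¹) ^ m - 1)) 0 := by
    have : ContinuousAt (fun κ : ℝ => (1 - κ)⁻¹) 0 :=
      (continuousAt_const.sub continuousAt_id).inv₀ (by simp)
    exact (continuousAt_const.mul continuousAt_id).add ((this.pow m).sub continuousAt_const)
  have h1 : ∀ᶠ κ : ℝ in 𝓝[>] 0, 4 * κ + (((1 - κ)⁻¹) ^ m - 1) < ε :=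
    (hc.eventually (gt_mem_nhds (by simpa using hε))).filter_mono nhdsWithin_le_nhds
  have h2 : ∀ᶠ κ : ℝ in 𝓝[>] 0, κ ∈ Ioo (0 : ℝ) (1 / 4) := Ioo_mem_nhdsGT (by norm_num)
  obtain ⟨κ, h3, h4⟩ := (h1.and h2).exists
  exact ⟨κ, h4.1, h4.2.le, h3.le⟩

/-- The divergence theorem for `χ • F` up to a relative error `ε`, for `χ` supported near a
point. -/
theorem exists_ball_abs_integral_divg_sub_le {Ω Λ : Set (E n)} (hΩ : IsOpen Ω)
    (hb : Bornology.IsBounded Ω) (hΛ : IsClosed Λ)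
    (hreg : ∀ p ∈ frontier Ω \ Λ, ∃ φ, IsDefiningFunctionAt Ω p φ) {F : E n → E n}
    (hF : ContDiffOn ℝ 1 F (closure Ω \ Λ)) {ε : ℝ} (hε : 0 < ε) {x : E n} (hx : x ∉ Λ) :
    ∃ U : Set (E n), IsOpen U ∧ x ∈ U ∧ ∀ χ : E n → ℝ, ContDiff ℝ 1 χ → HasCompactSupport χ →
      tsupport χ ⊆ U → IntegrableOn (flux Ω F χ) (frontier Ω) μHE[n] ∧
      |(∫ y in Ω, divg (fun z => χ z • F z) y) - ∫ y in frontier Ω, flux Ω F χ y ∂μHE[n]| ≤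
        ε * ∫ y in frontier Ω, |flux Ω F χ y| ∂μHE[n] := by
  -- If `χ` is supported inside `Ω` or off its closure, both sides of the divergence theorem vanish.
  have hoff : ∀ χ : E n → ℝ, (∀ y ∈ frontier Ω, χ y = 0) →
      (∫ y in Ω, divg (fun z => χ z • F z) y) = 0 →
      IntegrableOn (flux Ω F χ) (frontier Ω) μHE[n] ∧
      |(∫ y in Ω, divg (fun z => χ z • F z) y) - ∫ y in frontier Ω, flux Ω F χ y ∂μHE[n]| ≤
        ε * ∫ y in frontier Ω, |flux Ω F χ y| ∂μHE[n] := by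
    intro χ h0 h1
    have h2 : ∀ y ∈ frontier Ω, flux Ω F χ y = 0 := fun y hy => by rw [flux, h0 y hy, zero_mul]
    refine ⟨(integrableOn_congr_fun h2 isClosed_frontier.measurableSet).2 (by simp), ?_⟩
    rw [h1, setIntegral_congr_fun isClosed_frontier.measurableSet h2]
    simp only [integral_zero, sub_zero, abs_zero]
    exact mul_nonneg hε.le (integral_nonneg fun y => abs_nonneg _)
  by_cases hxΩ : x ∈ Ω
  · refine ⟨Ω \ Λ, hΩ.sdiff hΛ, ⟨hxΩ, hx⟩, fun χ hχ hc hs => hoff χ ?_ ?_⟩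
    · intro y hy
      refine image_eq_zero_of_notMem_tsupport fun h => ?_
      rw [hΩ.frontier_eq] at hy
      exact hy.2 (hs h).1
    · rw [← integral_divg_eq_zero (G := fun z => χ z • F z) ?_ hc.smul_right]
      · refine setIntegral_eq_integral_of_forall_compl_eq_zero fun y hy => ?_
        have h0 : χ =ᶠ[𝓝 y] fun _ => 0 :=
          notMem_tsupport_iff_eventuallyEq.1 fun h => hy (hs h).1
        have h1 : (fun z => χ z • F z) =ᶠ[𝓝 y] fun _ => 0 := by
          filter_upwards [h0] with z hz
          simp [hz]
        unfold divg
        rw [h1.fderiv_eq]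
        simp [tr]
      · refine contDiff_iff_contDiffAt.2 fun y => ?_
        by_cases hy : y ∈ tsupport χ
        · refine hχ.contDiffAt.smul ((hF y ⟨subset_closure (hs hy).1, (hs hy).2⟩).contDiffAt ?_)
          exact Filter.mem_of_superset ((hΩ.sdiff hΛ).mem_nhds (hs hy))
            (sdiff_subset_sdiff_left subset_closure)
        · have h0 := notMem_tsupport_iff_eventuallyEq.1 hy
          refine contDiffAt_const (c := (0 : E n)) |>.congr_of_eventuallyEq ?_
          filter_upwards [h0] with z hz
          simp [hz]
  by_cases hxc : x ∈ closure Ω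
  · have hxf : x ∈ frontier Ω \ Λ := ⟨by rw [hΩ.frontier_eq]; exact ⟨hxc, hxΩ⟩, hx⟩
    obtain ⟨φ, hφ⟩ := hreg x hxf
    obtain ⟨κ, hκ, hκ', hκε⟩ := exists_tilt_lt n hε
    obtain ⟨δ, hδ, hδΛ⟩ := Metric.isOpen_iff.1 hΛ.isOpen_compl x hx
    obtain ⟨r, hr, hchart⟩ := hφ.exists_graphChart hκ hκ' (show 0 < δ / 3 by positivity)
    refine ⟨Metric.ball x r, Metric.isOpen_ball, Metric.mem_ball_self hchart.r_pos,
      fun χ hχ hc hs => ?_⟩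
    have hF' : ContDiffOn ℝ 1 F (closure Ω ∩ Metric.ball x (3 * r)) := hF.mono fun y hy =>
      ⟨hy.1, hδΛ (Metric.ball_subset_ball (by linarith) hy.2)⟩
    obtain ⟨h1, h2⟩ := hchart.abs_integral_divg_sub_le hΩ hb hF' hχ hs
    exact ⟨h1, h2.trans (mul_le_mul_of_nonneg_right hκε (integral_nonneg fun y => abs_nonneg _))⟩
  · refine ⟨(closure Ω)ᶜ, isClosed_closure.isOpen_compl, hxc, fun χ hχ hc hs => hoff χ ?_ ?_⟩
    · intro y hy
      refine image_eq_zero_of_notMem_tsupport fun h => ?_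
      exact hs h (frontier_subset_closure hy)
    · refine setIntegral_eq_zero_of_forall_eq_zero fun y hy => ?_
      have h0 : χ =ᶠ[𝓝 y] fun _ => 0 :=
        notMem_tsupport_iff_eventuallyEq.1 fun h => hs h (subset_closure hy)
      have h1 : (fun z => χ z • F z) =ᶠ[𝓝 y] fun _ => 0 := by
        filter_upwards [h0] with z hz
        simp [hz]
      unfold divg
      rw [h1.fderiv_eq]
      simp [tr]

theorem integrableOn_divg_smul {Ω Λ : Set (E n)} (hΩ : IsOpen Ω)
    (hb : Bornology.IsBounded Ω) (hΛ : IsClosed Λ) {F : E n → E n}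
    (hF : ContDiffOn ℝ 1 F (closure Ω \ Λ)) {χ : E n → ℝ} (hχ : ContDiff ℝ 1 χ)
    (hc : HasCompactSupport χ) (hs : Disjoint (tsupport χ) Λ) :
    DifferentiableOn ℝ (fun z => χ z • F z) Ω ∧ IntegrableOn (divg fun z => χ z • F z) Ω := by
  obtain ⟨hA, hAc, C, hC⟩ := fderiv_bounded_of_tsupport_subset hΩ hΛ.isOpen_compl
    (q := fun z => χ z • F z) (hχ.contDiffOn.smul hF) hc.smul_right
    ((tsupport_smul_subset_left χ F).trans (disjoint_left.1 hs))
  exact ⟨hA.differentiableOn one_ne_zero,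
    integrableOn_of_continuousOn_of_bounded hΩ hb (continuous_tr.comp_continuousOn hAc)
    (C := (n + 1) * C) fun x hx =>
      (abs_tr_le _).trans (mul_le_mul_of_nonneg_left (hC x hx) (by positivity))⟩

/-- The divergence theorem on a bounded open set whose boundary is smooth off a closed set `Λ`, for
vector fields multiplied by a cutoff function that vanishes near `Λ`. -/
theorem integral_divg_smul_eq_integral_flux {Ω Λ : Set (E n)} (hΩ : IsOpen Ω)
    (hb : Bornology.IsBounded Ω) (hΛ : IsClosed Λ)
    (hreg : ∀ p ∈ frontier Ω \ Λ, ∃ φ, IsDefiningFunctionAt Ω p φ) {F : E n → E n}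
    (hF : ContDiffOn ℝ 1 F (closure Ω \ Λ)) {χ : E n → ℝ} (hχ : ContDiff ℝ 1 χ)
    (hc : HasCompactSupport χ) (hs : Disjoint (tsupport χ) Λ) :
    IntegrableOn (flux Ω F χ) (frontier Ω) μHE[n] ∧
      ∫ y in Ω, divg (fun z => χ z • F z) y = ∫ y in frontier Ω, flux Ω F χ y ∂μHE[n] := by
  have key : ∀ ε > 0, IntegrableOn (flux Ω F χ) (frontier Ω) μHE[n] ∧
      |(∫ y in Ω, divg (fun z => χ z • F z) y) - ∫ y in frontier Ω, flux Ω F χ y ∂μHE[n]| ≤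
        ε * ∫ y in frontier Ω, |flux Ω F χ y| ∂μHE[n] := by
    intro ε hε
    choose! U hUo hxU hU using fun x (hx : x ∉ Λ) =>
      exists_ball_abs_integral_divg_sub_le hΩ hb hΛ hreg hF hε hx
    have hsΛ : ∀ x ∈ tsupport χ, x ∉ Λ := fun x hx => disjoint_left.1 hs hx
    obtain ⟨t, hts, ht⟩ := hc.isCompact.elim_nhds_subcover U
      fun x hx => (hUo x (hsΛ x hx)).mem_nhds (hxU x (hsΛ x hx))
    obtain ⟨ρ, hρ⟩ := SmoothPartitionOfUnity.exists_isSubordinate (modelWithCornersSelf ℝ (E n))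
      (isClosed_tsupport χ) (fun i : t => U i) (fun i => hUo i (hsΛ i (hts i i.2)))
      (by
        intro x hx
        obtain ⟨i, hi, hxi⟩ := mem_iUnion₂.1 (ht hx)
        exact mem_iUnion.2 ⟨⟨i, hi⟩, hxi⟩)
    set η : t → E n → ℝ := fun i x => ρ i x * χ x with hη
    have hηC : ∀ i, ContDiff ℝ 1 (η i) := fun i =>
      (((ρ i).contMDiff.contDiff).of_le (by simp)).mul hχ
    have hηs : ∀ i, tsupport (η i) ⊆ tsupport χ := fun i => tsupport_mul_subset_right
    have hηc : ∀ i, HasCompactSupport (η i) := fun i => hc.mul_left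
    have hηU : ∀ i, tsupport (η i) ⊆ U i := fun i =>
      (tsupport_mul_subset_left (f := fun x => ρ i x) (g := χ)).trans (hρ i)
    have hsum : ∀ x, ∑ i, η i x = χ x := by
      intro x
      simp only [hη, ← Finset.sum_mul]
      by_cases hx : x ∈ tsupport χ
      · have := ρ.sum_eq_one hx
        rw [finsum_eq_sum_of_fintype] at this
        rw [this, one_mul]
      · rw [image_eq_zero_of_notMem_tsupport hx, mul_zero]
    have hloc := fun i : t => hU i (hsΛ i (hts i i.2)) (η i) (hηC i) (hηc i) (hηU i)
    have hfs : ∀ x, flux Ω F χ x = ∑ i, flux Ω F (η i) x := by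
      intro x
      simp only [flux, ← Finset.sum_mul, hsum]
    -- Because the partition functions are nonnegative, the absolute flux densities also add up
    -- exactly. The relative errors therefore sum to `ε` times a quantity that does not depend on
    -- the number of pieces.
    have hfa : ∀ x, |flux Ω F χ x| = ∑ i, |flux Ω F (η i) x| := by
      intro x
      have : ∀ i, |flux Ω F (η i) x| = ρ i x * |flux Ω F χ x| := by
        intro i
        simp only [flux, hη, mul_assoc, abs_mul, abs_of_nonneg (ρ.nonneg i x)]
      simp only [this, ← Finset.sum_mul]
      by_cases hx : x ∈ tsupport χ
      · have := ρ.sum_eq_one hx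
        rw [finsum_eq_sum_of_fintype] at this
        rw [this, one_mul]
      · simp [flux, image_eq_zero_of_notMem_tsupport hx]
    have hdv := fun i : t =>
      integrableOn_divg_smul hΩ hb hΛ hF (hηC i) (hηc i) (hs.mono_left (hηs i))
    have hd : ∫ y in Ω, divg (fun z => χ z • F z) y =
        ∑ i, ∫ y in Ω, divg (fun z => η i z • F z) y := by
      rw [← integral_finsetSum _ fun i _ => (hdv i).2]
      refine setIntegral_congr_fun hΩ.measurableSet fun x hx => ?_
      have h1 : (fun z => χ z • F z) = fun z => ∑ i, η i z • F z := by
        ext1 z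
        rw [← Finset.sum_smul, hsum]
      simp only [h1, divg]
      rw [fderiv_fun_sum fun i _ => ((hdv i).1 x hx).differentiableAt (hΩ.mem_nhds hx), tr_sum]
    have hint : IntegrableOn (flux Ω F χ) (frontier Ω) μHE[n] := by
      have : flux Ω F χ = fun x => ∑ i, flux Ω F (η i) x := funext hfs
      rw [this]
      exact integrable_finsetSum _ fun i _ => (hloc i).1
    refine ⟨hint, ?_⟩
    simp only [hfa]
    simp only [hfs]
    rw [hd, integral_finsetSum _ fun i _ => (hloc i).1,
      integral_finsetSum _ fun i _ => (hloc i).1.abs, ← Finset.sum_sub_distrib, Finset.mul_sum]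
    exact (Finset.abs_sum_le_sum_abs _ _).trans (Finset.sum_le_sum fun i _ => (hloc i).2)
  refine ⟨(key 1 one_pos).1, ?_⟩
  rw [← sub_eq_zero, ← abs_nonpos_iff]
  set M := ∫ y in frontier Ω, |flux Ω F χ y| ∂μHE[n] with hM
  have hM0 : 0 ≤ M := integral_nonneg fun y => abs_nonneg _
  refine le_of_forall_pos_le_add fun ε hε => ?_
  -- The `+ 1` avoids a division by zero when `M = 0`.
  have h1 := (key (ε / (M + 1)) (by positivity)).2
  refine h1.trans ?_
  rw [zero_add, div_mul_eq_mul_div, div_le_iff₀ (by positivity)]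
  nlinarith

/-! ### Volume of the neighbourhoods of the edge -/

/-- Stretching by `1 / ε` along `v₁` and `v₂`, a composition of two transvections of determinant
`ε⁻¹` each, carries the thin set into a ball whose radius does not depend on `ε`. -/
theorem volume_slab_le {l₁ l₂ : E n →L[ℝ] ℝ} {v₁ v₂ : E n} (h11 : l₁ v₁ = 1)
    (h21 : l₂ v₁ = 0) (h22 : l₂ v₂ = 1) {R C ε : ℝ} (hε : 0 < ε) (hε1 : ε ≤ 1)
    {S : Set (E n)} (hS : ∀ y ∈ S, ‖y‖ ≤ R ∧ |l₁ y| ≤ C * ε ∧ |l₂ y| ≤ C * ε) :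
    volume S ≤ ENNReal.ofReal (ε ^ 2) *
      volume (Metric.closedBall (0 : E n) (R + C * (‖v₁‖ + ‖v₂‖))) := by
  set s : ℝ := ε⁻¹ - 1 with hs
  set D : E n →ₗ[ℝ] E n := (LinearMap.transvection (s • (l₂ : E n →ₗ[ℝ] ℝ)) v₂) ∘ₗ
    (LinearMap.transvection (s • (l₁ : E n →ₗ[ℝ] ℝ)) v₁) with hD
  have hDy : ∀ y, D y = y + (s * l₁ y) • v₁ + (s * l₂ y) • v₂ := fun y => by
    simp [hD, LinearMap.transvection.apply, h21]
  have hdet : LinearMap.det D = (ε ^ 2)⁻¹ := by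
    rw [hD, LinearMap.det_comp, LinearMap.transvection.det, LinearMap.transvection.det]
    simp [h11, h22, hs]
    ring
  have h1 := Measure.addHaar_image_linearMap (volume : Measure (E n)) D S
  rw [hdet, abs_of_nonneg (by positivity)] at h1
  have h2 : D '' S ⊆ Metric.closedBall (0 : E n) (R + C * (‖v₁‖ + ‖v₂‖)) := by
    rintro _ ⟨y, hy, rfl⟩
    obtain ⟨hy0, hy1, hy2⟩ := hS y hy
    have hs0 : 0 ≤ s := sub_nonneg.2 ((one_le_inv₀ hε).2 hε1)
    have hsε : s * ε ≤ 1 := by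
      rw [hs, sub_mul, inv_mul_cancel₀ hε.ne']; linarith
    have hb : ∀ l : E n →L[ℝ] ℝ, |l y| ≤ C * ε → ∀ v : E n, ‖(s * l y) • v‖ ≤ C * ‖v‖ := by
      intro l hl v
      have hC : 0 ≤ C := by
        by_contra! hC
        have := abs_nonneg (l y)
        nlinarith
      rw [norm_smul, norm_mul, Real.norm_eq_abs, Real.norm_eq_abs, abs_of_nonneg hs0]
      refine mul_le_mul_of_nonneg_right ?_ (norm_nonneg _)
      calc s * |l y| ≤ s * (C * ε) := mul_le_mul_of_nonneg_left hl hs0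
        _ = C * (s * ε) := by ring
        _ ≤ C * 1 := mul_le_mul_of_nonneg_left hsε hC
        _ = C := mul_one C
    rw [mem_closedBall_zero_iff, hDy]
    refine (norm_add₃_le).trans ?_
    linarith [hb l₁ hy1 v₁, hb l₂ hy2 v₂]
  have h3 : volume S = ENNReal.ofReal (ε ^ 2) * volume (D '' S) := by
    rw [h1, ← mul_assoc, ← ENNReal.ofReal_mul (by positivity), mul_inv_cancel₀ (by positivity),
      ENNReal.ofReal_one, one_mul]
  rw [h3]
  exact mul_le_mul_right (measure_mono h2) _

/-- The inverse of `Ψ` on the image is 2-Lipschitz, and Lebesgue measure is the normalized Hausdorff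
measure of full dimension. -/
theorem volume_le_of_expanding {Ψ : E n → E n} {B : Set (E n)}
    (hΨ : ∀ x ∈ B, ∀ y ∈ B, ‖x - y‖ ≤ 2 * ‖Ψ x - Ψ y‖) {S : Set (E n)} (hS : S ⊆ B) :
    volume S ≤ 2 ^ (n + 1) * volume (Ψ '' S) := by
  have hinj : InjOn Ψ S := fun x hx y hy hxy => by
    have := hΨ x (hS hx) y (hS hy)
    rw [hxy, sub_self, norm_zero, mul_zero, norm_le_zero_iff, sub_eq_zero] at this
    exact this
  have hl : LipschitzOnWith 2 (Function.invFunOn Ψ S) (Ψ '' S) := by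
    refine LipschitzOnWith.of_dist_le_mul ?_
    rintro _ ⟨x, hx, rfl⟩ _ ⟨y, hy, rfl⟩
    rw [hinj.leftInvOn_invFunOn hx, hinj.leftInvOn_invFunOn hy, dist_eq_norm, dist_eq_norm]
    exact hΨ x (hS hx) y (hS hy)
  have h1 := euclideanHausdorffMeasure_image_le hl (n + 1)
  rw [image_image, image_congr fun x hx => hinj.leftInvOn_invFunOn hx, image_id',
    EuclideanSpace.euclideanHausdorffMeasure_eq_volume] at h1
  exact_mod_cast h1

/-- The volume of the part near `p` of the `ε`-neighbourhood of a submanifold of the sphere of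
dimension `N - 2` is `O(ε²)`. -/
theorem IsSphereHypersurface.exists_ball_volume_le {Λ : Set (E n)} (hΛ : IsSphereHypersurface Λ)
    {p : E n} (hp : p ∈ Λ) :
    ∃ R > 0, ∃ M : ENNReal, M ≠ ⊤ ∧ ∀ ε : ℝ, 0 < ε → ε ≤ 1 →
      volume {x ∈ Metric.ball p R | ∃ y ∈ Λ ∩ Metric.ball p R, dist x y < ε} ≤
        ENNReal.ofReal (ε ^ 2) * M := by
  obtain ⟨g, U, hU, hpU, hg, hiff, w, hpw, hgw⟩ := hΛ p hp
  have hp1 : ‖p‖ = 1 := ((hiff p hpU).1 hp).1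
  set l₁ : E n →L[ℝ] ℝ := (2 : ℝ) • innerSL ℝ p with hl₁
  set l₂ : E n →L[ℝ] ℝ := fderiv ℝ g p with hl₂
  -- The pair `v₁`, `v₂` is dual to the differentials `l₁`, `l₂` of `‖x‖ ^ 2 - 1` and `g` at `p`.
  -- This is possible because `w` is tangent to the sphere and `g` has nonzero derivative along it.
  set v₂ : E n := (l₂ w)⁻¹ • w with hv₂
  set v₁ : E n := (1 / 2 : ℝ) • p - (l₂ ((1 / 2 : ℝ) • p)) • v₂ with hv₁
  have h22 : l₂ v₂ = 1 := by rw [hv₂, map_smul, smul_eq_mul, inv_mul_cancel₀ hgw]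
  have h12 : l₁ v₂ = 0 := by simp [hl₁, hv₂, hpw]
  have h21 : l₂ v₁ = 0 := by rw [hv₁, map_sub, map_smul l₂ _ v₂, h22]; simp
  have h11 : l₁ v₁ = 1 := by
    rw [hv₁, map_sub, map_smul l₁ _ v₂, h12]
    simp [hl₁, hp1]
  -- `Ψ` straightens the edge: its components under `l₁` and `l₂` are `‖x‖ ^ 2 - 1` and `g`, both
  -- zero on `Λ`, and its derivative at `p` is the identity. Near `p` it distorts distances by at
  -- most a factor 2, so points within `ε` of `Λ` go into a slab of thickness comparable to `ε` in
  -- two directions.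
  set Ψ : E n → E n := fun x => x + (‖x‖ ^ 2 - 1 - l₁ x) • v₁ + (g x - l₂ x) • v₂ with hΨ
  have hΨ1 : ∀ x, l₁ (Ψ x) = ‖x‖ ^ 2 - 1 := fun x => by
    simp only [hΨ, map_add, map_smul, h11, h12, smul_eq_mul]; ring
  have hΨ2 : ∀ x, l₂ (Ψ x) = g x := fun x => by
    simp only [hΨ, map_add, map_smul, h21, h22, smul_eq_mul]; ring
  have hst : HasStrictFDerivAt Ψ (ContinuousLinearMap.id ℝ (E n)) p := by
    have hgs : HasStrictFDerivAt g l₂ p :=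
      (hg.contDiffAt (hU.mem_nhds hpU)).hasStrictFDerivAt (by simp)
    have hns : HasStrictFDerivAt (fun x : E n => ‖x‖ ^ 2) l₁ p := by
      have := hasStrictFDerivAt_norm_sq p
      rwa [← Nat.cast_smul_eq_nsmul ℝ, Nat.cast_ofNat] at this
    have := ((hasStrictFDerivAt_id p).add
      (((hns.sub_const 1).sub l₁.hasStrictFDerivAt).smul_const v₁)).add
      ((hgs.sub l₂.hasStrictFDerivAt).smul_const v₂)
    rw [sub_self, sub_self] at this
    refine this.congr_fderiv ?_
    ext x
    simp
  obtain ⟨s, hsp, hsa⟩ := hst.approximates_deriv_on_nhds (c := 1 / 2) (Or.inr (by norm_num))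
  obtain ⟨R, hR, hRs⟩ := Metric.mem_nhds_iff.1 (Filter.inter_mem hsp (hU.mem_nhds hpU))
  have happ : ∀ x ∈ Metric.ball p R, ∀ y ∈ Metric.ball p R,
      ‖Ψ x - Ψ y - (x - y)‖ ≤ 1 / 2 * ‖x - y‖ := fun x hx y hy => by
    simpa using hsa x (hRs hx).1 y (hRs hy).1
  have hexp : ∀ x ∈ Metric.ball p R, ∀ y ∈ Metric.ball p R, ‖x - y‖ ≤ 2 * ‖Ψ x - Ψ y‖ := by
    intro x hx y hy
    have h1 := happ x hx y hy
    have h2 := norm_sub_norm_le (x - y) (Ψ x - Ψ y)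
    rw [norm_sub_rev (x - y)] at h2
    linarith
  have hlip : ∀ x ∈ Metric.ball p R, ∀ y ∈ Metric.ball p R, ‖Ψ x - Ψ y‖ ≤ 2 * ‖x - y‖ := by
    intro x hx y hy
    have h1 := happ x hx y hy
    have h2 := norm_sub_norm_le (Ψ x - Ψ y) (x - y)
    linarith [norm_nonneg (x - y)]
  set C : ℝ := 2 * (‖l₁‖ + ‖l₂‖) with hC
  refine ⟨R, hR, 2 ^ (n + 1) * volume (Metric.closedBall (0 : E n)
    (‖Ψ p‖ + 2 * R + C * (‖v₁‖ + ‖v₂‖))), ?_, fun ε hε hε1 => ?_⟩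
  · exact ENNReal.mul_ne_top (by simp) measure_closedBall_lt_top.ne
  refine (volume_le_of_expanding hexp (sep_subset _ _)).trans ?_
  rw [mul_left_comm]
  refine mul_le_mul_right (volume_slab_le h11 h21 h22 hε hε1 ?_) _
  rintro _ ⟨x, ⟨hx, y, ⟨hyΛ, hyR⟩, hxy⟩, rfl⟩
  have hy0 := (hiff y (hRs hyR).2).1 hyΛ
  have h1 := hlip x hx y hyR
  rw [dist_eq_norm] at hxy
  have hb : ∀ l : E n →L[ℝ] ℝ, l (Ψ y) = 0 → |l (Ψ x)| ≤ ‖l‖ * (2 * ε) := by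
    intro l hl
    have h2 := l.le_opNorm (Ψ x - Ψ y)
    rw [map_sub, hl, sub_zero, Real.norm_eq_abs] at h2
    exact h2.trans (mul_le_mul_of_nonneg_left (by linarith) (norm_nonneg _))
  refine ⟨?_, ?_, ?_⟩
  · have h2 := hlip x hx p (Metric.mem_ball_self hR)
    have h3 := norm_sub_norm_le (Ψ x) (Ψ p)
    have h4 : ‖x - p‖ < R := mem_ball_iff_norm.1 hx
    linarith
  · refine (hb l₁ (by rw [hΨ1, hy0.1]; ring)).trans ?_
    rw [hC]
    nlinarith [mul_nonneg (norm_nonneg l₂) hε.le]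
  · refine (hb l₂ (by rw [hΨ2, hy0.2])).trans ?_
    rw [hC]
    nlinarith [mul_nonneg (norm_nonneg l₁) hε.le]

/-- The local estimates pass to finite unions, hence to the compact set `Λ`. -/
theorem IsSphereHypersurface.exists_volume_thickening_le {Λ : Set (E n)}
    (hΛ : IsSphereHypersurface Λ) (hc : IsCompact Λ) :
    ∃ ε₀ > 0, ∃ M : ENNReal, M ≠ ⊤ ∧ ∀ ε : ℝ, 0 < ε → ε ≤ ε₀ →
      volume (Metric.thickening ε Λ) ≤ ENNReal.ofReal (ε ^ 2) * M := by
  refine hc.induction_on (p := fun s => ∃ ε₀ > 0, ∃ M : ENNReal, M ≠ ⊤ ∧ ∀ ε : ℝ, 0 < ε → ε ≤ ε₀ →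
      volume (Metric.thickening ε s) ≤ ENNReal.ofReal (ε ^ 2) * M) ?_ ?_ ?_ ?_
  · exact ⟨1, one_pos, 0, by simp, fun ε _ _ => by simp⟩
  · rintro s t hst ⟨ε₀, h0, M, hM, h⟩
    exact ⟨ε₀, h0, M, hM, fun ε h1 h2 =>
      (measure_mono (Metric.thickening_subset_of_subset ε hst)).trans (h ε h1 h2)⟩
  · rintro s t ⟨ε₀, h0, M, hM, h⟩ ⟨ε₁, h0', M', hM', h'⟩
    refine ⟨min ε₀ ε₁, lt_min h0 h0', M + M', ENNReal.add_ne_top.2 ⟨hM, hM'⟩, fun ε h1 h2 => ?_⟩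
    rw [Metric.thickening_union, mul_add]
    exact (measure_union_le _ _).trans (add_le_add (h ε h1 (h2.trans (min_le_left _ _)))
      (h' ε h1 (h2.trans (min_le_right _ _))))
  · intro p hp
    obtain ⟨R, hR, M, hM, h⟩ := hΛ.exists_ball_volume_le hp
    -- Half the radius leaves room for thickenings of width up to `R / 2` inside the ball of radius
    -- `R`.
    refine ⟨Λ ∩ Metric.ball p (R / 2), inter_mem_nhdsWithin _ (Metric.ball_mem_nhds p (by positivity)),
      min 1 (R / 2), by positivity, M, hM, fun ε h1 h2 => ?_⟩
    refine (measure_mono fun x hx => ?_).trans (h ε h1 (h2.trans (min_le_left _ _)))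
    obtain ⟨y, ⟨hyΛ, hyR⟩, hxy⟩ := Metric.mem_thickening_iff.1 hx
    refine ⟨?_, y, ⟨hyΛ, Metric.ball_subset_ball (by linarith) hyR⟩, hxy⟩
    rw [Metric.mem_ball] at hyR ⊢
    have := dist_triangle x y p
    have := h2.trans (min_le_right _ _)
    linarith

/-! ### Cutoff functions near the edge -/

/-- A smooth cutoff function that vanishes near `Λ`. -/
theorem exists_smooth_cutoff (Λ : Set (E n)) {δ : ℝ} (hδ : 0 < δ) :
    ∃ η : E n → ℝ, ContDiff ℝ ∞ η ∧ (∀ x, 0 ≤ η x) ∧ (∀ x, η x ≤ 1) ∧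
      (∀ x ∈ Metric.thickening δ Λ, η x = 0) ∧ (∀ x ∉ Metric.thickening (4 * δ) Λ, η x = 1) ∧
      ∀ x, ‖fderiv ℝ η x‖ ≤ δ⁻¹ := by
  rcases Λ.eq_empty_or_nonempty with rfl | hne
  · exact ⟨fun _ => 1, contDiff_const, by simp, by simp, by simp, by simp, by simp [hδ.le]⟩
  have hthick : ∀ (a : ℝ) (x : E n), x ∈ Metric.thickening a Λ ↔ Metric.infDist x Λ < a :=
    fun a x => Metric.mem_thickening_iff_infDist_lt hne
  -- `L` is 0 up to distance `2 * δ` from `Λ`, is 1 beyond distance `3 * δ`, and is Lipschitz with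
  -- constant `δ⁻¹`. Mollification at scale `δ` preserves the Lipschitz bound and costs one `δ` on
  -- either side.
  set L : E n → ℝ := fun x => min 1 (max 0 (δ⁻¹ * Metric.infDist x Λ - 2)) with hL
  have hLlip : ∀ x y, |L x - L y| ≤ δ⁻¹ * ‖x - y‖ := by
    intro x y
    have h1 : |L x - L y| ≤ |(δ⁻¹ * Metric.infDist x Λ - 2) - (δ⁻¹ * Metric.infDist y Λ - 2)| := by
      have e1 := abs_min_sub_min_le_max 1 (max 0 (δ⁻¹ * Metric.infDist x Λ - 2)) 1
        (max 0 (δ⁻¹ * Metric.infDist y Λ - 2))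
      have e2 := abs_max_sub_max_le_max 0 (δ⁻¹ * Metric.infDist x Λ - 2) 0
        (δ⁻¹ * Metric.infDist y Λ - 2)
      simp only [sub_self, abs_zero] at e1 e2
      exact (e1.trans_eq (max_eq_right (abs_nonneg _))).trans
        (e2.trans_eq (max_eq_right (abs_nonneg _)))
    refine h1.trans ?_
    rw [sub_sub_sub_cancel_right, ← mul_sub, abs_mul, abs_of_pos (inv_pos.2 hδ)]
    refine mul_le_mul_of_nonneg_left ?_ (inv_nonneg.2 hδ.le)
    have := (Metric.lipschitz_infDist_pt Λ).dist_le_mul x y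
    rwa [NNReal.coe_one, one_mul, Real.dist_eq, dist_eq_norm] at this
  have hL0 : ∀ x, 0 ≤ L x := fun x => le_min zero_le_one (le_max_left _ _)
  have hL1 : ∀ x, L x ≤ 1 := fun x => min_le_left _ _
  have hLc : Continuous L := by
    have := Metric.continuous_infDist_pt Λ
    fun_prop
  have hdist : ∀ x y, Metric.infDist x Λ ≤ Metric.infDist y Λ + dist x y := fun x y =>
    Metric.infDist_le_infDist_add_dist
  set β : ContDiffBump (0 : E n) := ⟨δ / 2, δ, by positivity, by linarith⟩ with hβ
  set ψ : E n → ℝ := β.normed volume with hψ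
  have hψ0 : ∀ t, 0 ≤ ψ t := fun t => β.nonneg_normed t
  have hψ1 : ∫ t, ψ t = 1 := β.integral_normed
  have hψi : Integrable ψ := β.integrable_normed
  have hψL : ∀ x, Integrable fun t => ψ t * L (x - t) := fun x =>
    hψi.mul_bdd (c := 1) (by fun_prop) (Eventually.of_forall fun t => by
      rw [Real.norm_of_nonneg (hL0 _)]; exact hL1 _)
  set η : E n → ℝ := convolution ψ L (ContinuousLinearMap.lsmul ℝ ℝ) volume with hη
  have hηx : ∀ x, η x = ∫ t, ψ t * L (x - t) := fun x => by
    simp [hη, convolution]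
  refine ⟨η, ?_, ?_, ?_, ?_, ?_, ?_⟩
  · exact β.hasCompactSupport_normed.contDiff_convolution_left _ β.contDiff_normed
      hLc.locallyIntegrable
  · intro x
    rw [hηx]
    exact integral_nonneg fun t => mul_nonneg (hψ0 t) (hL0 _)
  · intro x
    rw [hηx, ← hψ1]
    exact integral_mono (hψL x) hψi fun t => mul_le_of_le_one_right (hψ0 t) (hL1 _)
  · intro x hx
    rw [hthick] at hx
    have h0 : ∀ y ∈ Metric.ball x δ, L y = 0 := by
      intro y hy
      have h1 := hdist y x
      have h2 : dist y x < δ := hy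
      have h3 : δ⁻¹ * Metric.infDist y Λ - 2 ≤ 0 := by
        rw [sub_nonpos, inv_mul_le_iff₀ hδ]; linarith
      simp only [hL]
      rw [max_eq_left h3]
      exact min_eq_right zero_le_one
    have hx0 := h0 x (Metric.mem_ball_self hδ)
    have := β.normed_convolution_eq_right (μ := volume) (g := L) (x₀ := x)
      fun y hy => by rw [h0 y hy, hx0]
    rw [hη, hψ, this, hx0]
  · intro x hx
    rw [hthick, not_lt] at hx
    have h0 : ∀ y ∈ Metric.ball x δ, L y = 1 := by
      intro y hy
      have h1 := hdist x y
      have h2 : dist y x < δ := hy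
      rw [dist_comm] at h2
      have h3 : 1 ≤ δ⁻¹ * Metric.infDist y Λ - 2 := by
        have : 3 ≤ δ⁻¹ * Metric.infDist y Λ := by
          rw [le_inv_mul_iff₀ hδ]; linarith
        linarith
      simp only [hL]
      rw [max_eq_right (by linarith), min_eq_left h3]
    have hx0 := h0 x (Metric.mem_ball_self hδ)
    have := β.normed_convolution_eq_right (μ := volume) (g := L) (x₀ := x)
      fun y hy => by rw [h0 y hy, hx0]
    rw [hη, hψ, this, hx0]
  · intro x
    have hlip : LipschitzWith (δ⁻¹).toNNReal η := by
      refine LipschitzWith.of_dist_le_mul fun x y => ?_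
      rw [Real.coe_toNNReal _ (inv_nonneg.2 hδ.le), Real.dist_eq, dist_eq_norm, hηx, hηx,
        ← integral_sub (hψL x) (hψL y)]
      calc |∫ t, (ψ t * L (x - t) - ψ t * L (y - t))|
          ≤ ∫ t, ψ t * (δ⁻¹ * ‖x - y‖) := by
            rw [← Real.norm_eq_abs]
            refine norm_integral_le_of_norm_le (hψi.mul_const (δ⁻¹ * ‖x - y‖))
              (Eventually.of_forall fun t => ?_)
            rw [← mul_sub, Real.norm_eq_abs, abs_mul, abs_of_nonneg (hψ0 t)]
            refine mul_le_mul_of_nonneg_left ?_ (hψ0 t)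
            simpa using hLlip (x - t) (y - t)
        _ = δ⁻¹ * ‖x - y‖ := by rw [integral_mul_const, hψ1, one_mul]
    have := norm_fderiv_le_of_lipschitz ℝ hlip (x₀ := x)
    rwa [Real.coe_toNNReal _ (inv_nonneg.2 hδ.le)] at this

/-- Cutoff functions that exhaust the complement of `Λ`, and whose gradients are negligible against
square integrable vector fields in `Ω`. -/
structure IsCutoffSequence (Ω Λ : Set (E n)) (χ : ℕ → E n → ℝ) : Prop where
  contDiff : ∀ k, ContDiff ℝ 1 (χ k)
  hasCompactSupport : ∀ k, HasCompactSupport (χ k)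
  disjoint : ∀ k, Disjoint (tsupport (χ k)) Λ
  nonneg : ∀ k x, 0 ≤ χ k x
  le_one : ∀ k x, χ k x ≤ 1
  eventually_eq_one : ∀ C, IsCompact C → C ⊆ Metric.closedBall 0 1 → Disjoint C Λ →
    ∀ᶠ k in atTop, ∀ x ∈ C, χ k x = 1
  tendsto_zero : ∀ F : E n → E n, ContinuousOn F Ω → IntegrableOn (fun x => ‖F x‖ ^ 2) Ω →
    (∀ k, IntegrableOn (fun x => fderiv ℝ (χ k) x (F x)) Ω) ∧
    Tendsto (fun k => ∫ x in Ω, fderiv ℝ (χ k) x (F x)) atTop (𝓝 0)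

/-- The gradients of the cutoffs are bounded by `δ⁻¹` and live on a set of volume O(δ²), so their L²
norms stay bounded, while the L² norm of `F` over that shrinking set tends to 0. -/
theorem IsSphereHypersurface.exists_isCutoffSequence {Ω Λ : Set (E n)}
    (hΛ : IsSphereHypersurface Λ) (hc : IsCompact Λ) (hΩ : IsOpen Ω)
    (hsub : Ω ⊆ Metric.ball 0 1) (hdisj : Disjoint Ω Λ) :
    ∃ χ : ℕ → E n → ℝ, IsCutoffSequence Ω Λ χ := by
  obtain ⟨ε₀, hε₀, M, hM, hvol⟩ := hΛ.exists_volume_thickening_le hc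
  set δ : ℕ → ℝ := fun k => ε₀ / (5 * (k + 1)) with hδ
  have hδ0 : ∀ k, 0 < δ k := fun k => by positivity
  have hδε : ∀ k, 5 * δ k ≤ ε₀ := fun k => by
    have : 5 * δ k = ε₀ / (k + 1) := by simp only [hδ]; field_simp
    rw [this]
    exact div_le_self hε₀.le (by linarith [(Nat.cast_nonneg k : (0 : ℝ) ≤ k)])
  have hδanti : Antitone δ := fun i j hij => by
    simp only [hδ]
    gcongr
  have hδlim : Tendsto δ atTop (𝓝 0) := by
    have h1 : Tendsto (fun k : ℕ => (5 : ℝ) * (k + 1)) atTop atTop :=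
      (tendsto_atTop_add_const_right _ _ tendsto_natCast_atTop_atTop).const_mul_atTop (by norm_num)
    exact h1.const_div_atTop ε₀
  choose η hη1 hη2 hη3 hη4 hη5 hη6 using fun k => exists_smooth_cutoff Λ (hδ0 k)
  -- The bump provides compact support; it equals 1 on the ball of radius 2 and so does not change
  -- the cutoffs in `Ω`.
  set ζ : ContDiffBump (0 : E n) := ⟨2, 3, by norm_num, by norm_num⟩ with hζ
  have hζ1 : ∀ x ∈ Metric.ball (0 : E n) 2, ζ x = 1 := fun x hx =>
    ζ.one_of_mem_closedBall (Metric.ball_subset_closedBall hx)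
  have hΩ2 : Ω ⊆ Metric.ball (0 : E n) 2 :=
    hsub.trans (Metric.ball_subset_ball (by norm_num))
  have hχη : ∀ k, ∀ x ∈ Ω, (fun y => η k y * ζ y) =ᶠ[𝓝 x] η k := fun k x hx => by
    filter_upwards [Metric.isOpen_ball.mem_nhds (hΩ2 hx)] with y hy
    rw [hζ1 y hy, mul_one]
  refine ⟨fun k x => η k x * ζ x, ?_, ?_, ?_, ?_, ?_, ?_, ?_⟩
  · exact fun k => ((hη1 k).of_le (by simp)).mul ζ.contDiff
  · exact fun k => ζ.hasCompactSupport.mul_left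
  · intro k
    refine disjoint_right.2 fun x hx => ?_
    refine notMem_tsupport_iff_eventuallyEq.2 ?_
    filter_upwards [Metric.isOpen_thickening.mem_nhds
      (Metric.self_subset_thickening (hδ0 k) Λ hx)] with y hy
    simp [hη4 k y hy]
  · exact fun k x => mul_nonneg (hη2 k x) ζ.nonneg
  · exact fun k x => mul_le_one₀ (hη3 k x) ζ.nonneg ζ.le_one
  · intro C hC hC1 hCΛ
    obtain ⟨d, hd, hdd⟩ := hCΛ.exists_thickenings hC hc.isClosed
    have h1 : ∀ᶠ k in atTop, 4 * δ k < d := by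
      have : Tendsto (fun k => 4 * δ k) atTop (𝓝 (4 * 0)) := hδlim.const_mul 4
      exact this.eventually (gt_mem_nhds (by simpa using hd))
    filter_upwards [h1] with k hk x hx
    rw [hη5 k x, one_mul, hζ1 x]
    · exact Metric.closedBall_subset_ball (by norm_num) (hC1 hx)
    · intro hx'
      exact disjoint_left.1 hdd (Metric.self_subset_thickening hd C hx)
        (Metric.thickening_mono hk.le Λ hx')
  · intro F hF hF2
    have hfd : ∀ k, ∀ x ∈ Ω, fderiv ℝ (fun y => η k y * ζ y) x = fderiv ℝ (η k) x :=
      fun k x hx => (hχη k x hx).fderiv_eq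
    -- The radius `5 * δ k` exceeds `4 * δ k`, so every point of `Ω` outside `A k` has a whole
    -- neighbourhood on which `η k` equals 1.
    set A : ℕ → Set (E n) := fun k => Ω ∩ Metric.thickening (5 * δ k) Λ with hA
    have hAo : ∀ k, IsOpen (A k) := fun k => hΩ.inter Metric.isOpen_thickening
    have hAm : ∀ k, MeasurableSet (A k) := fun k => (hAo k).measurableSet
    have hoff : ∀ k, ∀ x ∈ Ω, x ∉ A k → fderiv ℝ (fun y => η k y * ζ y) x = 0 := by
      intro k x hx hxA
      rw [hfd k x hx]
      have hxt : x ∉ Metric.thickening (5 * δ k) Λ := fun h => hxA ⟨hx, h⟩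
      have hxc : x ∉ Metric.cthickening (4 * δ k) Λ := fun h =>
        hxt (Metric.cthickening_subset_thickening' (by linarith [hδ0 k])
          (by linarith [hδ0 k]) Λ h)
      have h1 : η k =ᶠ[𝓝 x] fun _ => 1 := by
        filter_upwards [Metric.isClosed_cthickening.isOpen_compl.mem_nhds hxc] with y hy
        exact hη5 k y fun h => hy (Metric.thickening_subset_cthickening _ _ h)
      rw [h1.fderiv_eq]
      simp
    -- The product of the gradient bound and `‖F‖` is split by the weighted arithmetic-geometric
    -- mean inequality; the free weight `τ` plays the role of the Cauchy-Schwarz inequality.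
    have hpt : ∀ k, ∀ τ > 0, ∀ x ∈ Ω, |fderiv ℝ (fun y => η k y * ζ y) x (F x)| ≤
        (A k).indicator (fun y => τ * (δ k)⁻¹ ^ 2 + (4 * τ)⁻¹ * ‖F y‖ ^ 2) x := by
      intro k τ hτ x hx
      by_cases hxA : x ∈ A k
      · rw [indicator_of_mem hxA, hfd k x hx]
        have h1 : |fderiv ℝ (η k) x (F x)| ≤ (δ k)⁻¹ * ‖F x‖ :=
          ((fderiv ℝ (η k) x).le_opNorm (F x)).trans
            (mul_le_mul_of_nonneg_right (hη6 k x) (norm_nonneg _))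
        refine h1.trans ?_
        have h2 : τ * (δ k)⁻¹ ^ 2 + (4 * τ)⁻¹ * ‖F x‖ ^ 2 - (δ k)⁻¹ * ‖F x‖ =
            (4 * τ)⁻¹ * (2 * τ * (δ k)⁻¹ - ‖F x‖) ^ 2 := by
          field_simp
          ring
        have h3 : 0 ≤ (4 * τ)⁻¹ * (2 * τ * (δ k)⁻¹ - ‖F x‖) ^ 2 := by positivity
        linarith
      · rw [indicator_of_notMem hxA, hoff k x hx hxA]
        simp
    have hAfin : ∀ k, volume (A k) ≤ ENNReal.ofReal ((5 * δ k) ^ 2) * M := fun k =>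
      (measure_mono inter_subset_right).trans (hvol _ (by linarith [hδ0 k]) (hδε k))
    have hAtop : ∀ k, volume (A k) ≠ ⊤ := fun k =>
      ((hAfin k).trans_lt (ENNReal.mul_lt_top (by simp) hM.lt_top)).ne
    have hgi : ∀ k, ∀ τ : ℝ, IntegrableOn (fun y => τ * (δ k)⁻¹ ^ 2 + (4 * τ)⁻¹ * ‖F y‖ ^ 2)
        (A k) := fun k τ => (integrableOn_const (hAtop k)).add
          ((hF2.mono_set inter_subset_left).const_mul _)
    have hgi' : ∀ k, ∀ τ : ℝ, IntegrableOn ((A k).indicator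
        fun y => τ * (δ k)⁻¹ ^ 2 + (4 * τ)⁻¹ * ‖F y‖ ^ 2) Ω := fun k τ =>
      ((hgi k τ).integrable_indicator (hAm k)).integrableOn
    have hi : ∀ k, IntegrableOn (fun x => fderiv ℝ (fun y => η k y * ζ y) x (F x)) Ω := by
      intro k
      refine Integrable.mono' (hgi' k 1) ?_ ((ae_restrict_iff' hΩ.measurableSet).2
        (Eventually.of_forall fun x hx => hpt k 1 one_pos x hx))
      refine ContinuousOn.aestronglyMeasurable ?_ hΩ.measurableSet
      have h1 : ContDiff ℝ 1 fun y => η k y * ζ y := ((hη1 k).of_le (by simp)).mul ζ.contDiff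
      exact (h1.continuous_fderiv one_ne_zero).continuousOn.clm_apply hF
    refine ⟨hi, ?_⟩
    have hlim : Tendsto (fun k => ∫ x in A k, ‖F x‖ ^ 2) atTop (𝓝 0) := by
      have hanti : Antitone A := fun i j hij => inter_subset_inter_right _
        (Metric.thickening_mono (by linarith [hδanti hij]) Λ)
      have h1 := tendsto_setIntegral_of_antitone (f := fun x => ‖F x‖ ^ 2) hAm hanti
        ⟨0, hF2.mono_set inter_subset_left⟩
      have h2 : ⋂ k, A k = ∅ := by
        refine eq_empty_of_forall_notMem fun x hx => ?_
        have hx' : ∀ k, x ∈ A k := mem_iInter.1 hx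
        have hxΛ : x ∈ Λ := by
          rw [← hc.isClosed.closure_eq, Metric.mem_closure_iff]
          intro d hd
          have h3 : ∀ᶠ k in atTop, 5 * δ k < d := by
            have : Tendsto (fun k => 5 * δ k) atTop (𝓝 (5 * 0)) := hδlim.const_mul 5
            exact this.eventually (gt_mem_nhds (by simpa using hd))
          obtain ⟨k, hk⟩ := h3.exists
          obtain ⟨y, hy, hxy⟩ := Metric.mem_thickening_iff.1 (hx' k).2
          exact ⟨y, hy, hxy.trans hk⟩
        exact disjoint_left.1 hdisj (hx' 0).1 hxΛ
      rw [h2] at h1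
      simpa using h1
    have hbound : ∀ k, ∀ τ > 0, |∫ x in Ω, fderiv ℝ (fun y => η k y * ζ y) x (F x)| ≤
        τ * (25 * M.toReal) + (4 * τ)⁻¹ * ∫ x in A k, ‖F x‖ ^ 2 := by
      intro k τ hτ
      have h1 : |∫ x in Ω, fderiv ℝ (fun y => η k y * ζ y) x (F x)| ≤
          ∫ x in Ω, (A k).indicator (fun y => τ * (δ k)⁻¹ ^ 2 + (4 * τ)⁻¹ * ‖F y‖ ^ 2) x := by
        rw [← Real.norm_eq_abs]
        exact norm_integral_le_of_norm_le (hgi' k τ) ((ae_restrict_iff' hΩ.measurableSet).2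
          (Eventually.of_forall fun x hx => hpt k τ hτ x hx))
      have hci : Integrable (fun _ : E n => τ * (δ k)⁻¹ ^ 2) (volume.restrict (A k)) :=
        integrableOn_const (hAtop k)
      refine h1.trans ?_
      rw [setIntegral_indicator (hAm k), inter_eq_self_of_subset_right inter_subset_left,
        integral_add hci ((hF2.mono_set inter_subset_left).const_mul _), integral_const_mul (4 * τ)⁻¹,
        setIntegral_const,
        smul_eq_mul]
      refine add_le_add ?_ le_rfl
      have h2 : volume.real (A k) ≤ (5 * δ k) ^ 2 * M.toReal := by
        have := ENNReal.toReal_mono (ENNReal.mul_ne_top (by simp) hM) (hAfin k)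
        rwa [ENNReal.toReal_mul, ENNReal.toReal_ofReal (by positivity)] at this
      calc volume.real (A k) * (τ * (δ k)⁻¹ ^ 2)
          ≤ (5 * δ k) ^ 2 * M.toReal * (τ * (δ k)⁻¹ ^ 2) :=
            mul_le_mul_of_nonneg_right h2 (by positivity)
        _ = τ * (25 * M.toReal) := by
            have := (hδ0 k).ne'
            field_simp
            ring
    rw [tendsto_zero_iff_abs_tendsto_zero]
    refine Metric.tendsto_atTop'.2 fun ε hε => ?_
    -- First `τ` is fixed to make the volume term at most `ε / 2`; then `k` is taken large for the
    -- other term.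
    set τ : ℝ := ε / (2 * (25 * M.toReal + 1)) with hτ
    have hM0 : 0 ≤ M.toReal := ENNReal.toReal_nonneg
    have hτ0 : 0 < τ := by positivity
    have h1 : ∀ᶠ k in atTop, (4 * τ)⁻¹ * ∫ x in A k, ‖F x‖ ^ 2 < ε / 2 := by
      have := hlim.const_mul (4 * τ)⁻¹
      rw [mul_zero] at this
      exact this.eventually (gt_mem_nhds (by positivity))
    obtain ⟨K, hK⟩ := eventually_atTop.1 h1
    refine ⟨K, fun k hk => ?_⟩
    rw [Real.dist_0_eq_abs, Function.comp_apply, abs_abs]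
    have h2 : τ * (25 * M.toReal) ≤ ε / 2 := by
      rw [hτ, div_mul_eq_mul_div, div_le_div_iff₀ (by positivity) (by norm_num)]
      nlinarith
    linarith [hbound k τ hτ0, hK k hk.le]

namespace IsCutoffSequence

variable {Ω Λ : Set (E n)} {χ : ℕ → E n → ℝ}

/-- The divergence theorem on a domain whose boundary is smooth off `Λ`. -/
theorem tendsto_flux_sub (h : IsCutoffSequence Ω Λ χ) (hΩ : IsOpen Ω)
    (hb : Bornology.IsBounded Ω) (hΛ : IsClosed Λ) (hdisj : Disjoint Ω Λ)
    (hreg : ∀ p ∈ frontier Ω \ Λ, ∃ φ, IsDefiningFunctionAt Ω p φ) {F : E n → E n}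
    (hF : ContDiffOn ℝ 1 F (closure Ω \ Λ)) (hF2 : IntegrableOn (fun x => ‖F x‖ ^ 2) Ω) :
    (∀ k, IntegrableOn (flux Ω F (χ k)) (frontier Ω) μHE[n]) ∧
    (∀ k, IntegrableOn (fun x => χ k x * divg F x) Ω) ∧
    Tendsto (fun k => (∫ x in frontier Ω, flux Ω F (χ k) x ∂μHE[n]) -
      ∫ x in Ω, χ k x * divg F x) atTop (𝓝 0) := by
  have hFΩ : ContDiffOn ℝ 1 F Ω := hF.mono fun x hx =>
    ⟨subset_closure hx, disjoint_left.1 hdisj hx⟩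
  obtain ⟨hi, hlim⟩ := h.tendsto_zero F hFΩ.continuousOn hF2
  have hd := fun k => integrableOn_divg_smul hΩ hb hΛ hF (h.contDiff k) (h.hasCompactSupport k)
    (h.disjoint k)
  have hfl := fun k => integral_divg_smul_eq_integral_flux hΩ hb hΛ hreg hF (h.contDiff k)
    (h.hasCompactSupport k) (h.disjoint k)
  have heq : ∀ k, ∀ x ∈ Ω, divg (fun z => χ k z • F z) x - fderiv ℝ (χ k) x (F x) =
      χ k x * divg F x := fun k x hx => by
    rw [divg_smul ((h.contDiff k).differentiable one_ne_zero x)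
      ((hFΩ.contDiffAt (hΩ.mem_nhds hx)).differentiableAt one_ne_zero)]
    ring
  refine ⟨fun k => (hfl k).1, fun k => ?_, ?_⟩
  · exact (integrableOn_congr_fun (heq k) hΩ.measurableSet).1 ((hd k).2.sub (hi k))
  · refine hlim.congr fun k => ?_
    rw [← (hfl k).2, ← setIntegral_congr_fun hΩ.measurableSet (heq k),
      integral_sub (hd k).2 (hi k)]
    ring

/-- A vector field with nonnegative divergence whose total flux is not positive is divergence
free. -/
theorem divg_eq_zero (h : IsCutoffSequence Ω Λ χ) (hΩ : IsOpen Ω)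
    (hb : Ω ⊆ Metric.ball 0 1) (hΛ : IsClosed Λ) (hdisj : Disjoint Ω Λ)
    (hreg : ∀ p ∈ frontier Ω \ Λ, ∃ φ, IsDefiningFunctionAt Ω p φ) {F : E n → E n}
    (hF : ContDiffOn ℝ 1 F (closure Ω \ Λ)) (hF2 : IntegrableOn (fun x => ‖F x‖ ^ 2) Ω)
    (hdiv : ∀ x ∈ Ω, 0 ≤ divg F x) {c : ℝ} (hc : c ≤ 0)
    (hlim : Tendsto (fun k => ∫ x in frontier Ω, flux Ω F (χ k) x ∂μHE[n]) atTop (𝓝 c)) :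
    ∀ x ∈ Ω, divg F x = 0 := by
  obtain ⟨-, hi, hsub⟩ := h.tendsto_flux_sub hΩ (Metric.isBounded_ball.subset hb) hΛ hdisj hreg
    hF hF2
  have hlim' : Tendsto (fun k => ∫ x in Ω, χ k x * divg F x) atTop (𝓝 c) := by
    simpa using hlim.sub hsub
  have hFΩ : ContDiffOn ℝ 1 F Ω := hF.mono fun x hx =>
    ⟨subset_closure hx, disjoint_left.1 hdisj hx⟩
  have hcont : ContinuousOn (divg F) Ω :=
    continuous_tr.comp_continuousOn (hFΩ.continuousOn_fderiv_of_isOpen hΩ le_rfl)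
  intro x hx
  by_contra hne
  have hpos : 0 < divg F x := lt_of_le_of_ne (hdiv x hx) (Ne.symm hne)
  have hev : ∀ᶠ y in 𝓝 x, y ∈ Ω ∧ divg F x / 2 < divg F y :=
    (hΩ.eventually_mem hx).and ((hcont.continuousAt (hΩ.mem_nhds hx)).eventually
      (lt_mem_nhds (by linarith)))
  obtain ⟨r, hr, hball⟩ := Metric.nhds_basis_closedBall.mem_iff.1 hev
  set C := Metric.closedBall x r with hC
  have hCΩ : C ⊆ Ω := fun y hy => (hball hy).1
  have hCc : IsCompact C := isCompact_closedBall x r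
  have hCm : MeasurableSet C := measurableSet_closedBall
  have hvol : 0 < volume.real C :=
    ENNReal.toReal_pos (Metric.measure_closedBall_pos _ _ hr).ne' measure_closedBall_lt_top.ne
  -- A positive divergence at `x` stays above half its value on a small closed ball, where the
  -- cutoffs are eventually 1. This bounds the integrals below by a positive constant, against the
  -- non-positive limit.
  have hge : ∀ᶠ k in atTop, divg F x / 2 * volume.real C ≤ ∫ y in Ω, χ k y * divg F y := by
    filter_upwards [h.eventually_eq_one C hCc
      ((hCΩ.trans hb).trans Metric.ball_subset_closedBall) (hdisj.mono_left hCΩ)] with k hk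
    calc divg F x / 2 * volume.real C = ∫ y in C, divg F x / 2 := by
          rw [setIntegral_const, smul_eq_mul, mul_comm]
      _ ≤ ∫ y in C, χ k y * divg F y := by
          refine setIntegral_mono_on (integrableOn_const hCc.measure_lt_top.ne)
            ((hi k).mono_set hCΩ) hCm fun y hy => ?_
          rw [hk y hy, one_mul]
          exact (hball hy).2.le
      _ ≤ ∫ y in Ω, χ k y * divg F y := by
          refine setIntegral_mono_set (hi k) ?_ (Eventually.of_forall hCΩ)
          exact (ae_restrict_iff' hΩ.measurableSet).2 (Eventually.of_forall fun y hy =>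
            mul_nonneg (h.nonneg k y) (hdiv y hy))
  have := ge_of_tendsto hlim' hge
  have : 0 < divg F x / 2 * volume.real C := by positivity
  linarith

end IsCutoffSequence

/-! ### Boundary points: connectedness and tangent vectors -/

/-- Off the frontier, the open sets `Ω` and the complement of its closure would separate `V`. -/
theorem subset_of_disjoint_frontier {X : Type*} [TopologicalSpace X] {V Ω : Set X}
    (hV : IsPreconnected V) (hΩ : IsOpen Ω) (hne : (V ∩ Ω).Nonempty)
    (hd : Disjoint V (frontier Ω)) : V ⊆ Ω := by
  refine hV.subset_left_of_subset_union hΩ isClosed_closure.isOpen_compl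
    (disjoint_compl_right_iff_subset.2 subset_closure) (fun x hx => ?_) hne
  by_cases hxΩ : x ∈ Ω
  · exact Or.inl hxΩ
  · refine Or.inr fun hxc => disjoint_left.1 hd hx ?_
    rw [hΩ.frontier_eq]
    exact ⟨hxc, hxΩ⟩

theorem IsDefiningFunctionAt.mem_frontier {Ω : Set (E n)} {p : E n} {φ : E n → ℝ}
    (h : IsDefiningFunctionAt Ω p φ) (hΩ : IsOpen Ω) : p ∈ frontier Ω := by
  obtain ⟨r, -, hc⟩ := h.exists_graphChart (κ := 1 / 4) (by norm_num) le_rfl one_pos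
  exact (hc.mem_frontier_iff hΩ (Metric.mem_ball_self (by linarith [hc.r_pos]))).2 h.1

/-- Near `p`, `Ω` contains an open convex circular cone with apex `p` around the direction `-e`:
there `⟪e, y - p⟫ < -‖y - p‖ / 2`, which outweighs the approximation error with `κ = 1 / 4`. -/
theorem IsDefiningFunctionAt.uniqueDiffWithinAt {Ω : Set (E n)} {p : E n} {φ : E n → ℝ}
    (h : IsDefiningFunctionAt Ω p φ) : UniqueDiffWithinAt ℝ Ω p := by
  obtain ⟨r, -, hc⟩ := h.exists_graphChart (κ := 1 / 4) (by norm_num) le_rfl one_pos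
  set e := ‖gradient φ p‖⁻¹ • gradient φ p
  have hr := hc.r_pos
  set C : Set (E n) := {y | ‖y - p‖ + 2 * ⟪e, y - p⟫ < 0} ∩ Metric.ball p (3 * r) with hC
  have hCΩ : C ⊆ Ω := by
    rintro y ⟨hy, hyb⟩
    have hy : ‖y - p‖ + 2 * ⟪e, y - p⟫ < 0 := hy
    rw [hc.mem_iff y hyb]
    have h1 := (abs_le.1 (hc.approx p (Metric.mem_ball_self (by linarith)) y hyb)).2
    rw [hc.zero] at h1
    have := hc.a_pos
    nlinarith [norm_nonneg (y - p)]
  have hconv : Convex ℝ C := by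
    refine Convex.inter ?_ (convex_ball _ _)
    intro x hx y hy s t hs ht hst
    have hx : ‖x - p‖ + 2 * ⟪e, x - p⟫ < 0 := hx
    have hy : ‖y - p‖ + 2 * ⟪e, y - p⟫ < 0 := hy
    have heq : s • x + t • y - p = s • (x - p) + t • (y - p) := by
      rw [smul_sub, smul_sub, sub_add_sub_comm, ← add_smul, hst, one_smul]
    change ‖s • x + t • y - p‖ + 2 * ⟪e, s • x + t • y - p⟫ < 0
    rw [heq, inner_add_right, inner_smul_right, inner_smul_right]
    have h1 := norm_add_le (s • (x - p)) (t • (y - p))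
    rw [norm_smul, norm_smul, Real.norm_of_nonneg hs, Real.norm_of_nonneg ht] at h1
    rcases hs.eq_or_lt with h0 | h0
    · have : t = 1 := by linarith
      subst this
      rw [← h0] at h1 ⊢
      linarith
    · nlinarith
  have hopen : IsOpen C := by
    refine IsOpen.inter ?_ Metric.isOpen_ball
    exact isOpen_lt (by fun_prop) continuous_const
  have hseq : ∀ s ∈ Ioo (0 : ℝ) r, p - s • e ∈ C := by
    intro s hs
    have hn : ‖p - s • e - p‖ = s := by
      rw [sub_sub_cancel_left, norm_neg, norm_smul, hc.norm_e, Real.norm_of_nonneg hs.1.le, mul_one]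
    refine ⟨?_, by rw [mem_ball_iff_norm, hn]; linarith [hs.2]⟩
    change ‖p - s • e - p‖ + 2 * ⟪e, p - s • e - p⟫ < 0
    rw [hn, sub_sub_cancel_left, inner_neg_right, inner_smul_right, real_inner_self_eq_norm_sq,
      hc.norm_e]
    linarith [hs.1]
  refine (uniqueDiffWithinAt_convex hconv ?_ ?_).mono hCΩ
  · rw [hopen.interior_eq]
    exact ⟨_, hseq (r / 2) ⟨by linarith, by linarith⟩⟩
  · have hlim : Tendsto (fun s : ℝ => p - s • e) (𝓝[>] 0) (𝓝 p) := by
      have : Continuous fun s : ℝ => p - s • e := by fun_prop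
      simpa using (this.tendsto 0).mono_left nhdsWithin_le_nhds
    refine mem_closure_of_tendsto hlim ?_
    filter_upwards [Ioo_mem_nhdsGT hr] with s hs using hseq s hs

/-- The tangent space of the boundary consists of tangent vectors. -/
theorem IsDefiningFunctionAt.mem_tangentConeAt_frontier {Ω : Set (E n)} {p : E n} {φ : E n → ℝ}
    (h : IsDefiningFunctionAt Ω p φ) (hΩ : IsOpen Ω) {τ : E n} (hτ : ⟪gradient φ p, τ⟫ = 0)
    {U : Set (E n)} (hU : U ∈ 𝓝 p) : τ ∈ tangentConeAt ℝ (frontier Ω ∩ U) p := by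
  obtain ⟨r, -, hc⟩ := h.exists_graphChart (κ := 1 / 4) (by norm_num) le_rfl one_pos
  set e := ‖gradient φ p‖⁻¹ • gradient φ p with he
  have hr := hc.r_pos
  have hge : ⟪gradient φ p, e⟫ = ‖gradient φ p‖ := by
    rw [he, inner_smul_right, real_inner_self_eq_norm_sq, sq,
      inv_mul_cancel_left₀ (norm_ne_zero_iff.2 h.2.1)]
  have hnb : Metric.ball p (3 * r) ∩ U ∈ 𝓝 p :=
    Filter.inter_mem (Metric.ball_mem_nhds p (by linarith)) hU
  obtain ⟨R, hR, hRs⟩ := Metric.mem_nhds_iff.1 hnb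
  -- `φ` is positive at `p + s • (τ + b • e)` and negative at `p + s • (τ - b • e)` for small `s`,
  -- so it has a zero between them. These zeros approach `p` with direction tending to `τ`.
  have key : ∀ k : ℕ, ∃ s t : ℝ, 0 < s ∧ s < 1 / ((k : ℝ) + 1) ∧ |t| ≤ 1 / ((k : ℝ) + 1) ∧
      p + s • (τ + t • e) ∈ frontier Ω ∩ U := by
    intro k
    set b : ℝ := 1 / ((k : ℝ) + 1) with hb
    have hb0 : 0 < b := by positivity
    have h1 := (h.tendsto_ray (τ + b • e)).1
    have h2 := (h.tendsto_ray (τ + (-b) • e)).1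
    rw [inner_add_right, hτ, inner_smul_right, hge, zero_add] at h1 h2
    have hba : 0 < b * ‖gradient φ p‖ := mul_pos hb0 hc.a_pos
    have hsm : ∀ᶠ s : ℝ in 𝓝[>] 0, s * (‖τ‖ + b) < R := by
      have hcont : Continuous fun s : ℝ => s * (‖τ‖ + b) := by fun_prop
      exact ((hcont.tendsto 0).mono_left nhdsWithin_le_nhds).eventually
        (gt_mem_nhds (by simpa using hR))
    obtain ⟨s, hs1, hs2, hs3, hs4⟩ := ((h1.eventually (lt_mem_nhds hba)).and
      ((h2.eventually (gt_mem_nhds (show -b * ‖gradient φ p‖ < 0 by linarith))).and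
        (hsm.and (Ioo_mem_nhdsGT hb0)))).exists
    have hs0 : 0 < s := hs4.1
    have hp1 : 0 < φ (p + s • (τ + b • e)) := by
      have := mul_pos hs1 hs0
      rwa [div_mul_cancel₀ _ hs0.ne'] at this
    have hp2 : φ (p + s • (τ + (-b) • e)) < 0 := by
      have := mul_neg_of_neg_of_pos hs2 hs0
      rwa [div_mul_cancel₀ _ hs0.ne'] at this
    have hmem : ∀ t ∈ Icc (-b) b, p + s • (τ + t • e) ∈ Metric.ball p (3 * r) ∩ U := by
      intro t ht
      apply hRs
      rw [mem_ball_iff_norm, add_sub_cancel_left, norm_smul, Real.norm_of_nonneg hs0.le]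
      refine lt_of_le_of_lt (mul_le_mul_of_nonneg_left ?_ hs0.le) hs3
      refine (norm_add_le _ _).trans ?_
      rw [norm_smul, hc.norm_e, Real.norm_eq_abs, mul_one]
      linarith [abs_le.2 ht]
    have hcont : ContinuousOn (fun t : ℝ => φ (p + s • (τ + t • e))) (Icc (-b) b) :=
      hc.smooth.continuousOn.comp (by fun_prop) fun t ht => (hmem t ht).1
    obtain ⟨t, ht, ht0⟩ := intermediate_value_Icc (by linarith : -b ≤ b) hcont ⟨hp2.le, hp1.le⟩
    exact ⟨s, t, hs0, hs4.2, abs_le.2 ht, (hc.mem_frontier_iff hΩ (hmem t ht).1).2 ht0,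
      (hmem t ht).2⟩
  choose s t hs0 hs1 ht hmem using key
  have hblim : Tendsto (fun k : ℕ => 1 / ((k : ℝ) + 1)) atTop (𝓝 0) :=
    tendsto_one_div_add_atTop_nhds_zero_nat
  have hslim : Tendsto s atTop (𝓝 0) :=
    squeeze_zero (fun k => (hs0 k).le) (fun k => (hs1 k).le) hblim
  have htlim : Tendsto t atTop (𝓝 0) := squeeze_zero_norm ht hblim
  have hvlim : Tendsto (fun k => τ + t k • e) atTop (𝓝 τ) := by
    simpa using tendsto_const_nhds.add (htlim.smul_const e)
  refine mem_tangentConeAt_of_seq atTop (fun k => (s k)⁻¹) (fun k => s k • (τ + t k • e)) ?_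
    (Eventually.of_forall hmem) ?_
  · simpa using hslim.smul hvlim
  · refine hvlim.congr fun k => ?_
    rw [inv_smul_smul₀ (hs0 k).ne']

/-- A function that vanishes on the boundary has vanishing tangential derivatives there. -/
theorem fderiv_tangential_eq_zero {Ω K : Set (E n)} {p τ : E n} (hΩ : IsOpen Ω)
    (hp : ∃ φ, IsDefiningFunctionAt Ω p φ) (hτ : ⟪outwardNormal Ω p, τ⟫ = 0) {f : E n → ℝ}
    {f' : E n →L[ℝ] ℝ} (hf : HasFDerivWithinAt f f' K p) {U : Set (E n)} (hU : U ∈ 𝓝 p)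
    (hK : frontier Ω ∩ U ⊆ K) (h0 : ∀ x ∈ frontier Ω ∩ U, f x = 0) : f' τ = 0 := by
  obtain ⟨φ, hφ⟩ := hp
  have hτ' : ⟪gradient φ p, τ⟫ = 0 := by
    rw [outwardNormal_eq ⟨φ, hφ, rfl⟩, real_inner_smul_left] at hτ
    exact (mul_eq_zero.1 hτ).resolve_left (inv_ne_zero (norm_ne_zero_iff.2 hφ.2.1))
  have hpm : p ∈ frontier Ω ∩ U := ⟨hφ.mem_frontier hΩ, mem_of_mem_nhds hU⟩
  have h1 : HasFDerivWithinAt f (0 : E n →L[ℝ] ℝ) (frontier Ω ∩ U) p :=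
    (hasFDerivWithinAt_const (0 : ℝ) p _).congr h0 (h0 p hpm)
  exact (hf.mono hK).unique_on h1 (hφ.mem_tangentConeAt_frontier hΩ hτ' hU)

/-! ### Geometry of cap domains -/

namespace IsCapDomain

variable {Ω Sg T : Set (E n)}

theorem subset_ball (h : IsCapDomain Ω Sg T) : Ω ⊆ Metric.ball 0 1 := fun _ hx =>
  mem_ball_zero_iff.2 (h.subset_halfBall hx).1

theorem closure_cap_subset (h : IsCapDomain Ω Sg T) : closure T ⊆ Metric.sphere 0 1 :=
  closure_minimal h.cap_subset Metric.isClosed_sphere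

theorem edge_subset_sphere (h : IsCapDomain Ω Sg T) :
    closure Sg ∩ closure T ⊆ Metric.sphere 0 1 :=
  inter_subset_right.trans h.closure_cap_subset

theorem isCompact_edge (h : IsCapDomain Ω Sg T) : IsCompact (closure Sg ∩ closure T) :=
  (isCompact_sphere 0 1).of_isClosed_subset (isClosed_closure.inter isClosed_closure)
    h.edge_subset_sphere

theorem disjoint_edge (h : IsCapDomain Ω Sg T) : Disjoint Ω (closure Sg ∩ closure T) := by
  refine disjoint_left.2 fun x hx hx' => ?_
  have h1 := mem_ball_zero_iff.1 (h.subset_ball hx)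
  have h2 := mem_sphere_zero_iff_norm.1 (h.edge_subset_sphere hx')
  linarith

theorem frontier_diff_edge (h : IsCapDomain Ω Sg T) :
    frontier Ω \ (closure Sg ∩ closure T) = Sg ∪ T := by
  ext x
  constructor
  · rintro ⟨hx, hx'⟩
    by_cases hxT : x ∈ closure T
    · refine Or.inr ?_
      rw [h.cap_eq]
      exact ⟨hx, fun h => hx' ⟨h, hxT⟩⟩
    · refine Or.inl ?_
      rw [h.surface_eq]
      exact ⟨hx, hxT⟩
  · rintro (hx | hx)
    · rw [h.surface_eq] at hx
      exact ⟨hx.1, fun h => hx.2 h.2⟩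
    · rw [h.cap_eq] at hx
      exact ⟨hx.1, fun h => hx.2 h.1⟩

theorem surface_subset_frontier (h : IsCapDomain Ω Sg T) : Sg ⊆ frontier Ω := by
  rw [h.surface_eq]; exact sdiff_subset

theorem measurableSet_surface (h : IsCapDomain Ω Sg T) : MeasurableSet Sg := by
  rw [h.surface_eq]
  exact MeasurableSet.diff isClosed_frontier.measurableSet isClosed_closure.measurableSet

/-- A small ball around `p` misses the closure of `Sg`, so inside the unit ball it contains no
frontier point. Its intersection with the unit ball is convex and meets `Ω`, hence lies in `Ω`. -/
theorem exists_ball_of_mem_cap (h : IsCapDomain Ω Sg T) {p : E n} (hp : p ∈ T) :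
    ∃ r > 0, ∀ x ∈ Metric.ball p r, (x ∈ Ω ↔ ‖x‖ < 1) := by
  have hpT := hp
  rw [h.cap_eq] at hp
  obtain ⟨r, hr, hrs⟩ := Metric.isOpen_iff.1 isClosed_closure.isOpen_compl p hp.2
  refine ⟨r, hr, fun x hx => ⟨fun hxΩ => (h.subset_halfBall hxΩ).1, fun hx1 => ?_⟩⟩
  have hconv : IsPreconnected (Metric.ball p r ∩ Metric.ball 0 1) :=
    ((convex_ball p r).inter (convex_ball 0 1)).isPreconnected
  refine subset_of_disjoint_frontier hconv h.isOpen ?_ ?_ ⟨hx, mem_ball_zero_iff.2 hx1⟩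
  · obtain ⟨y, hy, hyΩ⟩ := Metric.mem_closure_iff.1 (frontier_subset_closure hp.1) r hr
    exact ⟨y, ⟨by rwa [Metric.mem_ball, dist_comm], h.subset_ball hy⟩, hy⟩
  · refine disjoint_left.2 fun y hy hyf => ?_
    rw [h.frontier_eq] at hyf
    rcases hyf with hyf | hyf
    · exact hrs hy.1 hyf
    · have h1 := mem_sphere_zero_iff_norm.1 (h.cap_subset hyf)
      have h2 := mem_ball_zero_iff.1 hy.2
      linarith

theorem norm_eq_one_of_mem_cap (h : IsCapDomain Ω Sg T) {p : E n} (hp : p ∈ T) : ‖p‖ = 1 :=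
  mem_sphere_zero_iff_norm.1 (h.cap_subset hp)

theorem isDefiningFunctionAt_cap (h : IsCapDomain Ω Sg T) {p : E n} (hp : p ∈ T) :
    IsDefiningFunctionAt Ω p (fun x => ‖x‖ ^ 2 - 1) ∧
      gradient (fun x : E n => ‖x‖ ^ 2 - 1) p = (2 : ℝ) • p := by
  have hp1 := h.norm_eq_one_of_mem_cap hp
  have hg : gradient (fun x : E n => ‖x‖ ^ 2 - 1) p = (2 : ℝ) • p := by
    refine HasGradientAt.gradient ?_
    rw [hasGradientAt_iff_hasFDerivAt]
    have := (hasStrictFDerivAt_norm_sq p).hasFDerivAt.sub_const 1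
    refine this.congr_fderiv ?_
    ext v
    simp [two_mul]
  obtain ⟨r, hr, hrs⟩ := h.exists_ball_of_mem_cap hp
  refine ⟨⟨by simp [hp1], ?_, Metric.ball p r, Metric.isOpen_ball, Metric.mem_ball_self hr, ?_, ?_⟩,
    hg⟩
  · rw [hg]
    intro h0
    have : ‖(2 : ℝ) • p‖ = 0 := by rw [h0, norm_zero]
    rw [norm_smul, hp1] at this
    norm_num at this
  · exact ((contDiff_norm_sq ℝ).sub contDiff_const).contDiffOn
  · intro x hx
    rw [hrs x hx, sub_neg, sq_lt_one_iff₀ (norm_nonneg x)]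

theorem outwardNormal_cap (h : IsCapDomain Ω Sg T) {p : E n} (hp : p ∈ T) :
    outwardNormal Ω p = p := by
  obtain ⟨h1, h2⟩ := h.isDefiningFunctionAt_cap hp
  refine outwardNormal_eq ⟨_, h1, ?_⟩
  rw [h2, norm_smul, h.norm_eq_one_of_mem_cap hp, smul_smul]
  norm_num

theorem exists_definingFunction (h : IsCapDomain Ω Sg T) :
    ∀ p ∈ frontier Ω \ (closure Sg ∩ closure T), ∃ φ, IsDefiningFunctionAt Ω p φ := by
  intro p hp
  rw [h.frontier_diff_edge] at hp
  rcases hp with hp | hp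
  · exact h.surface_smooth p hp
  · exact ⟨_, (h.isDefiningFunctionAt_cap hp).1⟩

/-- If the last coordinate of `p` were not positive, a point slightly inside the sphere and below
`p` would belong to `Ω` and have negative last coordinate. -/
theorem last_pos_of_mem_cap (h : IsCapDomain Ω Sg T) {p : E n} (hp : p ∈ T) :
    0 < p (Fin.last n) := by
  by_contra! hle
  obtain ⟨r, hr, hrs⟩ := h.exists_ball_of_mem_cap hp
  have hp1 := h.norm_eq_one_of_mem_cap hp
  set s : ℝ := min (1 / 2) (r / 3) with hs
  have hs0 : 0 < s := by positivity
  have hs1 : s ≤ 1 / 2 := min_le_left _ _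
  have hs2 : s ≤ r / 3 := min_le_right _ _
  have heN : ‖eN n‖ = 1 := by simp [eN]
  set x : E n := (1 - s) • p - (s / 2) • eN n with hx
  have hxb : x ∈ Metric.ball p r := by
    have : x - p = -(s • p) - (s / 2) • eN n := by
      rw [hx, sub_smul, one_smul]; abel
    rw [mem_ball_iff_norm, this]
    refine (norm_sub_le _ _).trans_lt ?_
    rw [norm_neg, norm_smul, norm_smul, heN, hp1, Real.norm_of_nonneg hs0.le,
      Real.norm_of_nonneg (by positivity)]
    linarith
  have hx1 : ‖x‖ < 1 := by
    refine (norm_sub_le _ _).trans_lt ?_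
    rw [norm_smul, norm_smul, heN, hp1, Real.norm_of_nonneg (by linarith),
      Real.norm_of_nonneg (by positivity)]
    linarith
  have h2 := (h.subset_halfBall ((hrs x hxb).2 hx1)).2
  have h3 : x (Fin.last n) = (1 - s) * p (Fin.last n) - s / 2 := by
    simp [hx, eN]
  rw [h3] at h2
  nlinarith

theorem closure_diff_edge (h : IsCapDomain Ω Sg T) :
    closure Ω \ (closure Sg ∩ closure T) = Ω ∪ (Sg ∪ T) := by
  rw [← h.frontier_diff_edge, closure_eq_self_union_frontier, union_sdiff_distrib,
    h.disjoint_edge.sdiff_eq_left]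

theorem last_pos (h : IsCapDomain Ω Sg T) {x : E n}
    (hx : x ∈ closure Ω \ (closure Sg ∩ closure T)) : 0 < x (Fin.last n) := by
  rw [h.closure_diff_edge] at hx
  rcases hx with hx | hx | hx
  · exact (h.subset_halfBall hx).2
  · exact (h.surface_subset hx).2
  · exact h.last_pos_of_mem_cap hx

/-- This makes the derivatives within the closure, off the edge, well determined and as smooth as
the solution. -/
theorem uniqueDiffOn (h : IsCapDomain Ω Sg T) :
    UniqueDiffOn ℝ (closure Ω \ (closure Sg ∩ closure T)) := by
  have hsub : Ω ⊆ closure Ω \ (closure Sg ∩ closure T) := fun x hx =>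
    ⟨subset_closure hx, disjoint_left.1 h.disjoint_edge hx⟩
  intro x hx
  by_cases hxΩ : x ∈ Ω
  · exact (h.isOpen.uniqueDiffWithinAt hxΩ).mono hsub
  · obtain ⟨φ, hφ⟩ := h.exists_definingFunction x
      ⟨by rw [h.isOpen.frontier_eq]; exact ⟨hx.1, hxΩ⟩, hx.2⟩
    exact hφ.uniqueDiffWithinAt.mono hsub

/-- The boundary is the surface near a point of the surface, and the cap near a point of the
cap. -/
theorem exists_nhds_frontier_subset (h : IsCapDomain Ω Sg T) :
    (∀ p ∈ Sg, ∃ U ∈ 𝓝 p, frontier Ω ∩ U ⊆ Sg) ∧ ∀ p ∈ T, ∃ U ∈ 𝓝 p, frontier Ω ∩ U ⊆ T := by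
  constructor
  · intro p hp
    have hp' := hp
    rw [h.surface_eq] at hp'
    refine ⟨(closure T)ᶜ, isClosed_closure.isOpen_compl.mem_nhds hp'.2, fun x hx => ?_⟩
    rw [h.surface_eq]
    exact hx
  · intro p hp
    have hp' := hp
    rw [h.cap_eq] at hp'
    refine ⟨(closure Sg)ᶜ, isClosed_closure.isOpen_compl.mem_nhds hp'.2, fun x hx => ?_⟩
    rw [h.cap_eq]
    exact hx

theorem exists_isCutoffSequence (h : IsCapDomain Ω Sg T) :
    ∃ χ, IsCutoffSequence Ω (closure Sg ∩ closure T) χ :=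
  h.edge.exists_isCutoffSequence h.isCompact_edge h.isOpen h.subset_ball h.disjoint_edge

end IsCapDomain

/-! ### Flux identities for fields tangential on the cap -/

namespace IsCapDomain

variable {Ω Sg T : Set (E n)} {χ : ℕ → E n → ℝ} {F : E n → E n}

theorem integral_flux_eq (h : IsCapDomain Ω Sg T)
    (hχ : IsCutoffSequence Ω (closure Sg ∩ closure T) χ) (hT : ∀ x ∈ T, ⟪F x, x⟫ = 0) (k : ℕ) :
    ∫ x in frontier Ω, flux Ω F (χ k) x ∂μHE[n] = ∫ x in Sg, flux Ω F (χ k) x ∂μHE[n] := by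
  refine setIntegral_eq_of_subset_of_forall_sdiff_eq_zero isClosed_frontier.measurableSet
    h.surface_subset_frontier fun x hx => ?_
  by_cases hxe : x ∈ closure Sg ∩ closure T
  · rw [flux, image_eq_zero_of_notMem_tsupport
      (fun hx' => disjoint_left.1 (hχ.disjoint k) hx' hxe), zero_mul]
  · have hxT : x ∈ Sg ∪ T := by rw [← h.frontier_diff_edge]; exact ⟨hx.1, hxe⟩
    have hxT := hxT.resolve_left hx.2
    rw [flux, h.outwardNormal_cap hxT, hT x hxT, mul_zero]

theorem tendsto_cutoff (h : IsCapDomain Ω Sg T)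
    (hχ : IsCutoffSequence Ω (closure Sg ∩ closure T) χ) {x : E n}
    (hx : x ∈ closure Ω \ (closure Sg ∩ closure T)) :
    Tendsto (fun k => χ k x) atTop (𝓝 1) := by
  have h1 : ∀ᶠ k in atTop, ∀ y ∈ ({x} : Set (E n)), χ k y = 1 :=
    hχ.eventually_eq_one {x} isCompact_singleton
      (singleton_subset_iff.2 (closure_minimal (h.subset_ball.trans Metric.ball_subset_closedBall)
        Metric.isClosed_closedBall hx.1)) (disjoint_singleton_left.2 hx.2)
  exact tendsto_const_nhds.congr' (h1.mono fun k hk => (hk x rfl).symm)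

theorem surface_subset_closure_diff (h : IsCapDomain Ω Sg T) :
    Sg ⊆ closure Ω \ (closure Sg ∩ closure T) := by
  rw [h.closure_diff_edge]
  exact fun x hx => Or.inr (Or.inl hx)

theorem cap_subset_closure_diff (h : IsCapDomain Ω Sg T) :
    T ⊆ closure Ω \ (closure Sg ∩ closure T) := by
  rw [h.closure_diff_edge]
  exact fun x hx => Or.inr (Or.inr hx)

theorem subset_closure_diff (h : IsCapDomain Ω Sg T) :
    Ω ⊆ closure Ω \ (closure Sg ∩ closure T) := by
  rw [h.closure_diff_edge]
  exact subset_union_left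

theorem tendsto_integral_flux (h : IsCapDomain Ω Sg T)
    (hχ : IsCutoffSequence Ω (closure Sg ∩ closure T) χ) (hT : ∀ x ∈ T, ⟪F x, x⟫ = 0)
    (hi : IntegrableOn (fun x => ⟪F x, outwardNormal Ω x⟫) Sg μHE[n]) :
    Tendsto (fun k => ∫ x in frontier Ω, flux Ω F (χ k) x ∂μHE[n]) atTop
      (𝓝 (∫ x in Sg, ⟪F x, outwardNormal Ω x⟫ ∂μHE[n])) := by
  simp_rw [h.integral_flux_eq hχ hT]
  refine tendsto_integral_of_dominated_convergence
    (fun x => ‖⟪F x, outwardNormal Ω x⟫‖) (fun k => ?_) hi.norm (fun k => ?_) ?_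
  · exact (hχ.contDiff k).continuous.aestronglyMeasurable.mul hi.aestronglyMeasurable
  · refine Eventually.of_forall fun x => ?_
    rw [flux, norm_mul, Real.norm_of_nonneg (hχ.nonneg k x)]
    exact mul_le_of_le_one_left (norm_nonneg _) (hχ.le_one k x)
  · refine (ae_restrict_iff' h.measurableSet_surface).2 (Eventually.of_forall fun x hx => ?_)
    simpa [flux] using (h.tendsto_cutoff hχ (h.surface_subset_closure_diff hx)).mul_const
      ⟪F x, outwardNormal Ω x⟫

theorem divg_eq_zero (h : IsCapDomain Ω Sg T)
    (hF : ContDiffOn ℝ 1 F (closure Ω \ (closure Sg ∩ closure T)))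
    (hF2 : IntegrableOn (fun x => ‖F x‖ ^ 2) Ω) (hT : ∀ x ∈ T, ⟪F x, x⟫ = 0)
    (hi : IntegrableOn (fun x => ⟪F x, outwardNormal Ω x⟫) Sg μHE[n])
    (hle : ∫ x in Sg, ⟪F x, outwardNormal Ω x⟫ ∂μHE[n] ≤ 0) (hdiv : ∀ x ∈ Ω, 0 ≤ divg F x) :
    ∀ x ∈ Ω, divg F x = 0 := by
  obtain ⟨χ, hχ⟩ := h.exists_isCutoffSequence
  exact hχ.divg_eq_zero h.isOpen h.subset_ball h.isCompact_edge.isClosed h.disjoint_edge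
    h.exists_definingFunction hF hF2 hdiv hle (h.tendsto_integral_flux hχ hT hi)

/-- Integrability of the normal component over `Sg` is not assumed. It follows from Fatou's lemma,
because the cut-off fluxes are nonnegative and converge to the finite integral of the divergence. -/
theorem integral_divg_eq (h : IsCapDomain Ω Sg T)
    (hF : ContDiffOn ℝ 1 F (closure Ω \ (closure Sg ∩ closure T)))
    (hF2 : IntegrableOn (fun x => ‖F x‖ ^ 2) Ω) (hT : ∀ x ∈ T, ⟪F x, x⟫ = 0)
    (hnn : ∀ x ∈ Sg, 0 ≤ ⟪F x, outwardNormal Ω x⟫)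
    (hdiv : IntegrableOn (divg F) Ω) :
    ∫ x in Ω, divg F x = ∫ x in Sg, ⟪F x, outwardNormal Ω x⟫ ∂μHE[n] := by
  obtain ⟨χ, hχ⟩ := h.exists_isCutoffSequence
  obtain ⟨h1, h2, h3⟩ := hχ.tendsto_flux_sub h.isOpen (Metric.isBounded_ball.subset h.subset_ball)
    h.isCompact_edge.isClosed h.disjoint_edge h.exists_definingFunction hF hF2
  have h4 : Tendsto (fun k => ∫ x in Ω, χ k x * divg F x) atTop (𝓝 (∫ x in Ω, divg F x)) := by
    refine tendsto_integral_of_dominated_convergence (fun x => ‖divg F x‖)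
      (fun k => (h2 k).aestronglyMeasurable) hdiv.norm (fun k => ?_) ?_
    · refine Eventually.of_forall fun x => ?_
      rw [norm_mul, Real.norm_of_nonneg (hχ.nonneg k x)]
      exact mul_le_of_le_one_left (norm_nonneg _) (hχ.le_one k x)
    · refine (ae_restrict_iff' h.isOpen.measurableSet).2 (Eventually.of_forall fun x hx => ?_)
      simpa using (h.tendsto_cutoff hχ (h.subset_closure_diff hx)).mul_const (divg F x)
  have h5 : Tendsto (fun k => ∫ x in frontier Ω, flux Ω F (χ k) x ∂μHE[n]) atTop
      (𝓝 (∫ x in Ω, divg F x)) := by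
    simpa using h3.add h4
  have hfl : ∀ k, ∀ x ∈ Sg, 0 ≤ flux Ω F (χ k) x := fun k x hx =>
    mul_nonneg (hχ.nonneg k x) (hnn x hx)
  have hi : IntegrableOn (fun x => ⟪F x, outwardNormal Ω x⟫) Sg μHE[n] := by
    have hm : ∀ k, AEStronglyMeasurable (flux Ω F (χ k)) (μHE[n].restrict Sg) := fun k =>
      ((h1 k).mono_set h.surface_subset_frontier).aestronglyMeasurable
    have hlim : ∀ᵐ x ∂(μHE[n].restrict Sg), Tendsto (fun k => flux Ω F (χ k) x) atTop
        (𝓝 ⟪F x, outwardNormal Ω x⟫) := by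
      refine (ae_restrict_iff' h.measurableSet_surface).2 (Eventually.of_forall fun x hx => ?_)
      simpa [flux] using (h.tendsto_cutoff hχ (h.surface_subset_closure_diff hx)).mul_const
        ⟪F x, outwardNormal Ω x⟫
    refine ⟨aestronglyMeasurable_of_tendsto_ae _ hm hlim, ?_⟩
    have he : ∀ k, ∫⁻ x in Sg, ‖flux Ω F (χ k) x‖ₑ ∂μHE[n] =
        ENNReal.ofReal (∫ x in frontier Ω, flux Ω F (χ k) x ∂μHE[n]) := fun k => by
      rw [h.integral_flux_eq hχ hT, ofReal_integral_eq_lintegral_ofReal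
        ((h1 k).mono_set h.surface_subset_frontier)
        ((ae_restrict_iff' h.measurableSet_surface).2 (Eventually.of_forall (hfl k)))]
      exact setLIntegral_congr_fun h.measurableSet_surface fun x hx =>
        Real.enorm_of_nonneg (hfl k x hx)
    calc ∫⁻ x in Sg, ‖⟪F x, outwardNormal Ω x⟫‖ₑ ∂μHE[n]
        = ∫⁻ x in Sg, liminf (fun k => ‖flux Ω F (χ k) x‖ₑ) atTop ∂μHE[n] :=
          lintegral_congr_ae (hlim.mono fun x hx => hx.enorm.liminf_eq.symm)
      _ ≤ liminf (fun k => ∫⁻ x in Sg, ‖flux Ω F (χ k) x‖ₑ ∂μHE[n]) atTop :=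
          lintegral_liminf_le' fun k => (hm k).enorm
      _ = ENNReal.ofReal (∫ x in Ω, divg F x) := by
          simp_rw [he]
          exact ((ENNReal.continuous_ofReal.tendsto _).comp h5).liminf_eq
      _ < ⊤ := ENNReal.ofReal_lt_top
  exact tendsto_nhds_unique h5 (h.tendsto_integral_flux hχ hT hi)

end IsCapDomain

/-! ### Gradient and Hessian of the solution -/

/-- `G` and `H` are the gradient and the Hessian of the solution `u`, up to the smooth part of the
boundary of `Ω`, with the bounds that the Sobolev regularity of `u` gives. -/
structure IsSolutionJet (Ω Sg T : Set (E n)) (u : E n → ℝ) (G : E n → E n)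
    (H : E n → E n →L[ℝ] E n) : Prop where
  contDiffOn : ContDiffOn ℝ 1 u (closure Ω \ (closure Sg ∩ closure T))
  contDiffOn_grad : ContDiffOn ℝ 1 G (closure Ω \ (closure Sg ∩ closure T))
  contDiffOn_hess : ContDiffOn ℝ 1 H (closure Ω \ (closure Sg ∩ closure T))
  hasFDerivWithinAt : ∀ x ∈ closure Ω \ (closure Sg ∩ closure T),
    HasFDerivWithinAt u (innerSL ℝ (G x)) (closure Ω \ (closure Sg ∩ closure T)) x
  hasFDerivWithinAt_grad : ∀ x ∈ closure Ω \ (closure Sg ∩ closure T),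
    HasFDerivWithinAt G (H x) (closure Ω \ (closure Sg ∩ closure T)) x
  symm : ∀ x ∈ Ω, ∀ v w, ⟪H x v, w⟫ = ⟪v, H x w⟫
  fderiv_symm : ∀ x ∈ Ω, ∀ v w, fderiv ℝ H x v w = fderiv ℝ H x w v
  tr_eq : ∀ x ∈ Ω, tr (H x) = n + 1
  bounded : ∃ C, 0 ≤ C ∧ ∀ x ∈ Ω, |u x| ≤ C ∧ ‖G x‖ ≤ C
  integrableOn : IntegrableOn (fun x => ‖H x‖ ^ 2) Ω
  dirichlet : ∀ x ∈ Sg, u x = 0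
  steklov : ∀ x ∈ T, ⟪G x, x⟫ = u x
  normalDeriv_eq : ∀ x ∈ Sg, normalDeriv Ω u x = ⟪G x, outwardNormal Ω x⟫

/-- By continuity, the set where the essential bound fails is open; being null, it is empty. -/
theorem exists_norm_le_of_memLp_top {V : Type*} [NormedAddCommGroup V] {Ω : Set (E n)}
    (hΩ : IsOpen Ω) {f : E n → V} (hf : ContinuousOn f Ω) (hm : MemLp f ⊤ (volume.restrict Ω)) :
    ∃ C, ∀ x ∈ Ω, ‖f x‖ ≤ C := by
  set C := lpNorm f ⊤ (volume.restrict Ω) with hC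
  have hae : ∀ᵐ x ∂(volume.restrict Ω), ‖f x‖ ≤ C := ae_le_lpNorm_exponent_top hm
  have hopen : IsOpen (Ω ∩ (fun x => ‖f x‖) ⁻¹' Ioi C) :=
    hf.norm.isOpen_inter_preimage hΩ isOpen_Ioi
  have h0 : Ω ∩ (fun x => ‖f x‖) ⁻¹' Ioi C = ∅ := by
    refine hopen.eq_empty_of_measure_zero (μ := volume) ?_
    have := (ae_restrict_iff' hΩ.measurableSet).1 hae
    refine measure_mono_null (fun x hx => ?_) (ae_iff.1 this)
    exact fun h => absurd (h hx.1) (not_le.2 hx.2)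
  refine ⟨C, fun x hx => ?_⟩
  by_contra! h
  exact (h0 ▸ (⟨hx, h⟩ : x ∈ Ω ∩ (fun x => ‖f x‖) ⁻¹' Ioi C) : x ∈ (∅ : Set (E n)))

theorem IsSolution.exists_jet {Ω Sg T : Set (E n)} {u : E n → ℝ} (h : IsCapDomain Ω Sg T)
    (hu : IsSolution Ω Sg T u) : ∃ G H, IsSolutionJet Ω Sg T u G H := by
  set K := closure Ω \ (closure Sg ∩ closure T) with hK
  have hKu : UniqueDiffOn ℝ K := h.uniqueDiffOn
  have hΩK : Ω ⊆ K := h.subset_closure_diff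
  have hnh : ∀ x ∈ Ω, K ∈ 𝓝 x := fun x hx => mem_of_superset (h.isOpen.mem_nhds hx) hΩK
  -- `G` is the Riesz representative of the derivative within the closure off the edge. Taking
  -- derivatives within this set keeps `G` and `H` smooth up to the smooth boundary.
  set L : StrongDual ℝ (E n) ≃ₗᵢ[ℝ] E n := (InnerProductSpace.toDual ℝ (E n)).symm with hL
  set G : E n → E n := fun x => L (fderivWithin ℝ u K x) with hG
  set H : E n → E n →L[ℝ] E n := fun x => fderivWithin ℝ G K x with hH
  have hGs : ContDiffOn ℝ ∞ G K :=
    (L.contDiff (n := ∞)).comp_contDiffOn (hu.smooth.fderivWithin hKu (by simp))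
  have hHs : ContDiffOn ℝ ∞ H K := hGs.fderivWithin hKu (by simp)
  have hus : ContDiffOn ℝ ∞ u Ω := hu.smooth.mono hΩK
  have hGi : ∀ x v, ⟪G x, v⟫ = fderivWithin ℝ u K x v := fun x v => by
    simp only [hG, hL]
    exact InnerProductSpace.toDual_symm_apply
  have hGf : ∀ x ∈ Ω, G x = L (fderiv ℝ u x) := fun x hx => by
    simp only [hG, fderivWithin_of_mem_nhds (hnh x hx)]
  have hHf : ∀ x ∈ Ω, H x = fderiv ℝ G x := fun x hx => fderivWithin_of_mem_nhds (hnh x hx)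
  have hua : ∀ x ∈ Ω, ContDiffAt ℝ ∞ u x := fun x hx => hus.contDiffAt (h.isOpen.mem_nhds hx)
  have hfa : ∀ x ∈ Ω, DifferentiableAt ℝ (fderiv ℝ u) x := fun x hx =>
    ((hua x hx).fderiv_right (m := 1)
      (WithTop.coe_le_coe.2 le_top : ((1 : WithTop ℕ∞) + 1 ≤ ∞))).differentiableAt one_ne_zero
  have hHu : ∀ x ∈ Ω, ∀ v w, ⟪H x v, w⟫ = fderiv ℝ (fderiv ℝ u) x v w := by
    intro x hx v w
    have h1 : G =ᶠ[𝓝 x] fun y => L (fderiv ℝ u y) :=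
      eventually_of_mem (h.isOpen.mem_nhds hx) hGf
    have h2 : HasFDerivAt (fun y => L (fderiv ℝ u y))
        ((L.toContinuousLinearEquiv : StrongDual ℝ (E n) →L[ℝ] E n).comp
          (fderiv ℝ (fderiv ℝ u) x)) x :=
      (L.toContinuousLinearEquiv : StrongDual ℝ (E n) →L[ℝ] E n).hasFDerivAt.comp x
        (hfa x hx).hasFDerivAt
    rw [hHf x hx, h1.fderiv_eq, h2.fderiv]
    exact InnerProductSpace.toDual_symm_apply
  have h2 : (2 : WithTop ℕ∞) ≤ ∞ := WithTop.coe_le_coe.2 le_top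
  have hfd : ∀ x ∈ K, fderivWithin ℝ u (closure Ω) x = fderivWithin ℝ u K x := fun x hx =>
    (fderivWithin_inter (h.isCompact_edge.isClosed.isOpen_compl.mem_nhds hx.2)).symm
  refine ⟨G, H, hu.smooth.of_le (by simp), hGs.of_le (by simp), hHs.of_le (by simp), ?_, ?_, ?_,
    ?_, ?_, ?_, ?_, hu.dirichlet, ?_, ?_⟩
  · intro x hx
    have := ((hu.smooth x hx).differentiableWithinAt (by simp)).hasFDerivWithinAt
    refine this.congr_fderiv ?_
    ext v
    rw [innerSL_apply_apply, hGi]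
  · intro x hx
    exact ((hGs x hx).differentiableWithinAt (by simp)).hasFDerivWithinAt
  · intro x hx v w
    rw [hHu x hx, real_inner_comm, hHu x hx]
    exact ((hua x hx).isSymmSndFDerivAt (by simpa using h2)) v w
  · intro x hx v w
    have h1 : H =ᶠ[𝓝 x] fderiv ℝ G := eventually_of_mem (h.isOpen.mem_nhds hx) hHf
    rw [h1.fderiv_eq]
    exact ((hGs.contDiffAt (hnh x hx)).isSymmSndFDerivAt (by simpa using h2)) v w
  · intro x hx
    have := hu.laplacian x hx
    rw [InnerProductSpace.laplacian_eq_iteratedFDeriv_orthonormalBasis u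
      (EuclideanSpace.basisFun (Fin (n + 1)) ℝ)] at this
    rw [← this, tr]
    refine Finset.sum_congr rfl fun i _ => ?_
    rw [real_inner_comm, hHu x hx, iteratedFDeriv_two_apply]
    rfl
  · obtain ⟨C₁, hC₁⟩ := (Metric.isBounded_ball.subset
      h.subset_ball).isCompact_closure.exists_bound_of_continuousOn hu.continuousOn
    have hm := hu.lipschitz.2 1 le_rfl
    have hc : ContinuousOn (fun x => iteratedFDeriv ℝ 1 u x) Ω := fun x hx =>
      (((hua x hx).iteratedFDeriv_right (i := 1) (m := 0) (by simp)).continuousAt).continuousWithinAt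
    obtain ⟨C₂, hC₂⟩ := exists_norm_le_of_memLp_top h.isOpen hc hm
    refine ⟨max 0 (max C₁ C₂), le_max_left _ _, fun x hx => ⟨?_, ?_⟩⟩
    · exact (hC₁ x (subset_closure hx)).trans ((le_max_left _ _).trans (le_max_right _ _))
    · rw [hGf x hx, LinearIsometryEquiv.norm_map, ← norm_iteratedFDeriv_one]
      exact (hC₂ x hx).trans ((le_max_right _ _).trans (le_max_right _ _))
  · have hm := (hu.sobolev.2 2 le_rfl).norm.integrable_sq
    refine hm.congr' ?_ ?_
    · exact ((hHs.continuousOn.mono hΩK).norm.pow 2).aestronglyMeasurable h.isOpen.measurableSet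
    · refine (ae_restrict_iff' h.isOpen.measurableSet).2 (Eventually.of_forall fun x hx => ?_)
      have e1 : ‖iteratedFDeriv ℝ 2 u x‖ = ‖fderiv ℝ (fderiv ℝ u) x‖ := by
        rw [← norm_iteratedFDeriv_one, norm_iteratedFDeriv_fderiv]
      have e2 : ‖H x‖ = ‖fderiv ℝ (fderiv ℝ u) x‖ := by
        have h3 : fderiv ℝ (fderiv ℝ u) x =
            (innerSL ℝ : E n →L[ℝ] E n →L[ℝ] ℝ).comp (H x) := by
          ext v w
          rw [← hHu x hx]
          rfl
        refine le_antisymm ?_ ?_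
        · refine (H x).opNorm_le_bound (norm_nonneg (fderiv ℝ (fderiv ℝ u) x)) fun v => ?_
          have : ‖H x v‖ = ‖fderiv ℝ (fderiv ℝ u) x v‖ := by
            rw [h3]; simp
          rw [this]
          exact ContinuousLinearMap.le_opNorm _ _
        · refine ContinuousLinearMap.opNorm_le_bound _ (norm_nonneg (H x)) fun v => ?_
          rw [h3]
          simpa using (H x).le_opNorm v
      simp only [e1, e2]
  · intro x hx
    have := hu.steklov x hx
    rw [normalDeriv, h.outwardNormal_cap hx] at this
    rw [hGi, ← this, hfd x (h.cap_subset_closure_diff hx)]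
  · intro x hx
    rw [hGi, normalDeriv, hfd x (h.surface_subset_closure_diff hx)]

/-! ### The Killing field and the sign of the solution -/

theorem inner_eN_right (x : E n) : ⟪x, eN n⟫ = x (Fin.last n) := by
  simp [eN, EuclideanSpace.inner_single_right]

theorem inner_eN_left (x : E n) : ⟪eN n, x⟫ = x (Fin.last n) := by
  rw [real_inner_comm, inner_eN_right]

theorem norm_eN : ‖eN n‖ = 1 := by
  simp [eN]

/-- The last coordinate as a continuous linear functional. -/
noncomputable def lastL (n : ℕ) : E n →L[ℝ] ℝ := innerSL ℝ (eN n)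

theorem lastL_apply (x : E n) : lastL n x = x (Fin.last n) := inner_eN_left x

theorem hasFDerivAt_last (x : E n) : HasFDerivAt (fun y : E n => y (Fin.last n)) (lastL n) x :=
  (lastL n).hasFDerivAt.congr_of_eventuallyEq
    (Eventually.of_forall fun y => (lastL_apply y).symm)

theorem contDiff_last {k : WithTop ℕ∞} : ContDiff ℝ k (fun y : E n => y (Fin.last n)) := by
  have : (fun y : E n => y (Fin.last n)) = lastL n := funext fun y => (lastL_apply y).symm
  rw [this]
  exact (lastL n).contDiff

theorem hasFDerivAt_killing (x : E n) :
    HasFDerivAt (killing : E n → E n) ((lastL n).smulRight x +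
      x (Fin.last n) • ContinuousLinearMap.id ℝ (E n) - (innerSL ℝ x).smulRight (eN n)) x := by
  have h1 := (hasFDerivAt_last x).smul (hasFDerivAt_id x)
  have h2 : HasFDerivAt (fun y : E n => (‖y‖ ^ 2 + 1) / 2) (innerSL ℝ x) x := by
    have := ((hasStrictFDerivAt_norm_sq x).hasFDerivAt.add_const 1).mul_const (2⁻¹ : ℝ)
    refine (this.congr_fderiv ?_).congr_of_eventuallyEq (Eventually.of_forall fun y => ?_)
    · ext v
      simp
    · exact div_eq_mul_inv _ _
  refine (h1.sub (h2.smul_const (eN n))).congr_fderiv ?_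
  ext v
  simp [add_comm]

theorem contDiff_killing {k : WithTop ℕ∞} : ContDiff ℝ k (killing : E n → E n) := by
  unfold killing
  exact (contDiff_last.smul contDiff_id).sub
    ((((contDiff_norm_sq ℝ).add contDiff_const).div_const 2).smul contDiff_const)

theorem inner_killing_self {x : E n} (hx : ‖x‖ = 1) : ⟪killing x, x⟫ = 0 := by
  rw [killing, inner_sub_left, real_inner_smul_left, real_inner_smul_left, inner_eN_left,
    real_inner_self_eq_norm_sq, hx]
  ring

theorem norm_killing_le {x : E n} (hx : ‖x‖ ≤ 1) : ‖killing x‖ ≤ 2 := by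
  have h1 : |x (Fin.last n)| ≤ 1 := by
    rw [← inner_eN_right]
    refine (abs_real_inner_le_norm _ _).trans ?_
    rwa [norm_eN, mul_one]
  have h2 : ‖x (Fin.last n) • x‖ ≤ 1 := by
    rw [norm_smul, Real.norm_eq_abs]
    exact mul_le_one₀ h1 (norm_nonneg _) hx
  have h3 : ‖((‖x‖ ^ 2 + 1) / 2) • eN n‖ ≤ 1 := by
    rw [norm_smul, norm_eN, mul_one, Real.norm_of_nonneg (by positivity)]
    have := pow_le_one₀ (n := 2) (norm_nonneg x) hx
    linarith
  calc ‖killing x‖ ≤ _ := norm_sub_le _ _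
    _ ≤ 2 := by linarith

namespace IsSolutionJet

variable {Ω Sg T : Set (E n)} {u : E n → ℝ} {G : E n → E n} {H : E n → E n →L[ℝ] E n}

theorem hasFDerivAt (hj : IsSolutionJet Ω Sg T u G H) (h : IsCapDomain Ω Sg T) {x : E n}
    (hx : x ∈ Ω) : HasFDerivAt u (innerSL ℝ (G x)) x :=
  (hj.hasFDerivWithinAt x (h.subset_closure_diff hx)).hasFDerivAt
    (mem_of_superset (h.isOpen.mem_nhds hx) h.subset_closure_diff)

theorem hasFDerivAt_grad (hj : IsSolutionJet Ω Sg T u G H) (h : IsCapDomain Ω Sg T) {x : E n}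
    (hx : x ∈ Ω) : HasFDerivAt G (H x) x :=
  (hj.hasFDerivWithinAt_grad x (h.subset_closure_diff hx)).hasFDerivAt
    (mem_of_superset (h.isOpen.mem_nhds hx) h.subset_closure_diff)

theorem hasFDerivAt_hess (hj : IsSolutionJet Ω Sg T u G H) (h : IsCapDomain Ω Sg T) {x : E n}
    (hx : x ∈ Ω) : HasFDerivAt H (fderiv ℝ H x) x :=
  ((hj.contDiffOn_hess.contDiffAt (mem_of_superset (h.isOpen.mem_nhds hx)
    h.subset_closure_diff)).differentiableAt one_ne_zero).hasFDerivAt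

/-- The derivative of `x_N ∇u - u e_N`. -/
theorem hasFDerivAt_flow (hj : IsSolutionJet Ω Sg T u G H) (h : IsCapDomain Ω Sg T) {x : E n}
    (hx : x ∈ Ω) : HasFDerivAt (fun y => y (Fin.last n) • G y - u y • eN n)
      ((lastL n).smulRight (G x) + x (Fin.last n) • H x - (innerSL ℝ (G x)).smulRight (eN n)) x := by
  refine (((hasFDerivAt_last x).smul (hj.hasFDerivAt_grad h hx)).sub
    ((hj.hasFDerivAt h hx).smul_const (eN n))).congr_fderiv ?_
  rw [add_comm (x (Fin.last n) • H x)]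

theorem contDiffOn_flow (hj : IsSolutionJet Ω Sg T u G H) :
    ContDiffOn ℝ 1 (fun y => y (Fin.last n) • G y - u y • eN n)
      (closure Ω \ (closure Sg ∩ closure T)) :=
  (contDiff_last.contDiffOn.smul hj.contDiffOn_grad).sub (hj.contDiffOn.smul contDiffOn_const)

theorem divg_flow (hj : IsSolutionJet Ω Sg T u G H) (h : IsCapDomain Ω Sg T) {x : E n}
    (hx : x ∈ Ω) :
    divg (fun y => y (Fin.last n) • G y - u y • eN n) x = (n + 1) * x (Fin.last n) := by
  rw [divg, (hj.hasFDerivAt_flow h hx).fderiv, tr_sub, tr_add, tr_smulRight, tr_smulRight, tr_smul,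
    hj.tr_eq x hx, lastL_apply, innerSL_apply_apply, inner_eN_right]
  ring

theorem inner_flow_eq_zero (hj : IsSolutionJet Ω Sg T u G H) {x : E n} (hx : x ∈ T) :
    ⟪x (Fin.last n) • G x - u x • eN n, x⟫ = 0 := by
  rw [inner_sub_left, real_inner_smul_left, real_inner_smul_left, inner_eN_left, hj.steklov x hx]
  ring

theorem exists_norm_flow_le (hj : IsSolutionJet Ω Sg T u G H) (h : IsCapDomain Ω Sg T) :
    ∃ C, 0 ≤ C ∧ ∀ x ∈ Ω, |u x| ≤ C ∧ ‖G x‖ ≤ C ∧ ‖x (Fin.last n) • G x - u x • eN n‖ ≤ 2 * C := by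
  obtain ⟨C, hC, hb⟩ := hj.bounded
  refine ⟨C, hC, fun x hx => ⟨(hb x hx).1, (hb x hx).2, ?_⟩⟩
  have h0 := h.subset_halfBall hx
  have h1 : |x (Fin.last n)| ≤ 1 := by
    rw [← inner_eN_right]
    refine (abs_real_inner_le_norm _ _).trans ?_
    rw [norm_eN, mul_one]
    exact h0.1.le
  calc ‖x (Fin.last n) • G x - u x • eN n‖ ≤ ‖x (Fin.last n) • G x‖ + ‖u x • eN n‖ := norm_sub_le _ _
    _ ≤ 1 * C + C * 1 := by
      rw [norm_smul, norm_smul, norm_eN, Real.norm_eq_abs, Real.norm_eq_abs]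
      gcongr
      exacts [(hb x hx).2, (hb x hx).1]
    _ = 2 * C := by ring

/-- Let `g` be a monotone smooth step of `u / x_N` that is positive exactly where `u > 0`. As `A =
x_N² ∇(u / x_N)`, the field `g A` has divergence `N x_N g` plus a nonnegative multiple of `|A|²`.
Its flux vanishes on `Sg`, where `g = 0`, and on `T`, where `A` is tangential. Hence the divergence
is zero and so is `g`. -/
theorem nonpos (hj : IsSolutionJet Ω Sg T u G H) (h : IsCapDomain Ω Sg T) {x : E n}
    (hx : x ∈ Ω) : u x ≤ 0 := by
  set A : E n → E n := fun y => y (Fin.last n) • G y - u y • eN n with hA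
  set g : E n → ℝ := fun y => Real.smoothTransition (u y / y (Fin.last n)) with hg
  have hgs : ContDiffOn ℝ 1 g (closure Ω \ (closure Sg ∩ closure T)) :=
    (Real.smoothTransition.contDiff (n := 1)).comp_contDiffOn
      (hj.contDiffOn.div contDiff_last.contDiffOn fun y hy => (h.last_pos hy).ne')
  have hF : ContDiffOn ℝ 1 (fun y => g y • A y) (closure Ω \ (closure Sg ∩ closure T)) :=
    hgs.smul hj.contDiffOn_flow
  have hg0 : ∀ y ∈ Sg, g y = 0 := fun y hy => by
    simp [hg, hj.dirichlet y hy]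
  have hdiv : ∀ y ∈ Ω, ∃ d : ℝ, 0 ≤ d ∧ divg (fun y => g y • A y) y =
      g y * ((n + 1) * y (Fin.last n)) + d := by
    intro y hy
    have hyn : 0 < y (Fin.last n) := (h.subset_halfBall hy).2
    have hv : HasFDerivAt (fun y => u y / y (Fin.last n))
        ((y (Fin.last n) ^ 2)⁻¹ • innerSL ℝ (A y)) y := by
      have h1 := (hj.hasFDerivAt h hy).mul
        ((hasDerivAt_inv hyn.ne').comp_hasFDerivAt y (hasFDerivAt_last y))
      refine (h1.congr_fderiv ?_).congr_of_eventuallyEq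
        (Eventually.of_forall fun z => div_eq_mul_inv _ _)
      ext w
      simp only [hA, add_apply, smul_apply, smul_eq_mul,
        innerSL_apply_apply, inner_sub_left, real_inner_smul_left, inner_eN_left, lastL_apply,
        Function.comp_apply]
      field_simp
      ring
    have hs : HasDerivAt Real.smoothTransition
        (deriv Real.smoothTransition (u y / y (Fin.last n))) (u y / y (Fin.last n)) :=
      ((Real.smoothTransition.contDiff (n := 1)).differentiable one_ne_zero _).hasDerivAt
    have hgd := hs.comp_hasFDerivAt y hv
    refine ⟨fderiv ℝ g y (A y), ?_, ?_⟩
    · rw [show fderiv ℝ g y = _ from hgd.fderiv, smul_apply, smul_apply, innerSL_apply_apply,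
        real_inner_self_eq_norm_sq, smul_eq_mul, smul_eq_mul]
      have : 0 ≤ deriv Real.smoothTransition (u y / y (Fin.last n)) :=
        Real.smoothTransition.monotone.deriv_nonneg
      positivity
    · rw [← hj.divg_flow h hy]
      exact divg_smul hgd.differentiableAt (hj.hasFDerivAt_flow h hy).differentiableAt
  obtain ⟨C, hC, hb⟩ := hj.exists_norm_flow_le h
  have hgn : ∀ y, 0 ≤ g y := fun y => Real.smoothTransition.nonneg _
  have hz := h.divg_eq_zero hF ?_ (fun y hy => ?_) ?_ ?_ (fun y hy => ?_) x hx
  · obtain ⟨d, hd, he⟩ := hdiv x hx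
    rw [hz] at he
    have hxn : 0 < x (Fin.last n) := (h.subset_halfBall hx).2
    by_contra! hpos
    have : 0 < g x := Real.smoothTransition.pos_of_pos (div_pos hpos hxn)
    have : 0 < g x * ((n + 1) * x (Fin.last n)) := by positivity
    linarith
  · refine integrableOn_of_continuousOn_of_bounded h.isOpen
      (Metric.isBounded_ball.subset h.subset_ball) (C := (2 * C) ^ 2)
      ((hF.continuousOn.mono h.subset_closure_diff).norm.pow 2) fun y hy => ?_
    rw [abs_of_nonneg (by positivity), norm_smul, Real.norm_of_nonneg (hgn y)]
    have h1 := mul_le_of_le_one_left (norm_nonneg (A y))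
      (Real.smoothTransition.le_one (u y / y (Fin.last n)))
    exact pow_le_pow_left₀ (mul_nonneg (hgn y) (norm_nonneg _)) (h1.trans (hb y hy).2.2) 2
  · rw [real_inner_smul_left, hj.inner_flow_eq_zero hy, mul_zero]
  · refine (integrableOn_zero).congr_fun (fun y hy => ?_) h.measurableSet_surface
    simp [hg0 y hy]
  · refine (setIntegral_eq_zero_of_forall_eq_zero fun y hy => ?_).le
    simp [hg0 y hy]
  · obtain ⟨d, hd, he⟩ := hdiv y hy
    rw [he]
    have hyn : 0 < y (Fin.last n) := (h.subset_halfBall hy).2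
    have := hgn y
    positivity

end IsSolutionJet

/-! ### The fundamental identity -/

theorem tr_comp_smulRight (M : E n →L[ℝ] E n) (l : E n →L[ℝ] ℝ) (v : E n) :
    tr (M.comp (l.smulRight v)) = l (M v) := by
  rw [← tr_smulRight l (M v)]
  congr 1
  ext w
  simp

/-- If the derivative of `M` is symmetric, then
`div (M V) = tr (M ∘ DV) + ∂_V tr M`. -/
theorem divg_clm_apply {M : E n → E n →L[ℝ] E n} {M' : E n →L[ℝ] E n →L[ℝ] E n}
    {V : E n → E n} {V' : E n →L[ℝ] E n} {x : E n} (hM : HasFDerivAt M M' x)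
    (hV : HasFDerivAt V V' x) (hs : ∀ v w, M' v w = M' w v) :
    divg (fun y => M y (V y)) x = tr ((M x).comp V') + tr (M' (V x)) := by
  rw [divg, (hM.clm_apply hV).fderiv, tr_add]
  congr 1
  refine congrArg tr ?_
  ext v : 1
  exact hs v (V x)

theorem tr_fderiv_apply_eq_zero {M : E n → E n →L[ℝ] E n} {M' : E n →L[ℝ] E n →L[ℝ] E n}
    {x : E n} (hM : HasFDerivAt M M' x) {c : ℝ} (hc : ∀ᶠ y in 𝓝 x, tr (M y) = c) (v : E n) :
    tr (M' v) = 0 := by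
  set L : (E n →L[ℝ] E n) →L[ℝ] ℝ := LinearMap.toContinuousLinearMap
    ((IsLinearMap.mk tr_add tr_smul : IsLinearMap ℝ (tr (n := n))).mk' tr) with hL
  have h1 : HasFDerivAt (fun y => tr (M y)) (L.comp M') x := L.hasFDerivAt.comp x hM
  have h2 : HasFDerivAt (fun y => tr (M y)) (0 : E n →L[ℝ] ℝ) x :=
    (hasFDerivAt_const c x).congr_of_eventuallyEq hc
  exact congrArg (fun l : E n →L[ℝ] ℝ => l v) (h1.unique h2)

theorem tr_comp_self_of_symm {M : E n →L[ℝ] E n} (hM : ∀ v w, ⟪M v, w⟫ = ⟪v, M w⟫) :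
    tr (M.comp M) = ∑ i, ‖M (EuclideanSpace.basisFun (Fin (n + 1)) ℝ i)‖ ^ 2 := by
  refine Finset.sum_congr rfl fun i _ => ?_
  rw [ContinuousLinearMap.comp_apply, ← hM, real_inner_self_eq_norm_sq]

theorem tr_comp_self_nonneg {M : E n →L[ℝ] E n} (hM : ∀ v w, ⟪M v, w⟫ = ⟪v, M w⟫) :
    0 ≤ tr (M.comp M) := by
  rw [tr_comp_self_of_symm hM]
  positivity

theorem eq_zero_of_tr_comp_self {M : E n →L[ℝ] E n} (hM : ∀ v w, ⟪M v, w⟫ = ⟪v, M w⟫)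
    (h0 : tr (M.comp M) = 0) : M = 0 := by
  rw [tr_comp_self_of_symm hM, Finset.sum_eq_zero_iff_of_nonneg fun _ _ => by positivity] at h0
  refine ContinuousLinearMap.coe_injective
    ((EuclideanSpace.basisFun (Fin (n + 1)) ℝ).toBasis.ext fun i => ?_)
  have := h0 i (Finset.mem_univ i)
  rw [sq_eq_zero_iff, norm_eq_zero] at this
  simpa using this

namespace IsCapDomain

variable {Ω Sg T : Set (E n)}

theorem norm_outwardNormal (h : IsCapDomain Ω Sg T) {x : E n} (hx : x ∈ Sg) :
    ‖outwardNormal Ω x‖ = 1 := by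
  obtain ⟨φ, hφ⟩ := h.surface_smooth x hx
  rw [outwardNormal_eq ⟨φ, hφ, rfl⟩, norm_smul, norm_inv, norm_norm,
    inv_mul_cancel₀ (norm_ne_zero_iff.2 hφ.2.1)]

end IsCapDomain

/-- The field `x_N ∇u - u e_N - X^q`, which is free of divergence. -/
noncomputable def freeField (u : E n → ℝ) (G : E n → E n) (x : E n) : E n :=
  x (Fin.last n) • G x - u x • eN n - killing x

namespace IsSolutionJet

variable {Ω Sg T : Set (E n)} {u : E n → ℝ} {G : E n → E n} {H : E n → E n →L[ℝ] E n}

/-- Since `u` vanishes on `Sg`, its gradient there is normal. -/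
theorem norm_sq_grad (hj : IsSolutionJet Ω Sg T u G H) (h : IsCapDomain Ω Sg T) {x : E n}
    (hx : x ∈ Sg) : ‖G x‖ ^ 2 = normalDeriv Ω u x ^ 2 := by
  rw [hj.normalDeriv_eq x hx]
  set ν := outwardNormal Ω x with hν
  have hν1 : ‖ν‖ = 1 := h.norm_outwardNormal hx
  set τ := G x - ⟪G x, ν⟫ • ν with hτ
  have hort : ⟪ν, τ⟫ = 0 := by
    rw [hτ, inner_sub_right, inner_smul_right, real_inner_self_eq_norm_sq, hν1,
      real_inner_comm]
    ring
  obtain ⟨U, hU, hUs⟩ := h.exists_nhds_frontier_subset.1 x hx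
  have := fderiv_tangential_eq_zero h.isOpen (h.surface_smooth x hx) hort
    (hj.hasFDerivWithinAt x (h.surface_subset_closure_diff hx)) hU
    (hUs.trans h.surface_subset_closure_diff) fun y hy => hj.dirichlet y (hUs hy)
  rw [innerSL_apply_apply, hτ, inner_sub_right, inner_smul_right,
    real_inner_self_eq_norm_sq] at this
  linarith

/-- Differentiating `⟪G x, x⟫ = u x` along the tangent vector `τ` gives `⟪H x τ, x⟫ + ⟪G x, τ⟫ = ⟪G
x, τ⟫`. -/
theorem inner_hess_eq_zero (hj : IsSolutionJet Ω Sg T u G H) (h : IsCapDomain Ω Sg T)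
    {x τ : E n} (hx : x ∈ T) (hτ : ⟪τ, x⟫ = 0) : ⟪H x τ, x⟫ = 0 := by
  have hxK := h.cap_subset_closure_diff hx
  obtain ⟨U, hU, hUs⟩ := h.exists_nhds_frontier_subset.2 x hx
  have hd := ((hj.hasFDerivWithinAt_grad x hxK).inner ℝ (hasFDerivWithinAt_id x _)).sub
    (hj.hasFDerivWithinAt x hxK)
  have := fderiv_tangential_eq_zero h.isOpen ⟨_, (h.isDefiningFunctionAt_cap hx).1⟩
    (by rw [h.outwardNormal_cap hx, real_inner_comm, hτ]) hd hU
    (hUs.trans h.cap_subset_closure_diff) fun y hy => by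
      simpa using sub_eq_zero.2 (hj.steklov y (hUs hy))
  simpa using this

theorem inner_freeField (hj : IsSolutionJet Ω Sg T u G H) (h : IsCapDomain Ω Sg T) {x : E n}
    (hx : x ∈ T) : ⟪freeField u G x, x⟫ = 0 := by
  rw [freeField, inner_sub_left, hj.inner_flow_eq_zero hx,
    inner_killing_self (h.norm_eq_one_of_mem_cap hx), sub_zero]

theorem contDiffOn_freeField (hj : IsSolutionJet Ω Sg T u G H) :
    ContDiffOn ℝ 1 (freeField u G) (closure Ω \ (closure Sg ∩ closure T)) :=
  hj.contDiffOn_flow.sub contDiff_killing.contDiffOn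

/-- The form matters: besides `x_N (H - id)` there remain only two rank-one terms whose sum is skew.
They have no trace, even after composition with a symmetric endomorphism. -/
theorem hasFDerivAt_freeField (hj : IsSolutionJet Ω Sg T u G H) (h : IsCapDomain Ω Sg T) {x : E n}
    (hx : x ∈ Ω) : HasFDerivAt (freeField u G)
      (x (Fin.last n) • (H x - ContinuousLinearMap.id ℝ (E n)) + (lastL n).smulRight (G x - x) -
        (innerSL ℝ (G x - x)).smulRight (eN n)) x := by
  refine ((hj.hasFDerivAt_flow h hx).sub (hasFDerivAt_killing x)).congr_fderiv ?_
  ext1 v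
  simp only [add_apply, sub_apply,
    smul_apply, ContinuousLinearMap.smulRight_apply,
    ContinuousLinearMap.id_apply, map_sub]
  module

theorem divg_freeField (hj : IsSolutionJet Ω Sg T u G H) (h : IsCapDomain Ω Sg T) {x : E n}
    (hx : x ∈ Ω) : divg (freeField u G) x = 0 := by
  rw [divg, (hj.hasFDerivAt_freeField h hx).fderiv, tr_sub, tr_add, tr_smul, tr_sub, tr_smulRight,
    tr_smulRight, hj.tr_eq x hx, tr_id, lastL_apply, innerSL_apply_apply, inner_eN_right]
  ring

theorem symm_sub_id (hj : IsSolutionJet Ω Sg T u G H) {x : E n} (hx : x ∈ Ω) (v w : E n) :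
    ⟪(H x - ContinuousLinearMap.id ℝ (E n)) v, w⟫ =
      ⟪v, (H x - ContinuousLinearMap.id ℝ (E n)) w⟫ := by
  simp only [sub_apply, ContinuousLinearMap.id_apply, inner_sub_left, inner_sub_right,
    hj.symm x hx]

/-- The derivative of the trace of the Hessian vanishes because the Laplacian is constant, and the
skew part of the derivative of the field is traceless against the symmetric `M`. -/
theorem divg_hess_freeField (hj : IsSolutionJet Ω Sg T u G H) (h : IsCapDomain Ω Sg T) {x : E n}
    (hx : x ∈ Ω) :
    divg (fun y => (H y - ContinuousLinearMap.id ℝ (E n)) (freeField u G y)) x =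
      x (Fin.last n) * tr ((H x - ContinuousLinearMap.id ℝ (E n)).comp
        (H x - ContinuousLinearMap.id ℝ (E n))) := by
  set M := H x - ContinuousLinearMap.id ℝ (E n) with hM
  have hHd := hj.hasFDerivAt_hess h hx
  rw [divg_clm_apply (hHd.sub_const _) (hj.hasFDerivAt_freeField h hx) (hj.fderiv_symm x hx),
    tr_fderiv_apply_eq_zero hHd (eventually_of_mem (h.isOpen.mem_nhds hx) hj.tr_eq), add_zero,
    ContinuousLinearMap.comp_sub, ContinuousLinearMap.comp_add, ContinuousLinearMap.comp_smul,
    tr_sub, tr_add, tr_smul, tr_comp_smulRight, tr_comp_smulRight, lastL_apply,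
    innerSL_apply_apply, ← hM]
  have hs : ⟪G x - x, M (eN n)⟫ = M (G x - x) (Fin.last n) := by
    rw [← inner_eN_right, hM, hj.symm_sub_id hx]
  rw [hs]
  ring

/-- The gradient of `½‖G‖² - u` is `M G`. Its product with the divergence-free field cancels the
term arising from differentiating the factor `u`, by symmetry of `M`. -/
theorem divg_fundamental (hj : IsSolutionJet Ω Sg T u G H) (h : IsCapDomain Ω Sg T) (c : ℝ)
    {x : E n} (hx : x ∈ Ω) :
    divg (fun y => (1 / 2 * ‖G y‖ ^ 2 - u y - c ^ 2 / 2) • freeField u G y -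
      u y • (H y - ContinuousLinearMap.id ℝ (E n)) (freeField u G y)) x =
      -(u x * x (Fin.last n)) * tr ((H x - ContinuousLinearMap.id ℝ (E n)).comp
        (H x - ContinuousLinearMap.id ℝ (E n))) := by
  have hP : HasFDerivAt (fun y => 1 / 2 * ‖G y‖ ^ 2 - u y - c ^ 2 / 2)
      (innerSL ℝ ((H x - ContinuousLinearMap.id ℝ (E n)) (G x))) x := by
    refine ((((hj.hasFDerivAt_grad h hx).norm_sq.const_mul (1 / 2)).sub
      (hj.hasFDerivAt h hx)).sub_const (c ^ 2 / 2)).congr_fderiv ?_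
    ext v
    simp [hj.symm x hx]
  have hW := hj.hasFDerivAt_freeField h hx
  have hM := ((hj.hasFDerivAt_hess h hx).sub_const
    (ContinuousLinearMap.id ℝ (E n))).clm_apply hW
  have hu := hj.hasFDerivAt h hx
  rw [divg_sub (hP.fun_smul hW).differentiableAt (hu.fun_smul hM).differentiableAt,
    divg_smul hP.differentiableAt hW.differentiableAt,
    divg_smul hu.differentiableAt hM.differentiableAt, hP.fderiv, hu.fderiv,
    hj.divg_freeField h hx, hj.divg_hess_freeField h hx, innerSL_apply_apply, innerSL_apply_apply]
  simp only [sub_apply, ContinuousLinearMap.id_apply, inner_sub_left,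
    inner_sub_right, hj.symm x hx]
  ring

theorem hess_eq_id_of_ne_zero (hj : IsSolutionJet Ω Sg T u G H) (h : IsCapDomain Ω Sg T) {c : ℝ}
    (hi : IntegrableOn (rhsIntegrand Ω u c) Sg μHE[n]) (hc : fundamentalRHS Ω Sg u c ≤ 0)
    {x : E n} (hx : x ∈ Ω) (hux : u x ≠ 0) : H x = ContinuousLinearMap.id ℝ (E n) := by
  set F : E n → E n := fun y => (1 / 2 * ‖G y‖ ^ 2 - u y - c ^ 2 / 2) • freeField u G y -
      u y • (H y - ContinuousLinearMap.id ℝ (E n)) (freeField u G y) with hF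
  have hFs : ContDiffOn ℝ 1 F (closure Ω \ (closure Sg ∩ closure T)) := by
    refine ContDiffOn.sub (ContDiffOn.fun_smul ?_ hj.contDiffOn_freeField)
      (hj.contDiffOn.fun_smul ((hj.contDiffOn_hess.sub contDiffOn_const).clm_apply
        hj.contDiffOn_freeField))
    exact ((contDiffOn_const.mul (hj.contDiffOn_grad.norm_sq ℝ)).sub hj.contDiffOn).sub
      contDiffOn_const

  have hflux : ∀ y ∈ Sg, 1 / 2 * rhsIntegrand Ω u c y = ⟪F y, outwardNormal Ω y⟫ := by
    intro y hy
    simp only [hF, freeField, hj.dirichlet y hy, hj.norm_sq_grad h hy, rhsIntegrand,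
      inner_sub_left, real_inner_smul_left, zero_smul, sub_zero,
      ← hj.normalDeriv_eq y hy]
    ring
  have hz := h.divg_eq_zero hFs ?_ (fun y hy => ?_) ?_ ?_ (fun y hy => ?_) x hx
  · rw [hF, hj.divg_fundamental h c hx] at hz
    have hxn : 0 < x (Fin.last n) := (h.subset_halfBall hx).2
    have h0 := (mul_eq_zero.1 hz).resolve_left (neg_ne_zero.2 (mul_ne_zero hux hxn.ne'))
    exact sub_eq_zero.1 (eq_zero_of_tr_comp_self (hj.symm_sub_id hx) h0)
  -- All factors are bounded except the Hessian, which enters linearly; hence `F` is square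
  -- integrable because `H` is.
  · obtain ⟨C, hC, hb⟩ := hj.exists_norm_flow_le h
    set K : ℝ := 2 * C + 2
    set K' : ℝ := 1 / 2 * C ^ 2 + C + c ^ 2 / 2
    have hle : ∀ y ∈ Ω, ‖F y‖ ≤ (K' + C) * K + C * K * ‖H y‖ := by
      intro y hy
      obtain ⟨h1, h2, h3⟩ := hb y hy
      have hW : ‖freeField u G y‖ ≤ K :=
        (norm_sub_le _ _).trans (add_le_add h3 (norm_killing_le (h.subset_halfBall hy).1.le))
      have hP : |1 / 2 * ‖G y‖ ^ 2 - u y - c ^ 2 / 2| ≤ K' := by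
        have h4 := pow_le_pow_left₀ (norm_nonneg _) h2 2
        have h5 := abs_le.1 h1
        have h6 := sq_nonneg ‖G y‖
        have h7 := sq_nonneg c
        rw [abs_le]
        constructor <;> simp only [K'] <;> nlinarith
      have hM : ‖(H y - ContinuousLinearMap.id ℝ (E n)) (freeField u G y)‖ ≤ (‖H y‖ + 1) * K := by
        refine (ContinuousLinearMap.le_opNorm _ _).trans ?_
        gcongr
        exact (norm_sub_le _ _).trans (add_le_add le_rfl ContinuousLinearMap.norm_id_le)
      calc ‖F y‖ ≤ _ := norm_sub_le _ _
        _ ≤ K' * K + C * ((‖H y‖ + 1) * K) := by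
          rw [norm_smul, norm_smul, Real.norm_eq_abs, Real.norm_eq_abs]
          have : 0 ≤ K' := (abs_nonneg _).trans hP
          gcongr
        _ = (K' + C) * K + C * K * ‖H y‖ := by ring
    have hfin : IsFiniteMeasure (volume.restrict Ω) :=
      ⟨by simpa using (Metric.isBounded_ball.subset h.subset_ball).measure_lt_top⟩
    have hdom : IntegrableOn (fun y => 2 * ((K' + C) * K) ^ 2 + 2 * (C * K) ^ 2 * ‖H y‖ ^ 2) Ω :=
      (integrable_const _).add (hj.integrableOn.const_mul _)
    refine hdom.mono' (((hFs.continuousOn.mono h.subset_closure_diff).norm.pow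
      2).aestronglyMeasurable h.isOpen.measurableSet) ?_
    refine (ae_restrict_iff' h.isOpen.measurableSet).2 (Eventually.of_forall fun y hy => ?_)
    rw [Real.norm_of_nonneg (by positivity)]
    have h1 := pow_le_pow_left₀ (norm_nonneg _) (hle y hy) 2
    have h2 := sq_nonneg ((K' + C) * K - C * K * ‖H y‖)
    nlinarith
  -- On the cap the free field is tangential, and the Hessian keeps it so.
  · have hW := hj.inner_freeField h hy
    simp only [hF, inner_sub_left, real_inner_smul_left, sub_apply,
      ContinuousLinearMap.id_apply, hW, hj.inner_hess_eq_zero h hy hW]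
    ring
  · exact IntegrableOn.congr_fun (hi.const_mul (1 / 2)) hflux h.measurableSet_surface
  · rw [← setIntegral_congr_fun h.measurableSet_surface hflux, integral_const_mul]
    exact hc
  · rw [hF, hj.divg_fundamental h c hy]
    have hyn : 0 < y (Fin.last n) := (h.subset_halfBall hy).2
    have := mul_nonpos_of_nonpos_of_nonneg (hj.nonpos h hy) hyn.le
    exact mul_nonneg (by linarith) (tr_comp_self_nonneg (hj.symm_sub_id hy))

end IsSolutionJet

/-! ### Rigidity: the solution and the domain -/

theorem hasFDerivAt_half_norm_sub_sq (z x : E n) :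
    HasFDerivAt (fun y => 1 / 2 * ‖y - z‖ ^ 2) (innerSL ℝ (x - z)) x := by
  refine (((hasFDerivAt_id x).sub_const z).norm_sq.const_mul (1 / 2)).congr_fderiv ?_
  ext v
  simp

namespace IsSolutionJet

variable {Ω Sg T : Set (E n)} {u : E n → ℝ} {G : E n → E n} {H : E n → E n →L[ℝ] E n}

/-- If the Hessian differs from the identity at `x`, it does so nearby, which forces `u = 0` there.
Then the Hessian vanishes at `x`, contradicting its trace. -/
theorem hess_eq_id (hj : IsSolutionJet Ω Sg T u G H) (h : IsCapDomain Ω Sg T) {c : ℝ}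
    (hi : IntegrableOn (rhsIntegrand Ω u c) Sg μHE[n]) (hc : fundamentalRHS Ω Sg u c ≤ 0)
    {x : E n} (hx : x ∈ Ω) : H x = ContinuousLinearMap.id ℝ (E n) := by
  by_contra hne
  have hΩx := h.isOpen.mem_nhds hx
  have hev : ∀ᶠ y in 𝓝 x, u y = 0 := by
    filter_upwards [hΩx, (hj.hasFDerivAt_hess h hx).continuousAt.eventually_ne hne] with y hy hy'
    by_contra hu0
    exact hy' (hj.hess_eq_id_of_ne_zero h hi hc hy hu0)
  have hG : ∀ᶠ y in 𝓝 x, G y = 0 := by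
    filter_upwards [hΩx, hev.eventually_nhds] with y hy hy'
    have h1 := (hj.hasFDerivAt h hy).unique ((hasFDerivAt_const (0 : ℝ) y).congr_of_eventuallyEq hy')
    have h2 := congrArg (fun l : E n →L[ℝ] ℝ => l (G y)) h1
    simpa using h2
  have h0 := (hj.hasFDerivAt_grad h hx).unique
    ((hasFDerivAt_const (0 : E n) x).congr_of_eventuallyEq hG)
  have h1 := hj.tr_eq x hx
  rw [h0, show tr (0 : E n →L[ℝ] E n) = 0 by simp [tr]] at h1
  have : (0 : ℝ) < n + 1 := by positivity
  linarith

theorem exists_center (hj : IsSolutionJet Ω Sg T u G H) (h : IsCapDomain Ω Sg T)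
    (hu : ContinuousOn u (closure Ω)) (hH : ∀ x ∈ Ω, H x = ContinuousLinearMap.id ℝ (E n)) :
    ∃ (z : E n) (ρ : ℝ), 0 < ρ ∧ ‖z‖ ^ 2 = 1 + ρ ^ 2 ∧
      (∀ x ∈ closure Ω, u x = 1 / 2 * (‖x - z‖ ^ 2 - ρ ^ 2)) ∧
      ∀ x ∈ closure Ω \ (closure Sg ∩ closure T), G x = x - z := by
  obtain ⟨x₀, hx₀⟩ := h.isConnected.nonempty
  have hpre := h.isConnected.isPreconnected
  have hd1 : ∀ x ∈ Ω, HasFDerivAt (fun y => G y - y) (0 : E n →L[ℝ] E n) x := fun x hx => by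
    refine ((hj.hasFDerivAt_grad h hx).sub (hasFDerivAt_id x)).congr_fderiv ?_
    rw [hH x hx, sub_self]
  obtain ⟨z', hz'⟩ := h.isOpen.exists_is_const_of_fderiv_eq_zero hpre
    (fun x hx => (hd1 x hx).differentiableAt.differentiableWithinAt) fun x hx => (hd1 x hx).fderiv
  set z := -z' with hz
  have hG : ∀ x ∈ Ω, G x = x - z := fun x hx => by
    have : G x - x = z' := hz' x hx
    rw [hz, sub_neg_eq_add, ← this]
    abel
  have hd2 : ∀ x ∈ Ω, HasFDerivAt (fun y => u y - 1 / 2 * ‖y - z‖ ^ 2) (0 : E n →L[ℝ] ℝ) x :=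
    fun x hx => by
      refine ((hj.hasFDerivAt h hx).sub (hasFDerivAt_half_norm_sub_sq z x)).congr_fderiv ?_
      rw [hG x hx, sub_self]
  obtain ⟨a, ha⟩ := h.isOpen.exists_is_const_of_fderiv_eq_zero hpre
    (fun x hx => (hd2 x hx).differentiableAt.differentiableWithinAt) fun x hx => (hd2 x hx).fderiv
  have huc : EqOn u (fun x => 1 / 2 * ‖x - z‖ ^ 2 + a) (closure Ω) := by
    refine EqOn.of_subset_closure (s := Ω) (fun x hx => ?_) hu (by fun_prop) subset_closure le_rfl
    have : u x - 1 / 2 * ‖x - z‖ ^ 2 = a := ha x hx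
    rw [← this]
    ring
  have hGc : EqOn G (fun x => x - z) (closure Ω \ (closure Sg ∩ closure T)) :=
    EqOn.of_subset_closure (s := Ω) hG hj.contDiffOn_grad.continuousOn (by fun_prop)
      h.subset_closure_diff sdiff_subset
  obtain ⟨p, hp⟩ := h.cap_nonempty
  have hpK := h.cap_subset_closure_diff hp
  have hp1 := h.norm_eq_one_of_mem_cap hp
  -- The condition `⟪G p, p⟫ = u p` at a single point of the cap determines the constant: `-(2 * a)
  -- = ‖z‖ ^ 2 - 1`.
  have hst := hj.steklov p hp
  rw [hGc hpK, huc hpK.1] at hst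
  simp only [norm_sub_sq_real, inner_sub_left, real_inner_self_eq_norm_sq, hp1] at hst
  rw [real_inner_comm] at hst
  have haz : -(2 * a) = ‖z‖ ^ 2 - 1 := by linarith
  have hpos : 0 < -(2 * a) := by
    have h1 := hj.nonpos h hx₀
    rw [huc (subset_closure hx₀)] at h1
    have h1 : 1 / 2 * ‖x₀ - z‖ ^ 2 + a ≤ 0 := h1
    have h2 := sq_nonneg ‖x₀ - z‖
    -- If `a` were zero, then `x₀ = z` and `‖z‖ = 1`, although `x₀` is in the open unit ball.
    refine lt_of_le_of_ne (by linarith) fun h3 => ?_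
    have h4 : ‖x₀ - z‖ = 0 := by
      rw [← sq_eq_zero_iff]
      linarith
    rw [norm_eq_zero, sub_eq_zero] at h4
    have h5 := (h.subset_halfBall hx₀).1
    rw [h4] at h5
    nlinarith [norm_nonneg z]
  refine ⟨z, √(-(2 * a)), Real.sqrt_pos.2 hpos, ?_, fun x hx => ?_, hGc⟩
  · rw [Real.sq_sqrt hpos.le]
    linarith
  · rw [Real.sq_sqrt hpos.le, huc hx]
    ring

end IsSolutionJet

namespace IsCapDomain

variable {Ω Sg T : Set (E n)} {z : E n} {ρ : ℝ}

/-- The frontier of `Ω` lies on the two spheres, so it does not meet the intersection of the open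
balls, which is convex and contains `Ω`. -/
theorem eq_inter_ball (h : IsCapDomain Ω Sg T) (hρ : 0 < ρ) (hΩ : Ω ⊆ Metric.closedBall z ρ)
    (hSg : Sg ⊆ Metric.sphere z ρ) : Ω = Metric.ball 0 1 ∩ Metric.ball z ρ := by
  have hsub : Ω ⊆ Metric.ball 0 1 ∩ Metric.ball z ρ := by
    refine subset_inter h.subset_ball ?_
    rw [← interior_closedBall z hρ.ne']
    exact interior_maximal hΩ h.isOpen
  refine hsub.antisymm (subset_of_disjoint_frontier
    ((convex_ball 0 1).inter (convex_ball z ρ)).isPreconnected h.isOpen ?_ ?_)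
  · rw [inter_eq_right.2 hsub]
    exact h.isConnected.nonempty
  · refine disjoint_left.2 fun x hx hxf => ?_
    rw [h.frontier_eq] at hxf
    rcases hxf with hxf | hxf
    · have h1 := closure_minimal hSg Metric.isClosed_sphere hxf
      exact absurd (Metric.mem_sphere.1 h1) (Metric.mem_ball.1 hx.2).ne
    · exact absurd (h.norm_eq_one_of_mem_cap hxf) (mem_ball_zero_iff.1 hx.1).ne

theorem surface_eq_sphere (h : IsCapDomain Ω Sg T) (hρ : 0 < ρ)
    (hΩ : Ω = Metric.ball 0 1 ∩ Metric.ball z ρ) (hSg : Sg ⊆ Metric.sphere z ρ) :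
    Sg = {x | x ∈ halfBall n ∧ ‖x - z‖ = ρ} := by
  refine Subset.antisymm (fun x hx => ⟨h.surface_subset hx, mem_sphere_iff_norm.1 (hSg hx)⟩) ?_
  rintro x ⟨hx, hxz⟩
  rw [h.surface_eq]
  refine ⟨?_, fun hxT => ?_⟩
  · rw [h.isOpen.frontier_eq]
    refine ⟨?_, fun hxΩ => ?_⟩
    -- Moving `x` slightly towards `z` stays in the unit ball and enters the ball around `z`.
    · have hc : Tendsto (fun t : ℝ => x + t • (z - x)) (𝓝[>] 0) (𝓝 x) := by
        have : Continuous fun t : ℝ => x + t • (z - x) := by fun_prop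
        simpa using (this.tendsto 0).mono_left nhdsWithin_le_nhds
      refine mem_closure_of_tendsto hc ?_
      filter_upwards [hc.eventually (Metric.isOpen_ball.mem_nhds (mem_ball_zero_iff.2 hx.1)),
        Ioo_mem_nhdsGT one_pos] with t ht ht'
      rw [hΩ]
      refine ⟨ht, ?_⟩
      have h1 : x + t • (z - x) - z = (1 - t) • (x - z) := by module
      rw [mem_ball_iff_norm, h1, norm_smul, hxz, Real.norm_of_nonneg (by linarith [ht'.2])]
      nlinarith [ht'.1]
    · rw [hΩ] at hxΩ
      exact absurd hxz (mem_ball_iff_norm.1 hxΩ.2).ne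
  · exact absurd (mem_sphere_zero_iff_norm.1 (h.closure_cap_subset hxT)) hx.1.ne

/-- Otherwise the inverse point `y = z' / ‖z'‖²` has norm below 1 and satisfies `‖y - z‖² = ‖y‖² - 1
+ ρ² < ρ²`. It would lie in the lens `Ω`, although its last coordinate is zero. -/
theorem norm_horizontal_le (h : IsCapDomain Ω Sg T) (hρ : 0 < ρ) (hz : ‖z‖ ^ 2 = 1 + ρ ^ 2)
    (hΩ : Ω = Metric.ball 0 1 ∩ Metric.ball z ρ) : ‖horizontal z‖ ≤ 1 := by
  by_contra! hlt
  set w := ‖horizontal z‖ with hw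
  have hw0 : 0 < w := one_pos.trans hlt
  have hwi : w⁻¹ < 1 := inv_lt_one_of_one_lt₀ hlt
  have hort : ⟪horizontal z, eN n⟫ = 0 := by
    rw [horizontal, inner_sub_left, real_inner_smul_left, inner_eN_right,
      real_inner_self_eq_norm_sq, norm_eN]
    ring
  have hzz : ⟪horizontal z, z⟫ = w ^ 2 := by
    calc ⟪horizontal z, z⟫ = ⟪horizontal z, horizontal z + z (Fin.last n) • eN n⟫ := by
          rw [horizontal, sub_add_cancel]
      _ = w ^ 2 := by
          rw [inner_add_right, real_inner_self_eq_norm_sq, inner_smul_right, hort, mul_zero,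
            add_zero]
  set y : E n := (w ^ 2)⁻¹ • horizontal z with hy
  have hyn : ‖y‖ = w⁻¹ := by
    rw [hy, norm_smul, Real.norm_of_nonneg (by positivity), ← hw]
    field_simp
  have hyz : ‖y - z‖ ^ 2 < ρ ^ 2 := by
    rw [norm_sub_sq_real, hyn, hz, hy, real_inner_smul_left, hzz, inv_mul_cancel₀ (by positivity)]
    have : w⁻¹ ^ 2 < 1 := pow_lt_one₀ (by positivity) hwi two_ne_zero
    linarith
  have hyΩ : y ∈ Ω := by
    rw [hΩ]
    exact ⟨mem_ball_zero_iff.2 (hyn ▸ hwi), mem_ball_iff_norm.2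
      (lt_of_pow_lt_pow_left₀ 2 hρ.le hyz)⟩
  have h1 := (h.subset_halfBall hyΩ).2
  rw [← inner_eN_right, hy, real_inner_smul_left, hort, mul_zero] at h1
  exact lt_irrefl _ h1

theorem outwardNormal_surface (h : IsCapDomain Ω Sg T) (hρ : 0 < ρ)
    (hΩ : Ω = Metric.ball 0 1 ∩ Metric.ball z ρ) (hSg : Sg ⊆ Metric.sphere z ρ) {x : E n}
    (hx : x ∈ Sg) : outwardNormal Ω x = ρ⁻¹ • (x - z) := by
  have hxz : ‖x - z‖ = ρ := mem_sphere_iff_norm.1 (hSg hx)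
  set φ : E n → ℝ := fun y => 1 / 2 * ‖y - z‖ ^ 2 - 1 / 2 * ρ ^ 2 with hφ
  have hg : gradient φ x = x - z := by
    refine HasGradientAt.gradient ?_
    rw [hasGradientAt_iff_hasFDerivAt]
    refine ((hasFDerivAt_half_norm_sub_sq z x).sub_const _).congr_fderiv ?_
    ext v
    simp
  refine outwardNormal_eq ⟨φ, ⟨?_, ?_, Metric.ball 0 1, Metric.isOpen_ball,
    mem_ball_zero_iff.2 (h.surface_subset hx).1, ?_, fun y hy => ?_⟩, ?_⟩
  · simp [hφ, hxz]
  · rw [hg, ← norm_ne_zero_iff, hxz]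
    exact hρ.ne'
  · exact ((contDiff_const.mul ((contDiff_id.sub contDiff_const).norm_sq ℝ)).sub
      contDiff_const).contDiffOn
  · rw [hΩ, mem_inter_iff, and_iff_right hy, mem_ball_iff_norm, hφ,
      ← pow_lt_pow_iff_left₀ (norm_nonneg _) hρ.le two_ne_zero]
    constructor <;> intro h' <;> simp only at * <;> linarith
  · rw [hg, hxz]

/-- At a point `p` of both spheres the relation `‖z‖² = 1 + ρ²` is Pythagoras' theorem for the
vectors `p` and `p - z`. The normals extend continuously to the edge. -/
theorem meetOrthogonally (h : IsCapDomain Ω Sg T) (hρ : 0 < ρ) (hz : ‖z‖ ^ 2 = 1 + ρ ^ 2)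
    (hΩ : Ω = Metric.ball 0 1 ∩ Metric.ball z ρ) (hSg : Sg ⊆ Metric.sphere z ρ) :
    MeetOrthogonally Ω Sg T := by
  intro p hp
  have hp1 : ‖p‖ = 1 := mem_sphere_zero_iff_norm.1 (h.edge_subset_sphere hp)
  have hpz : ‖p - z‖ = ρ :=
    mem_sphere_iff_norm.1 (closure_minimal hSg Metric.isClosed_sphere hp.1)
  have h0 : ⟪ρ⁻¹ • (p - z), p⟫ = 0 := by
    have h1 := norm_sub_sq_real p z
    rw [hpz, hp1, hz] at h1
    rw [real_inner_smul_left, inner_sub_left, real_inner_self_eq_norm_sq, hp1,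
      real_inner_comm]
    have : 1 ^ 2 - ⟪p, z⟫ = 0 := by linarith
    rw [this, mul_zero]
  have hc : Continuous fun q : E n × E n => ⟪ρ⁻¹ • (q.1 - z), q.2⟫ := by fun_prop
  have ht := hc.tendsto (p, p)
  rw [h0, nhds_prod_eq] at ht
  refine (ht.mono_left (prod_mono nhdsWithin_le_nhds nhdsWithin_le_nhds)).congr' ?_
  filter_upwards [prod_mem_prod self_mem_nhdsWithin self_mem_nhdsWithin] with q hq
  rw [h.outwardNormal_surface hρ hΩ hSg hq.1, h.outwardNormal_cap hq.2]

end IsCapDomain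

/-- The field `x_N ∇u - u e_N` has divergence `N x_N`, is tangential on the cap, and has normal
component `ρ x_N` on `Sg`. This also shows that the denominator of `radius` is not zero. -/
theorem IsSolutionJet.radius_eq {Ω Sg T : Set (E n)} {u : E n → ℝ} {G : E n → E n}
    {H : E n → E n →L[ℝ] E n} (hj : IsSolutionJet Ω Sg T u G H) (h : IsCapDomain Ω Sg T) {ρ : ℝ}
    (hG : ∀ x ∈ Sg, ⟪G x, outwardNormal Ω x⟫ = ρ) (hρ : 0 < ρ) : radius Ω Sg = ρ := by
  have hflux : ∀ x ∈ Sg, ⟪x (Fin.last n) • G x - u x • eN n, outwardNormal Ω x⟫ =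
      ρ * x (Fin.last n) := fun x hx => by
    rw [hj.dirichlet x hx, zero_smul, sub_zero, real_inner_smul_left, hG x hx, mul_comm]
  have hint : IntegrableOn (fun x : E n => x (Fin.last n)) Ω := by
    refine integrableOn_of_continuousOn_of_bounded h.isOpen
      (Metric.isBounded_ball.subset h.subset_ball) (C := 1)
      (contDiff_last (k := 0)).continuous.continuousOn fun x hx => ?_
    rw [← inner_eN_right]
    refine (abs_real_inner_le_norm _ _).trans ?_
    rw [norm_eN, mul_one]
    exact (h.subset_halfBall hx).1.le
  obtain ⟨C, hC, hb⟩ := hj.exists_norm_flow_le h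
  have key := h.integral_divg_eq hj.contDiffOn_flow ?_ (fun x hx => hj.inner_flow_eq_zero hx)
    (fun x hx => ?_) ?_
  · rw [setIntegral_congr_fun h.isOpen.measurableSet fun x hx => hj.divg_flow h hx,
      setIntegral_congr_fun h.measurableSet_surface hflux, integral_const_mul,
      integral_const_mul] at key
    have hpos : 0 < ∫ x in Ω, x (Fin.last n) := by
      rw [setIntegral_pos_iff_support_of_nonneg_ae _ hint]
      · have : Ω ⊆ Function.support (fun x : E n => x (Fin.last n)) ∩ Ω := fun x hx =>
          ⟨(h.subset_halfBall hx).2.ne', hx⟩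
        exact (h.isOpen.measure_pos volume h.isConnected.nonempty).trans_le (measure_mono this)
      · exact (ae_restrict_iff' h.isOpen.measurableSet).2
          (Eventually.of_forall fun x hx => (h.subset_halfBall hx).2.le)
    have hne : ∫ x in Sg, x (Fin.last n) ∂μHE[n] ≠ 0 := by
      intro h0
      rw [h0, mul_zero] at key
      have : 0 < ((n : ℝ) + 1) * ∫ x in Ω, x (Fin.last n) := by positivity
      linarith
    rw [radius, key, mul_div_cancel_right₀ _ hne]
  · refine integrableOn_of_continuousOn_of_bounded h.isOpen
      (Metric.isBounded_ball.subset h.subset_ball) (C := (2 * C) ^ 2)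
      ((hj.contDiffOn_flow.continuousOn.mono h.subset_closure_diff).norm.pow 2) fun y hy => ?_
    rw [abs_of_nonneg (by positivity)]
    exact pow_le_pow_left₀ (norm_nonneg _) (hb y hy).2.2 2
  · rw [hflux x hx]
    exact mul_nonneg hρ.le (h.surface_subset hx).2.le
  · exact IntegrableOn.congr_fun (hint.const_mul ((n : ℝ) + 1))
      (fun x hx => (hj.divg_flow h hx).symm) h.isOpen.measurableSet

end HalfBallTorsion

/-! ### The theorem -/

theorem corollary2p5 (n : ℕ) (hn : 1 ≤ n) (Ω Sg T : Set (E n)) (hΩ : IsCapDomain Ω Sg T)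
    (u : E n → ℝ) (hu : IsSolution Ω Sg T u)
    (h : (∃ c : ℝ, IntegrableOn (rhsIntegrand Ω u c) Sg μHE[n] ∧ fundamentalRHS Ω Sg u c ≤ 0) ∨
      (∃ c : ℝ, ∀ x ∈ Sg, normalDeriv Ω u x = c)) :
    0 < radius Ω Sg ∧
    ∃ z : E n,
      ‖z‖ = Real.sqrt (1 + radius Ω Sg ^ 2) ∧
      ‖horizontal z‖ ≤ 1 ∧
      (∀ x ∈ Ω, u x = 1 / 2 * (‖x - z‖ ^ 2 - radius Ω Sg ^ 2)) ∧
      Sg = {x | x ∈ halfBall n ∧ ‖x - z‖ = radius Ω Sg} ∧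
      MeetOrthogonally Ω Sg T := by
  obtain ⟨c, hi, hc⟩ : ∃ c : ℝ, IntegrableOn (rhsIntegrand Ω u c) Sg μHE[n] ∧
      fundamentalRHS Ω Sg u c ≤ 0 := by
    rcases h with h | ⟨c, hc⟩
    · exact h
    -- With `c` the constant value of the normal derivative, the integrand vanishes identically on
    -- `Sg`.
    · have h0 : EqOn (rhsIntegrand Ω u c) 0 Sg := fun x hx => by simp [rhsIntegrand, hc x hx]
      refine ⟨c, integrableOn_zero.congr_fun h0.symm hΩ.measurableSet_surface, ?_⟩
      rw [fundamentalRHS, setIntegral_eq_zero_of_forall_eq_zero h0, mul_zero]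
  obtain ⟨G, H, hj⟩ := hu.exists_jet hΩ
  obtain ⟨z, ρ, hρ, hz, huz, hG⟩ := hj.exists_center hΩ hu.continuousOn
    fun x hx => hj.hess_eq_id hΩ hi hc hx
  have hSg : Sg ⊆ Metric.sphere z ρ := fun x hx => by
    have h1 := huz x (hΩ.surface_subset_closure_diff hx).1
    rw [hu.dirichlet x hx] at h1
    rw [mem_sphere_iff_norm, ← pow_left_inj₀ (norm_nonneg _) hρ.le two_ne_zero]
    linarith
  have hsub : Ω ⊆ Metric.closedBall z ρ := fun x hx => by
    have h1 := hj.nonpos hΩ hx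
    rw [huz x (subset_closure hx)] at h1
    rw [mem_closedBall_iff_norm, ← pow_le_pow_iff_left₀ (norm_nonneg _) hρ.le two_ne_zero]
    linarith
  have hlens := hΩ.eq_inter_ball hρ hsub hSg
  have hR : radius Ω Sg = ρ := by
    refine hj.radius_eq hΩ (fun x hx => ?_) hρ
    rw [hG x (hΩ.surface_subset_closure_diff hx), hΩ.outwardNormal_surface hρ hlens hSg hx,
      inner_smul_right, real_inner_self_eq_norm_sq, mem_sphere_iff_norm.1 (hSg hx), sq,
      inv_mul_cancel_left₀ hρ.ne']
  rw [hR]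
  refine ⟨hρ, z, ?_, hΩ.norm_horizontal_le hρ hz hlens, fun x hx => huz x (subset_closure hx),
    hΩ.surface_eq_sphere hρ hlens hSg, hΩ.meetOrthogonally hρ hz hlens hSg⟩
  rw [← hz, Real.sqrt_sq (norm_nonneg z)]
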